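/- A lune-free link graph is a finite simple connected $4$-regular plane graph; its vertices are called crossings. It is a knot graph if a single closed walk that leaves every vertex along the edge opposite (in the cyclic order at the vertex) to the edge of arrival traverses the whole graph. It is tight if of any two adjacent faces (faces sharing an edge) at least one has exactly $3$ edges on its boundary. Plane graphs are described by rotation systems of Euler characteristic $2$. Theorem 4. (1) There exists a tight lune-free link graph with $v$ crossings if and only if $v \geq 6$ and $v \not\equiv \pm 1 \bmod 6$. (2) There exists a tight lune-free knot graph with $v$ crossings if and only if $v \geq 8$, $v \not\equiv \pm 1 \bmod 6$, and $v \neq 12$. -/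

import Mathlib

/-- A rotation system on a graph: a cyclic order of the darts (oriented edges) leaving each vertex.
`next d` is the dart that follows `d` counterclockwise around the initial vertex of `d`. -/
structure RotationSystem {V : Type} (G : SimpleGraph V) where
  next : Equiv.Perm G.Dart
  next_fst : ∀ d, (next d).fst = d.fst
  sameCycle_of_fst_eq : ∀ d d', d.fst = d'.fst → next.SameCycle d d'

namespace RotationSystem

variable {V : Type} {G : SimpleGraph V} (R : RotationSystem G)

/-- Reversal of darts. -/
def rev (G : SimpleGraph V) : Equiv.Perm G.Dart where
  toFun d := d.symm
  invFun d := d.symm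
  left_inv d := d.symm_symm
  right_inv d := d.symm_symm

/-- The successor of a dart in the boundary walk of the face on its left: at the end of the dart,
turn to the neighbouring edge on the left, the one just before the reversed dart in the
counterclockwise order. -/
def faceStep : Equiv.Perm G.Dart := (rev G).trans R.next.symm

/-- The faces of the embedding described by the rotation system, given by their boundary walks,
the cycles of `faceStep`. -/
def Face : Type := Quotient (Equiv.Perm.SameCycle.setoid R.faceStep)

/-- The face on the left of a dart. -/
def leftFace (d : G.Dart) : R.Face := Quotient.mk _ d

/-- The number of edges on the boundary of a face (the length of its boundary walk). -/
noncomputable def faceDegree (F : R.Face) : ℕ := {d : G.Dart | R.leftFace d = F}.ncard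

/-- Two faces are adjacent if some edge has one of them on its left and the other on its right. -/
def FaceAdj (F F' : R.Face) : Prop := ∃ d : G.Dart, R.leftFace d = F ∧ R.leftFace d.symm = F'

/-- A rotation system on a finite connected graph with at least one edge describes an embedding
in the plane (equivalently, in the sphere) if the closed surface obtained by gluing a disc to each
face boundary is a sphere, that is, if it has Euler characteristic `2`. -/
def IsPlanar : Prop := Nat.card V + Nat.card R.Face = Nat.card G.edgeSet + 2

/-- The successor of a dart in a straight-ahead walk in a 4-regular graph: at the end of the dart,
leave along the edge that is opposite in the cyclic order, hence not adjacent to the edge of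
arrival. -/
def straight : Equiv.Perm G.Dart := ((rev G).trans R.next).trans R.next

end RotationSystem

/-- Lune-free link graphs: simple, 4-regular, connected plane graphs (finite). -/
structure LuneFreeLinkGraph (V : Type) [Finite V] where
  graph : SimpleGraph V
  connected : graph.Connected
  regular : ∀ x, (graph.neighborSet x).ncard = 4
  rotation : RotationSystem graph
  planar : rotation.IsPlanar

namespace LuneFreeLinkGraph

variable {V : Type} [Finite V] (L : LuneFreeLinkGraph V)

/-- Of any two adjacent faces, at least one is a triangle. -/
def Tight : Prop := ∀ F F' : L.rotation.Face, L.rotation.FaceAdj F F' →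
  L.rotation.faceDegree F = 3 ∨ L.rotation.faceDegree F' = 3

/-- Knot graphs: a single closed straight-ahead walk traverses every edge
(in one of its directions). -/
def IsKnot : Prop := ∃ d₀ : L.graph.Dart, ∀ d : L.graph.Dart,
  L.rotation.straight.SameCycle d₀ d ∨ L.rotation.straight.SameCycle d₀ d.symm

end LuneFreeLinkGraph

/-! The faces of a 4-regular plane graph have a checkerboard colouring. Let the graph be tight. If a
nontriangular face has only triangles opposite to it at its vertices, then these triangles and the
adjacent ones close up to the band of an antiprism, and the number `v` of crossings is twice the
length of the face (`QuarticMap.Tight.card_of_antiprism`). Otherwise all vertices are on, or across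
a triangle from, nontriangles of one colour, say black, and from this it follows that all white
faces are triangles (`QuarticMap.Tight.classification`). There are `2 * v` edges, each on exactly
one white triangle, so `3 ∣ v`. Hence `v` is even or divisible by three, and `v ≥ 5` as the graph is
simple and 4-regular; this leaves `v ≥ 6` and `v ≢ ±1` modulo `6`.

For `v = 6` all faces are triangles, and for `v = 12` the graph is an antiprism or its white faces
are triangles. In octahedra and antiprisms straight-ahead walks advance periodically along the band
of triangles (`QuarticMap.straight_four`), and those of the octahedron and of the antiprism with `12`
vertices are too short to traverse the whole graph. If `v = 12` and the white faces are triangles,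
consider the cubic graph `H` on the eight white faces, adjacent if they share a vertex. A function on
the vertices of `H` that is harmonic modulo two extends to the black faces so that its sum around
each crossing vanishes (`QuarticMap.Planar.exists_extension`); then the sum of its values on both
sides of an edge is invariant along straight-ahead walks. So for knot graphs only constants are
harmonic (`QuarticMap.Knot.const_of_harmonic`). Linear algebra over `𝔽₂` on the complement of `H`,
whose adjacency matrix is alternating of even size and has row sums zero, shows that then `H` is
`K₃,₃` with a vertex blown up to a triangle (`exists_triangle_of_kernel_const`). Its short cycles are
too few for the six black faces (`QuarticMap.Knot.false_of_card_eq_twelve`).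

Conversely, the antiprisms have any even number `v ≥ 6` of crossings, and they are knot graphs if
`3 ∤ v`. The medial graphs of cubic plane graphs are tight, since one colour of faces comes from the
vertices. Prisms over polygons with an odd number `m` of sides yield knot graphs with `3 * m`
crossings, and ladders closed up by a cap at each end, with `r` rungs, yield knot graphs with
`18 + 3 * r` crossings: a rung permutes the four strands along the rails in such a way that the two
caps never close up a proper part of them (`CappedLadder.forall_of_rungs`).

Plane graphs are treated as permutations of darts, as in `QuarticMap`. Euler's formula enters through
a duality over `𝔽₂` (`euler_inequality_and_exactness`): a connected map never has more faces than
on the sphere, and if it has as many, then cycles are boundaries. The first part reduces planarity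
of the examples to labelling sufficiently many faces; the second one gives the checkerboard colouring
and the extension of harmonic functions. -/

/-! ### Euler's inequality over the field with two elements -/

/-- A fixed-point-free involution has a transversal `P`: one element of each pair. -/
theorem exists_transversal {D : Type} [Fintype D] (τ : D → D) (h1 : ∀ d, τ (τ d) = d)
    (h2 : ∀ d, τ d ≠ d) : ∃ P : Finset D, 2 * P.card = Fintype.card D ∧
      (∀ f : D → ZMod 2, ∑ d, f d = ∑ p ∈ P, (f p + f (τ p))) ∧ ∀ d, d ∈ P ∨ τ d ∈ P := by
  classical
  let e := Fintype.equivFin D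
  let P : Finset D := Finset.univ.filter fun d => e d < e (τ d)
  have hP : ∀ d, d ∈ P ↔ e d < e (τ d) := fun d => by simp [P]
  have hc : P.image τ = Pᶜ := by
    ext d
    simp only [Finset.mem_image, Finset.mem_compl, hP]
    constructor
    · rintro ⟨x, hx, rfl⟩
      rw [h1]; exact not_lt.2 hx.le
    · intro h
      refine ⟨τ d, ?_, h1 d⟩
      rw [h1]
      exact lt_of_le_of_ne (not_lt.1 h) fun h' => h2 d (e.injective h')
  have hinj : Function.Injective τ := fun x y h => by rw [← h1 x, h, h1]
  refine ⟨P, ?_, fun f => ?_, fun d => ?_⟩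
  · have := Finset.card_image_of_injective P hinj
    rw [hc, Finset.card_compl] at this
    have := Finset.card_le_univ P
    omega
  · rw [Finset.sum_add_distrib, ← Finset.sum_image (f := f) (s := P) (g := τ) hinj.injOn, hc,
      Finset.sum_add_sum_compl]
  · rw [hP, hP, h1]
    exact lt_or_gt_of_ne fun h => h2 d (e.injective h.symm)

/-- The coboundary over `𝔽₂` of functions on the vertices of a graph: `τ` reverses the darts, `a`
sends a dart to its initial vertex, and `P` contains a dart of each edge. -/
def coboundary {D A : Type} (τ : D → D) (a : D → A) (P : Finset D) :
    (A → ZMod 2) →ₗ[ZMod 2] (P → ZMod 2) where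
  toFun s p := s (a p) + s (a (τ p))
  map_add' s t := by ext p; simp; ring
  map_smul' k s := by ext p; simp; ring

/-- In a connected graph, the kernel of the coboundary consists of the constants. -/
theorem card_le_finrank_range_coboundary {D A : Type} [Fintype A] (τ : D → D) (a : D → A)
    (P : Finset D) (h1 : ∀ d, τ (τ d) = d) (hP : ∀ d, d ∈ P ∨ τ d ∈ P)
    (hA : ∀ s : A → ZMod 2, (∀ d, s (a (τ d)) = s (a d)) → ∀ x y, s x = s y) :
    Fintype.card A ≤ Module.finrank (ZMod 2) (coboundary τ a P).range + 1 := by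
  have h := LinearMap.finrank_range_add_finrank_ker (coboundary τ a P)
  rw [Module.finrank_fintype_fun_eq_card] at h
  have hk : (coboundary τ a P).ker ≤ Submodule.span (ZMod 2) {fun _ => 1} := by
    intro s hs
    have hs' : ∀ d ∈ P, s (a (τ d)) = s (a d) := fun d hd => by
      have := congrFun (LinearMap.mem_ker.1 hs) ⟨d, hd⟩
      exact (CharTwo.add_eq_zero.1 this).symm
    have hc := hA s fun d => by
      rcases hP d with hd | hd
      · exact hs' d hd
      · have := hs' _ hd
        rw [h1] at this; exact this.symm
    rw [Submodule.mem_span_singleton]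
    rcases isEmpty_or_nonempty A with hE | ⟨⟨x⟩⟩
    · exact ⟨0, Subsingleton.elim _ _⟩
    · exact ⟨s x, funext fun y => by simp [hc y x]⟩
  have h1 : Module.finrank (ZMod 2) (coboundary τ a P).ker ≤ 1 :=
    (Submodule.finrank_mono hk).trans ((finrank_span_le_card _).trans (by simp))
  omega

/-- Euler's inequality for a connected graph on a closed surface, and what equality means. The darts
`D` are reversed by `τ` and permuted along the boundaries of the faces by `ψ`; `A` are the faces and
`C` the vertices, `a d` being the face on the left of `d` and `c d` the initial vertex. The
coboundaries of functions on faces are orthogonal to those of functions on vertices, so their ranks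
add up to at most the number of edges. If equality holds, then every cycle `z` modulo two is the
coboundary of a function on the faces. -/
theorem euler_inequality_and_exactness {D A C : Type} [Fintype D] [Fintype A] [Fintype C]
    (τ : D → D) (h1 : ∀ d, τ (τ d) = d) (h2 : ∀ d, τ d ≠ d) (ψ : Equiv.Perm D)
    (a : D → A) (c : D → C) (haψ : ∀ d, a (ψ d) = a d) (hcψ : ∀ d, c (ψ d) = c (τ d))
    (hA : ∀ s : A → ZMod 2, (∀ d, s (a (τ d)) = s (a d)) → ∀ x y, s x = s y)
    (hC : ∀ s : C → ZMod 2, (∀ d, s (c (τ d)) = s (c d)) → ∀ x y, s x = s y) :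
    2 * (Fintype.card A + Fintype.card C) ≤ Fintype.card D + 4 ∧
    (2 * (Fintype.card A + Fintype.card C) = Fintype.card D + 4 →
      ∀ z : D → ZMod 2, (∀ d, z (τ d) = z d) → (∀ t : C → ZMod 2, ∑ d, z d * t (c d) = 0) →
      ∃ s : A → ZMod 2, ∀ d, z d = s (a d) + s (a (τ d))) := by
  classical
  obtain ⟨P, hPc, hPs, hP⟩ := exists_transversal τ h1 h2
  let B : LinearMap.BilinForm (ZMod 2) (P → ZMod 2) := Matrix.toBilin' (1 : Matrix P P (ZMod 2))
  have hB : ∀ x y, B x y = ∑ p, x p * y p := fun x y => by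
    simp [B, Matrix.toBilin'_apply', dotProduct]
  have hBn : B.Nondegenerate := by
    simp only [B]
    exact Matrix.Nondegenerate.toBilin' (Matrix.nondegenerate_of_det_ne_zero (by simp))
  have hBr : B.IsRefl := fun x y h => by
    rw [hB] at h ⊢
    simpa [mul_comm] using h
  have hle : (coboundary τ a P).range ≤ B.orthogonal (coboundary τ c P).range := by
    rintro _ ⟨s, rfl⟩ _ ⟨t, rfl⟩
    change B _ _ = 0
    rw [hB]
    have h := hPs fun d => s (a d) * (t (c d) + t (c (τ d)))
    have h' : ∑ d, s (a d) * (t (c d) + t (c (τ d))) = 0 := by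
      simp_rw [mul_add, Finset.sum_add_distrib]
      rw [← Equiv.sum_comp ψ (fun d => s (a d) * t (c d))]
      simp_rw [haψ, hcψ]
      exact CharTwo.add_self_eq_zero _
    rw [h'] at h
    rw [h, ← Finset.sum_coe_sort P]
    refine Finset.sum_congr rfl fun p _ => ?_
    simp only [coboundary, LinearMap.coe_mk, AddHom.coe_mk, h1]
    ring
  have hra := card_le_finrank_range_coboundary τ a P h1 hP hA
  have hrc := card_le_finrank_range_coboundary τ c P h1 hP hC
  have ho := LinearMap.BilinForm.finrank_orthogonal hBn (coboundary τ c P).range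
  have hrc' := Submodule.finrank_le (coboundary τ c P).range
  have hm := Submodule.finrank_mono hle
  simp only [Module.finrank_fintype_fun_eq_card, Fintype.card_coe] at ho hrc'
  refine ⟨by omega, fun heq z hz1 hz2 => ?_⟩
  have hEq := Submodule.eq_of_le_of_finrank_le hle (by omega)
  have hzm : (fun p : P => z p) ∈ (coboundary τ a P).range := by
    rw [hEq]
    rintro _ ⟨t, rfl⟩
    change B _ _ = 0
    rw [hB]
    have h := hPs fun d => z d * t (c d)
    rw [hz2, ← Finset.sum_coe_sort P] at h
    rw [h]
    refine Finset.sum_congr rfl fun p _ => ?_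
    simp only [coboundary, LinearMap.coe_mk, AddHom.coe_mk, hz1]
    ring
  obtain ⟨s, hs⟩ := hzm
  refine ⟨s, fun d => ?_⟩
  rcases hP d with hd | hd
  · exact (congrFun hs ⟨d, hd⟩).symm
  · have := congrFun hs ⟨τ d, hd⟩
    simp only [coboundary, LinearMap.coe_mk, AddHom.coe_mk, hz1, h1] at this
    rw [← this, add_comm]

/-! ### Quartic maps -/

theorem ncard_sameCycle {D : Type} [Finite D] (f : Equiv.Perm D) (d : D) :
    {x | f.SameCycle d x}.ncard = Function.minimalPeriod f d := by
  classical
  have hd : d ∈ Function.periodicPts f := f.injective.mem_periodicPts d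
  have : {x | f.SameCycle d x} =
      (((Finset.range (Function.minimalPeriod f d)).image fun n => f^[n] d : Finset D) : Set D) := by
    ext x
    simp only [Set.mem_ofPred_eq, Finset.coe_image, Set.mem_image, Finset.mem_coe,
      Finset.mem_range]
    constructor
    · intro h
      obtain ⟨n, -, h⟩ := h.exists_pow_eq'
      refine ⟨n % Function.minimalPeriod f d,
        Nat.mod_lt _ (Function.minimalPeriod_pos_of_mem_periodicPts hd), ?_⟩
      rw [Function.iterate_mod_minimalPeriod_eq, ← h, Equiv.Perm.iterate_eq_pow]
    · rintro ⟨n, -, h⟩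
      exact ⟨n, by simpa [Equiv.Perm.iterate_eq_pow] using h⟩
  rw [this, Set.ncard_coe_finset, Finset.card_image_of_injOn, Finset.card_range]
  simpa [Set.InjOn] using Function.iterate_injOn_Iio_minimalPeriod (f := f) (x := d)

/-- A connected simple 4-regular map on an orientable surface, as permutations of its darts `D`: the
vertex `src d` at which a dart starts, the next dart `nx d` counterclockwise around that vertex, and
the reversed dart `rv d`. -/
structure QuarticMap (V D : Type) where
  src : D → V
  nx : Equiv.Perm D
  rv : Equiv.Perm D
  src_nx : ∀ d, src (nx d) = src d
  sameCycle : ∀ d d', src d = src d' → nx.SameCycle d d'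
  nx_four : ∀ d, nx (nx (nx (nx d))) = d
  nx_two_ne : ∀ d, nx (nx d) ≠ d
  rv_rv : ∀ d, rv (rv d) = d
  src_rv_ne : ∀ d, src (rv d) ≠ src d
  simple : ∀ d d', src d = src d' → src (rv d) = src (rv d') → d = d'
  src_surjective : Function.Surjective src
  connected : ∀ p : V → Prop, (∀ d, p (src d) → p (src (rv d))) → ∀ u v, p u → p v

namespace QuarticMap

variable {V D : Type} (M : QuarticMap V D)

/-- The next dart of the boundary walk of the face on the left. -/
def faceStep : Equiv.Perm D := M.rv.trans M.nx.symm

/-- The next dart of the straight-ahead walk. -/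
def straight : Equiv.Perm D := (M.rv.trans M.nx).trans M.nx

/-- The faces, as cycles of `faceStep`. -/
def Face : Type := Quotient (Equiv.Perm.SameCycle.setoid M.faceStep)

/-- The face on the left of a dart. -/
def face (d : D) : M.Face := Quotient.mk _ d

theorem face_eq_iff {d d' : D} : M.face d = M.face d' ↔ M.faceStep.SameCycle d d' :=
  Quotient.eq

theorem face_surjective : Function.Surjective M.face := Quotient.mk_surjective

theorem nx_faceStep (d : D) : M.nx (M.faceStep d) = M.rv d := by simp [faceStep]

theorem faceStep_rv_nx (d : D) : M.faceStep (M.rv (M.nx d)) = d := by simp [faceStep, M.rv_rv]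

theorem faceStep_rv (d : D) : M.faceStep (M.rv d) = M.nx (M.nx (M.nx d)) := by
  simp [faceStep, M.rv_rv, Equiv.symm_apply_eq, M.nx_four]

theorem straight_apply (d : D) : M.straight d = M.nx (M.nx (M.rv d)) := rfl

theorem src_faceStep (d : D) : M.src (M.faceStep d) = M.src (M.rv d) := by
  rw [← M.nx_faceStep, M.src_nx]

theorem face_faceStep (d : D) : M.face (M.faceStep d) = M.face d :=
  M.face_eq_iff.2 (Equiv.Perm.sameCycle_apply_left.2 (Equiv.Perm.SameCycle.refl _ _))

theorem face_rv_nx (d : D) : M.face (M.rv (M.nx d)) = M.face d := by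
  rw [← M.face_faceStep, faceStep_rv_nx]

theorem face_rv (d : D) : M.face (M.rv d) = M.face (M.nx (M.nx (M.nx d))) := by
  rw [← M.face_faceStep, faceStep_rv]

theorem rv_ne (d : D) : M.rv d ≠ d := fun h => M.src_rv_ne d (by rw [h])

theorem nx_ne (d : D) : M.nx d ≠ d := fun h => M.nx_two_ne d (by rw [h, h])

theorem faceStep_ne (d : D) : M.faceStep d ≠ d := fun h =>
  M.src_rv_ne d (by rw [← M.src_faceStep, h])

theorem faceStep_two_ne (d : D) : M.faceStep (M.faceStep d) ≠ d := fun h => by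
  have h1 : M.src (M.rv (M.faceStep d)) = M.src d := by rw [← M.src_faceStep, h]
  have h2 : M.rv d = M.faceStep d :=
    M.simple _ _ (M.src_faceStep d).symm (by rw [M.rv_rv, h1])
  have h3 := M.nx_faceStep d
  rw [← h2] at h3
  exact M.nx_ne _ h3

theorem eq_nx_of_src_eq {d d' : D} (h : M.src d = M.src d') :
    d' = d ∨ d' = M.nx d ∨ d' = M.nx (M.nx d) ∨ d' = M.nx (M.nx (M.nx d)) := by
  obtain ⟨i, hi⟩ := M.sameCycle d d' h
  have h4 : M.nx ^ (4 : ℤ) = 1 := by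
    ext x; exact M.nx_four x
  have : (M.nx ^ (i % 4)) d = d' := by
    rw [← hi]
    conv_rhs => rw [← Int.emod_add_mul_ediv i 4, zpow_add, zpow_mul, h4, one_zpow, mul_one]
  have h0 := Int.emod_nonneg i (by norm_num : (4 : ℤ) ≠ 0)
  have h5 := Int.emod_lt_of_pos i (by norm_num : (0 : ℤ) < 4)
  generalize i % 4 = j at *
  interval_cases j
  · exact Or.inl this.symm
  · exact Or.inr (Or.inl this.symm)
  · exact Or.inr (Or.inr (Or.inl this.symm))
  · exact Or.inr (Or.inr (Or.inr this.symm))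

/-- A property of darts that is preserved by rotation and by reversal holds for all darts or for
none. -/
theorem dart_induction {p : D → Prop} (hn : ∀ d, p d → p (M.nx d)) (hr : ∀ d, p d → p (M.rv d))
    {d : D} (hd : p d) (d' : D) : p d' := by
  have key : ∀ x y, M.src x = M.src y → p x → p y := fun x y hxy hx => by
    rcases M.eq_nx_of_src_eq hxy with rfl | rfl | rfl | rfl
    exacts [hx, hn _ hx, hn _ (hn _ hx), hn _ (hn _ (hn _ hx))]
  exact M.connected (fun v => ∀ x, M.src x = v → p x)
    (fun x hx y hy => key _ _ hy.symm (hr x (hx x rfl))) (M.src d) (M.src d')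
    (fun x hx => key _ _ hx.symm hd) d' rfl

theorem minimalPeriod_faceStep_eq_three_iff (d : D) :
    Function.minimalPeriod M.faceStep d = 3 ↔ M.faceStep (M.faceStep (M.faceStep d)) = d := by
  constructor
  · intro h
    have := Function.isPeriodicPt_minimalPeriod M.faceStep d
    rw [h] at this
    exact this
  · intro h
    have h3 : Function.IsPeriodicPt M.faceStep 3 d := h
    rcases (Nat.dvd_prime Nat.prime_three).1 h3.minimalPeriod_dvd with h1 | h1
    · exact absurd (Function.minimalPeriod_eq_one_iff_isFixedPt.1 h1) (M.faceStep_ne d)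
    · exact h1

/-- Every vertex has exactly four darts. -/
theorem card_fiber_src [Fintype D] [DecidableEq V] (v : V) :
    (Finset.univ.filter fun d => M.src d = v).card = 4 := by
  classical
  obtain ⟨d, rfl⟩ := M.src_surjective v
  have : (Finset.univ.filter fun x => M.src x = M.src d) =
      {d, M.nx d, M.nx (M.nx d), M.nx (M.nx (M.nx d))} := by
    ext x
    simp only [Finset.mem_filter_univ, Finset.mem_insert, Finset.mem_singleton]
    constructor
    · exact fun h => M.eq_nx_of_src_eq h.symm
    · rintro (rfl | rfl | rfl | rfl) <;> simp [M.src_nx]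
  have h1 := M.nx_ne
  have h2 := M.nx_two_ne
  have h3 : ∀ x, M.nx (M.nx (M.nx x)) ≠ x := fun x h => M.nx_ne x (by
    have := M.nx_four x
    rwa [h] at this)
  rw [this, Finset.card_insert_of_notMem, Finset.card_insert_of_notMem,
    Finset.card_insert_of_notMem, Finset.card_singleton] <;>
  simp [(h1 _).symm, (h2 _).symm, (h3 _).symm]

theorem card_dart {V D : Type} [Fintype D] [Fintype V] (M : QuarticMap V D) :
    Fintype.card D = 4 * Fintype.card V := by
  classical
  rw [← Finset.card_univ, Finset.card_eq_sum_card_fiberwise (f := M.src) (t := Finset.univ)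
    (fun _ _ => Finset.mem_univ _)]
  simp [M.card_fiber_src, mul_comm]

end QuarticMap

namespace LuneFreeLinkGraph

variable {V : Type} [Finite V] (L : LuneFreeLinkGraph V)

instance : Finite L.graph.Dart :=
  Finite.of_injective (fun d : L.graph.Dart => d.toProd) SimpleGraph.Dart.toProd_injective

theorem minimalPeriod_next (d : L.graph.Dart) :
    Function.minimalPeriod L.rotation.next d = 4 := by
  have hfst : ∀ x, L.rotation.next.SameCycle d x → x.fst = d.fst := by
    intro x hx
    obtain ⟨n, -, rfl⟩ := hx.exists_pow_eq'
    induction n with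
    | zero => rfl
    | succ n ih => rw [pow_succ', Equiv.Perm.mul_apply, L.rotation.next_fst, ih ⟨n, by simp⟩]
  rw [← ncard_sameCycle, ← L.regular d.fst]
  refine Set.ncard_congr (fun x _ => x.snd) ?_ ?_ ?_
  · intro x hx
    rw [SimpleGraph.mem_neighborSet, ← hfst x hx]
    exact x.adj
  · intro x y hx hy h
    exact SimpleGraph.Dart.ext _ _ (Prod.ext ((hfst x hx).trans (hfst y hy).symm) h)
  · intro y hy
    exact ⟨⟨(d.fst, y), hy⟩, L.rotation.sameCycle_of_fst_eq _ _ rfl, rfl⟩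

/-- The combinatorial map of a lune-free link graph. -/
def toQuarticMap : QuarticMap V L.graph.Dart where
  src d := d.fst
  nx := L.rotation.next
  rv := RotationSystem.rev L.graph
  src_nx := L.rotation.next_fst
  sameCycle := L.rotation.sameCycle_of_fst_eq
  nx_four d := by
    have := Function.isPeriodicPt_minimalPeriod L.rotation.next d
    rwa [L.minimalPeriod_next] at this
  nx_two_ne d h := by
    have h2 : Function.IsPeriodicPt L.rotation.next 2 d := h
    have := h2.minimalPeriod_le two_pos
    rw [L.minimalPeriod_next] at this
    omega
  rv_rv d := d.symm_symm
  src_rv_ne d := d.adj.ne'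
  simple d d' h h' := SimpleGraph.Dart.ext _ _ (Prod.ext h h')
  src_surjective x := by
    have h : (L.graph.neighborSet x).ncard ≠ 0 := by rw [L.regular x]; norm_num
    obtain ⟨y, hy⟩ := Set.nonempty_of_ncard_ne_zero h
    exact ⟨⟨(x, y), hy⟩, rfl⟩
  connected p hp u v hu := by
    obtain ⟨w⟩ := L.connected u v
    induction w with
    | nil => exact hu
    | cons h _ ih => exact ih (hp ⟨(_, _), h⟩ hu)

/-- The faces of the two descriptions are definitionally the same. -/
theorem faceDegree_leftFace (d : L.graph.Dart) :
    L.rotation.faceDegree (L.rotation.leftFace d) =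
      Function.minimalPeriod L.toQuarticMap.faceStep d := by
  rw [← ncard_sameCycle, RotationSystem.faceDegree]
  congr 1
  ext x
  exact L.toQuarticMap.face_eq_iff.trans Equiv.Perm.sameCycle_comm

theorem faceDegree_leftFace_eq_three_iff (d : L.graph.Dart) :
    L.rotation.faceDegree (L.rotation.leftFace d) = 3 ↔ L.toQuarticMap.faceStep
      (L.toQuarticMap.faceStep (L.toQuarticMap.faceStep d)) = d := by
  rw [faceDegree_leftFace, QuarticMap.minimalPeriod_faceStep_eq_three_iff]

theorem card_add_card_face :
    Nat.card V + Nat.card L.toQuarticMap.Face = 2 * Nat.card V + 2 := by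
  classical
  have := Fintype.ofFinite V
  have := Fintype.ofFinite L.graph.Dart
  have h : Nat.card V + Nat.card L.toQuarticMap.Face = Nat.card L.graph.edgeSet + 2 := L.planar
  have h1 := L.graph.dart_card_eq_twice_card_edges
  have h2 := L.toQuarticMap.card_dart
  rw [h, Nat.card_eq_fintype_card, Nat.card_eq_fintype_card, ← SimpleGraph.edgeFinset_card]
  have h3 : Fintype.card L.graph.Dart = 2 * L.graph.edgeFinset.card := by
    convert h1
  omega

theorem tight_iff : L.Tight ↔ ∀ d, L.toQuarticMap.faceStep
      (L.toQuarticMap.faceStep (L.toQuarticMap.faceStep d)) = d ∨ L.toQuarticMap.faceStep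
      (L.toQuarticMap.faceStep (L.toQuarticMap.faceStep (L.toQuarticMap.rv d))) =
        L.toQuarticMap.rv d := by
  simp only [← faceDegree_leftFace_eq_three_iff]
  constructor
  · exact fun h d => h _ _ ⟨d, rfl, rfl⟩
  · rintro h _ _ ⟨d, rfl, rfl⟩
    exact h d

end LuneFreeLinkGraph

/-! ### Checkerboard colourings -/

namespace QuarticMap

variable {V D : Type} (M : QuarticMap V D)

/-- The face on the left of `d` is a triangle. -/
def Tri (d : D) : Prop := M.faceStep (M.faceStep (M.faceStep d)) = d

/-- Of the two faces along any edge, at least one is a triangle. -/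
def Tight : Prop := ∀ d, M.Tri d ∨ M.Tri (M.rv d)

/-- The surface of the map is a sphere; the number of edges is twice the number of vertices. -/
def Planar : Prop := Nat.card M.Face = Nat.card V + 2

/-- Up to reversal, a single straight-ahead walk traverses all edges. -/
def Knot : Prop := ∃ d₀, ∀ d, M.straight.SameCycle d₀ d ∨ M.straight.SameCycle d₀ (M.rv d)

/-- A checkerboard colouring of the faces, as a function on the darts. -/
structure IsCheckerboard (c : D → Bool) : Prop where
  faceStep : ∀ d, c (M.faceStep d) = c d
  rv : ∀ d, c (M.rv d) = !c d

variable {M}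

theorem IsCheckerboard.nx {c : D → Bool} (hc : M.IsCheckerboard c) (d : D) :
    c (M.nx d) = !c d := by
  have h := hc.faceStep (M.rv (M.nx d))
  rw [M.faceStep_rv_nx, hc.rv] at h
  rw [h, Bool.not_not]

theorem IsCheckerboard.not {c : D → Bool} (hc : M.IsCheckerboard c) :
    M.IsCheckerboard fun d => !c d :=
  ⟨fun d => by rw [hc.faceStep], fun d => by rw [hc.rv]⟩

theorem IsCheckerboard.of_face_eq {c : D → Bool} (hc : M.IsCheckerboard c) {d d' : D}
    (h : M.face d = M.face d') : c d = c d' := by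
  obtain ⟨i, rfl⟩ := M.face_eq_iff.1 h
  induction i using Int.induction_on with
  | zero => rfl
  | succ i ih =>
    rw [add_comm, zpow_add, zpow_one, Equiv.Perm.mul_apply, hc.faceStep]
    exact ih (M.face_eq_iff.2 ⟨_, rfl⟩)
  | pred i ih =>
    have h1 : M.faceStep ((M.faceStep ^ (-(i : ℤ) - 1)) d) = (M.faceStep ^ (-(i : ℤ))) d := by
      rw [← Equiv.Perm.mul_apply, ← zpow_one_add]
      congr 2
      ring
    rw [ih (M.face_eq_iff.2 ⟨_, rfl⟩), ← h1, hc.faceStep]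

variable (M)

theorem const_of_face [Finite D] {A : Type} (s : M.Face → A)
    (h : ∀ d, s (M.face (M.rv d)) = s (M.face d)) (F F' : M.Face) : s F = s F' := by
  obtain ⟨d, rfl⟩ := M.face_surjective F
  obtain ⟨d', rfl⟩ := M.face_surjective F'
  refine M.dart_induction (p := fun x => s (M.face d) = s (M.face x)) ?_ ?_ rfl d'
  · intro x hx
    rw [hx, ← h (M.nx x), M.face_rv_nx]
  · intro x hx
    rw [hx, h]

theorem const_of_src {A : Type} (s : V → A) (h : ∀ d, s (M.src (M.rv d)) = s (M.src d))
    (v w : V) : s v = s w :=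
  M.connected (fun x => s v = s x) (fun d hd => hd.trans (h d).symm) v w rfl

instance [Finite D] : Finite M.Face := Quotient.finite _

/-- Euler's inequality for faces and vertices of a map. -/
theorem euler [Fintype D] [Fintype V] [Fintype M.Face] :
    2 * (Fintype.card M.Face + Fintype.card V) ≤ Fintype.card D + 4 ∧
    (2 * (Fintype.card M.Face + Fintype.card V) = Fintype.card D + 4 →
      ∀ z : D → ZMod 2, (∀ d, z (M.rv d) = z d) →
      (∀ t : V → ZMod 2, ∑ d, z d * t (M.src d) = 0) →
      ∃ s : M.Face → ZMod 2, ∀ d, z d = s (M.face d) + s (M.face (M.rv d))) :=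
  euler_inequality_and_exactness M.rv M.rv_rv M.rv_ne M.faceStep M.face M.src M.face_faceStep
    M.src_faceStep (fun s h => M.const_of_face s h) fun s h => M.const_of_src s h

/-- A map has at most as many faces as a map on the sphere. -/
theorem card_face_le [Finite D] [Finite V] : Nat.card M.Face ≤ Nat.card V + 2 := by
  have := Fintype.ofFinite D
  have := Fintype.ofFinite V
  have := Fintype.ofFinite M.Face
  have h := M.euler.1
  rw [M.card_dart] at h
  rw [Nat.card_eq_fintype_card, Nat.card_eq_fintype_card]
  omega

/-- All vertices having even degree, the set of all edges is a cycle modulo two, so it separates the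
faces into two colours. -/
theorem Planar.exists_checkerboard [Finite D] [Finite V] (h : M.Planar) :
    ∃ c, M.IsCheckerboard c := by
  classical
  have := Fintype.ofFinite D
  have := Fintype.ofFinite V
  have := Fintype.ofFinite M.Face
  have hcard : 2 * (Fintype.card M.Face + Fintype.card V) = Fintype.card D + 4 := by
    rw [Planar, Nat.card_eq_fintype_card, Nat.card_eq_fintype_card] at h
    rw [M.card_dart]
    omega
  obtain ⟨s, hs⟩ := M.euler.2 hcard (fun _ => 1) (fun _ => rfl) fun t => by
    rw [← Finset.sum_fiberwise_of_maps_to (s := Finset.univ) (t := Finset.univ) (g := M.src)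
      (fun _ _ => Finset.mem_univ _)]
    refine Finset.sum_eq_zero fun v _ => ?_
    rw [Finset.sum_congr rfl (g := fun _ => t v)
      (fun d hd => by rw [(Finset.mem_filter.1 hd).2, one_mul]), Finset.sum_const, M.card_fiber_src]
    rw [show 4 = 2 * 2 from rfl, mul_smul, CharTwo.two_nsmul]
  refine ⟨fun d => decide (s (M.face d) = 0), fun d => by rw [M.face_faceStep], fun d => ?_⟩
  have h1 := hs d
  generalize s (M.face d) = x at *
  generalize s (M.face (M.rv d)) = y at *
  revert x y
  decide

/-! ### Triangles -/

variable {M}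

theorem tri_faceStep {d : D} : M.Tri (M.faceStep d) ↔ M.Tri d :=
  M.faceStep.injective.eq_iff

theorem tri_congr {d d' : D} (h : M.face d = M.face d') : M.Tri d ↔ M.Tri d' := by
  obtain ⟨i, rfl⟩ := M.face_eq_iff.1 h
  clear h
  have : M.Tri ((M.faceStep ^ i) d) ↔ (M.faceStep ^ i) ((M.faceStep ^ 3) d) = (M.faceStep ^ i) d := by
    rw [← Equiv.Perm.mul_apply, ← zpow_natCast, (Commute.zpow_zpow_self M.faceStep i _).eq]
    rfl
  rw [this, EmbeddingLike.apply_eq_iff_eq]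
  rfl

theorem Tight.tri_or_tri_nx (ht : M.Tight) (d : D) : M.Tri d ∨ M.Tri (M.nx d) := by
  rw [← tri_congr (M.face_rv_nx d)]
  exact (ht _).symm

theorem Tight.tri_nx (ht : M.Tight) {d : D} (h : ¬ M.Tri d) : M.Tri (M.nx d) :=
  (ht.tri_or_tri_nx d).resolve_left h

theorem Tight.tri_nx_three (ht : M.Tight) {d : D} (h : ¬ M.Tri d) :
    M.Tri (M.nx (M.nx (M.nx d))) :=
  (ht.tri_or_tri_nx _).resolve_right (by rwa [M.nx_four])

theorem Tight.tri_rv (ht : M.Tight) {d : D} (h : ¬ M.Tri d) : M.Tri (M.rv d) :=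
  (ht d).resolve_left h

variable (M)

/-- If the face on the right of `d` is a triangle: the dart that leaves the third corner of this
triangle towards the end of `d`. -/
def apex (d : D) : D := M.faceStep (M.faceStep (M.rv d))

variable {M}

theorem nx_apex (d : D) : M.nx (M.apex d) = M.rv (M.nx (M.nx (M.nx d))) := by
  rw [apex, M.nx_faceStep, M.faceStep_rv]

theorem apex_eq {d : D} (h : M.Tri (M.rv d)) :
    M.apex d = M.rv (M.nx (M.nx (M.faceStep d))) := by
  apply M.faceStep.injective
  rw [M.faceStep_rv_nx, M.nx_faceStep]
  exact h

theorem face_nx_apex (d : D) : M.face (M.nx (M.apex d)) = M.face (M.nx (M.nx d)) := by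
  rw [nx_apex, M.face_rv_nx]

theorem face_nx_three_apex {d : D} (h : M.Tri (M.rv d)) :
    M.face (M.nx (M.nx (M.nx (M.apex d)))) = M.face (M.nx (M.nx (M.faceStep d))) := by
  rw [← M.face_rv, apex_eq h, M.rv_rv]

/-- The apices of the triangles across two consecutive edges of a face are adjacent if the face
opposite to that face at the vertex in between is a triangle. -/
theorem nx_two_apex_faceStep {d : D} (h : M.Tri (M.rv d))
    (hg : M.Tri (M.nx (M.nx (M.faceStep d)))) :
    M.nx (M.nx (M.apex (M.faceStep d))) = M.rv (M.nx (M.nx (M.nx (M.apex d)))) := by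
  have h1 : M.faceStep (M.nx (M.nx (M.faceStep d))) = M.nx (M.nx (M.nx (M.apex d))) := by
    rw [← M.faceStep_rv, apex_eq h, M.rv_rv]
  have h2 : M.nx (M.apex (M.faceStep d)) =
      M.faceStep (M.faceStep (M.nx (M.nx (M.faceStep d)))) := by
    apply M.rv.injective
    rw [nx_apex, M.rv_rv, ← M.nx_faceStep, hg]
  rw [h2, M.nx_faceStep, h1]

theorem faceStep_nx_two_apex_faceStep {d : D} (h : M.Tri (M.rv d))
    (hg : M.Tri (M.nx (M.nx (M.faceStep d)))) :
    M.faceStep (M.nx (M.nx (M.apex (M.faceStep d)))) = M.nx (M.nx (M.apex d)) := by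
  rw [nx_two_apex_faceStep h hg, M.faceStep_rv_nx]

/-- Let the face of `d` not be a triangle, and let some face opposite to it at a vertex not be one
either. Then the faces opposite to the adjacent triangles, at their apices, are triangles: such a
face is adjacent to the faces opposite to the nontriangle at the ends of the edge, and as long as
the latter are triangles, it is the same face for consecutive edges. -/
theorem Tight.tri_nx_two_apex (ht : M.Tight) {d : D} (hd : ¬ M.Tri d)
    (hg : ∃ y, M.faceStep.SameCycle d y ∧ ¬ M.Tri (M.nx (M.nx y))) [Finite D] :
    M.Tri (M.nx (M.nx (M.apex d))) := by
  obtain ⟨y, hy, hgy⟩ := hg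
  have hyd : ¬ M.Tri y := by rwa [← tri_congr (M.face_eq_iff.2 hy)]
  obtain ⟨i, -, rfl⟩ := hy.symm.exists_pow_eq'
  clear hd hy
  induction i with
  | zero =>
    refine (ht.tri_or_tri_nx _).resolve_left ?_
    rwa [tri_congr (face_nx_apex _)]
  | succ i ih =>
    rw [pow_succ', Equiv.Perm.mul_apply]
    have hn : ¬ M.Tri ((M.faceStep ^ i) y) := by
      rwa [← tri_congr (M.face_eq_iff.2 ⟨(i : ℤ), by rw [zpow_natCast]⟩ : M.face y = _)]
    by_cases hg : M.Tri (M.nx (M.nx (M.faceStep ((M.faceStep ^ i) y))))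
    · rwa [← tri_faceStep, faceStep_nx_two_apex_faceStep (ht.tri_rv hn) hg]
    · refine (ht.tri_or_tri_nx _).resolve_left ?_
      rwa [tri_congr (face_nx_apex _)]

/-! ### Classification of tight maps -/

section Classification

variable {c : D → Bool}

theorem IsCheckerboard.nx_nx (hc : M.IsCheckerboard c) (d : D) : c (M.nx (M.nx d)) = c d := by
  rw [hc.nx, hc.nx, Bool.not_not]

theorem IsCheckerboard.apex (hc : M.IsCheckerboard c) (d : D) : c (M.apex d) = !c d := by
  rw [QuarticMap.apex, hc.faceStep, hc.faceStep, hc.rv]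

/-- Some dart at the initial vertex of `d` has a face of colour `b` on its left that is no
triangle. -/
def TouchesNontriangle (M : QuarticMap V D) (c : D → Bool) (b : Bool) (d : D) : Prop :=
  ∃ x, M.src x = M.src d ∧ c x = b ∧ ¬ M.Tri x

/-- The initial vertex of `d` lies on a nontriangle of colour `b`, or it is the apex of a triangle
adjacent to one. -/
def NearNontriangle (M : QuarticMap V D) (c : D → Bool) (b : Bool) (d : D) : Prop :=
  M.TouchesNontriangle c b d ∨ ∃ x, c x = b ∧ ¬ M.Tri x ∧ M.src (M.apex x) = M.src d

theorem TouchesNontriangle.near_rv (hc : M.IsCheckerboard c) (ht : M.Tight) {b : Bool} {d : D}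
    (h : M.TouchesNontriangle c b d) : M.NearNontriangle c b (M.rv d) := by
  obtain ⟨x, hx, hxb, hxt⟩ := h
  obtain ⟨x', rfl⟩ := M.faceStep.surjective x
  have hx'b : c x' = b := by rw [← hxb, hc.faceStep]
  have hx't : ¬ M.Tri x' := fun h => hxt (tri_faceStep.2 h)
  rcases M.eq_nx_of_src_eq hx with rfl | rfl | rfl | rfl
  · exact Or.inl ⟨M.faceStep (M.faceStep x'), by rw [M.src_faceStep], by rw [hc.faceStep, hxb],
      by rwa [tri_faceStep]⟩
  · exact Or.inl ⟨x', by rw [M.nx_faceStep, M.rv_rv], hx'b, hx't⟩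
  · exact Or.inr ⟨x', hx'b, hx't, by rw [apex_eq (ht.tri_rv hx't)]⟩
  · exact Or.inr ⟨M.faceStep x', hxb, hxt, by rw [← nx_apex, M.src_nx]⟩

/-- In a tight map, the vertices near the nontriangles of one colour are closed under adjacency. -/
theorem near_rv (hc : M.IsCheckerboard c) (ht : M.Tight) {b : Bool} {d : D}
    (h : M.NearNontriangle c b d) : M.NearNontriangle c b (M.rv d) := by
  rcases h with h | ⟨x, hxb, hxt, hx⟩
  · exact h.near_rv hc ht
  have touch : ∀ y, c y = b → ¬ M.Tri y → M.src y = M.src d →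
      M.NearNontriangle c b (M.rv d) := fun y hy hyt hyd =>
    TouchesNontriangle.near_rv hc ht ⟨y, hyd, hy, hyt⟩
  rcases M.eq_nx_of_src_eq hx with rfl | rfl | rfl | rfl
  · refine Or.inl ⟨M.faceStep x, ?_, by rw [hc.faceStep, hxb], by rwa [tri_faceStep]⟩
    rw [apex_eq (ht.tri_rv hxt), M.rv_rv, M.src_nx, M.src_nx]
  · exact Or.inl ⟨x, by rw [nx_apex, M.rv_rv, M.src_nx, M.src_nx, M.src_nx], hxb, hxt⟩
  · obtain ⟨x', rfl⟩ := M.faceStep.surjective x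
    have hx't : ¬ M.Tri x' := fun h => hxt (tri_faceStep.2 h)
    by_cases hg : M.Tri (M.nx (M.nx (M.faceStep x')))
    · refine Or.inr ⟨x', by rw [← hxb, hc.faceStep], hx't, ?_⟩
      rw [nx_two_apex_faceStep (ht.tri_rv hx't) hg, M.rv_rv, M.src_nx, M.src_nx, M.src_nx]
    · refine touch (M.nx (M.apex (M.faceStep x'))) (by rw [hc.nx, hc.apex, Bool.not_not, hxb]) ?_
        (M.src_nx _).symm
      rwa [tri_congr (face_nx_apex _)]
  · by_cases hg : M.Tri (M.nx (M.nx (M.faceStep x)))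
    · refine Or.inr ⟨M.faceStep x, by rw [hc.faceStep, hxb], by rwa [tri_faceStep], ?_⟩
      rw [← nx_two_apex_faceStep (ht.tri_rv hxt) hg, M.src_nx, M.src_nx]
    · refine touch (M.nx (M.nx (M.nx (M.apex x))))
        (by rw [hc.nx_nx, hc.nx, hc.apex, Bool.not_not, hxb]) ?_ rfl
      rwa [tri_congr (face_nx_three_apex (ht.tri_rv hxt))]

/-- If there are nontriangles of colour `b` and each of them is opposite, at some vertex, to
another one, then all faces of the other colour are triangles. -/
theorem tri_of_opposite_nontriangles [Finite D] (hc : M.IsCheckerboard c) (ht : M.Tight)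
    {b : Bool} {d₀ : D} (hb : c d₀ = b) (hd₀ : ¬ M.Tri d₀)
    (hg : ∀ x, c x = b → ¬ M.Tri x → ∃ y, M.faceStep.SameCycle x y ∧ ¬ M.Tri (M.nx (M.nx y)))
    (d : D) (hd : c d = !b) : M.Tri d := by
  have near : M.NearNontriangle c b d := by
    refine M.dart_induction (p := M.NearNontriangle c b) (fun x hx => ?_)
      (fun x hx => near_rv hc ht hx) (Or.inl ⟨d₀, rfl, hb, hd₀⟩) d
    simpa only [NearNontriangle, TouchesNontriangle, M.src_nx] using hx
  have hne : ∀ e, c e = b → e ≠ d := fun e he h => by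
    rw [← h, he] at hd; exact (Bool.not_ne_self b).symm hd
  rcases near with ⟨x, hx, hxb, hxt⟩ | ⟨x, hxb, hxt, hx⟩
  · rcases M.eq_nx_of_src_eq hx with rfl | rfl | rfl | rfl
    · exact absurd rfl (hne _ hxb)
    · exact ht.tri_nx hxt
    · exact absurd rfl (hne _ (by rw [hc.nx_nx, hxb]))
    · exact ht.tri_nx_three hxt
  · rcases M.eq_nx_of_src_eq hx with rfl | rfl | rfl | rfl
    · rw [apex, tri_faceStep, tri_faceStep]
      exact ht.tri_rv hxt
    · exact absurd rfl (hne _ (by rw [hc.nx, hc.apex, Bool.not_not, hxb]))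
    · exact ht.tri_nx_two_apex hxt (hg x hxb hxt)
    · exact absurd rfl (hne _ (by rw [hc.nx_nx, hc.nx, hc.apex, Bool.not_not, hxb]))

/-- The tight maps: either all faces of one colour are triangles, or all faces opposite to some
nontriangle are triangles. -/
theorem Tight.classification [Finite D] (hc : M.IsCheckerboard c) (ht : M.Tight) :
    (∃ b, ∀ d, c d = b → M.Tri d) ∨
      ∃ d, ¬ M.Tri d ∧ ∀ y, M.faceStep.SameCycle d y → M.Tri (M.nx (M.nx y)) := by
  by_cases h : ∃ d, c d = true ∧ ¬ M.Tri d
  · by_cases h' : ∃ d, ¬ M.Tri d ∧ ∀ y, M.faceStep.SameCycle d y → M.Tri (M.nx (M.nx y))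
    · exact Or.inr h'
    · push Not at h'
      obtain ⟨d, hd, hdt⟩ := h
      exact Or.inl ⟨false, fun x hx =>
        tri_of_opposite_nontriangles hc ht hd hdt (fun y _ hy => h' y hy) x hx⟩
  · push Not at h
    exact Or.inl ⟨true, h⟩

theorem SameCycle.nontri {d y : D} (hd : ¬ M.Tri d) (hy : M.faceStep.SameCycle d y) : ¬ M.Tri y := by
  rwa [← tri_congr (M.face_eq_iff.2 hy)]

/-- If all faces opposite to a nontriangle are triangles, then the map is an antiprism: the vertices
of the nontriangle and the apices of the adjacent triangles are all the vertices. -/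
theorem Tight.card_of_antiprism [Finite D] (hc : M.IsCheckerboard c) (ht : M.Tight) {d : D}
    (hd : ¬ M.Tri d) (hg : ∀ y, M.faceStep.SameCycle d y → M.Tri (M.nx (M.nx y))) :
    Nat.card V = 2 * Function.minimalPeriod M.faceStep d := by
  rw [← ncard_sameCycle, ← Nat.card_coe_set_eq]
  have hO : ∀ x : {x | M.faceStep.SameCycle d x}, ¬ M.Tri x ∧ M.Tri (M.nx (M.nx x)) ∧ c x = c d :=
    fun x => ⟨SameCycle.nontri hd x.2, hg x x.2, (hc.of_face_eq (M.face_eq_iff.2 x.2)).symm⟩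
  have pred : ∀ x : {x | M.faceStep.SameCycle d x}, ∃ y : {x | M.faceStep.SameCycle d x},
      M.faceStep y = x := fun x =>
    ⟨⟨M.faceStep.symm x, Equiv.Perm.sameCycle_symm_apply_right.2 x.2⟩, by simp⟩
  have succ : ∀ x : {x | M.faceStep.SameCycle d x}, M.faceStep.SameCycle d (M.faceStep x) :=
    fun x => Equiv.Perm.sameCycle_apply_right.2 x.2
  have hapex : ∀ x : {x | M.faceStep.SameCycle d x}, c (M.apex x) = !c d := fun x => by
    rw [hc.apex, (hO x).2.2]
  have ha1 : ∀ x : {x | M.faceStep.SameCycle d x}, M.Tri (M.nx (M.apex x)) := fun x => by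
    rw [tri_congr (face_nx_apex _)]; exact (hO x).2.1
  have ha3 : ∀ x : {x | M.faceStep.SameCycle d x}, M.Tri (M.nx (M.nx (M.nx (M.apex x)))) :=
    fun x => by
      rw [tri_congr (face_nx_three_apex (ht.tri_rv (hO x).1))]; exact (hO ⟨_, succ x⟩).2.1
  have hrv : ∀ x : {x | M.faceStep.SameCycle d x}, M.rv (M.faceStep (M.apex x)) = x := fun x => by
    have : M.faceStep (M.apex x) = M.rv x := ht.tri_rv (hO x).1
    rw [this, M.rv_rv]
  -- The vertices of the face (`false`) and the apices (`true`).
  let f : {x | M.faceStep.SameCycle d x} × Bool → V :=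
    fun p => if p.2 then M.src (M.apex p.1) else M.src (p.1 : D)
  have hcross : ∀ x y : {x | M.faceStep.SameCycle d x}, M.src (M.apex x) ≠ M.src (y : D) := by
    intro x y h
    have hy := hO y
    have h1 := ha1 x
    have h3 := ha3 x
    have hcx := hapex x
    rcases M.eq_nx_of_src_eq h with h | h | h | h
    · rw [← h, hy.2.2] at hcx; simp at hcx
    · rw [← h] at h1; exact hy.1 h1
    · have := hy.2.2
      rw [h, hc.nx_nx, hcx] at this; simp at this
    · rw [← h] at h3; exact hy.1 h3
  have hinj : Function.Injective f := by
    rintro ⟨x, i⟩ ⟨y, j⟩ h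
    have hx := hO x
    have hy := hO y
    cases i <;> cases j <;> simp only [f, Bool.false_eq_true, if_false, if_true] at h
    · refine Prod.ext (Subtype.ext ?_) rfl
      rcases M.eq_nx_of_src_eq h with h | h | h | h
      · exact h.symm
      · have := hc.nx x
        rw [← h, hx.2.2, hy.2.2] at this; simp at this
      · rw [← h] at hx; exact absurd hx.2.1 hy.1
      · have := hc.nx (M.nx (M.nx x))
        rw [← h, hc.nx_nx, hx.2.2, hy.2.2] at this; simp at this
    · exact absurd h.symm (hcross _ _)
    · exact absurd h (hcross _ _)
    · refine Prod.ext (Subtype.ext ?_) rfl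
      rcases M.eq_nx_of_src_eq h with h | h | h | h
      · rw [← hrv x, ← hrv y, h]
      · have := hc.nx (M.apex x)
        rw [← h, hapex, hapex] at this; simp at this
      · exfalso
        obtain ⟨x', hx'⟩ := pred x
        obtain ⟨x'', hx''⟩ := pred x'
        have h1 := hrv y
        rw [h, ← hx', faceStep_nx_two_apex_faceStep (ht.tri_rv (hO x').1) (by
          rw [hx']; exact hx.2.1), ← hx'', nx_two_apex_faceStep (ht.tri_rv (hO x'').1) (by
          rw [hx'']; exact (hO x').2.1), M.rv_rv] at h1
        exact hy.1 (h1 ▸ ha3 x'')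
      · have := hc.nx (M.nx (M.nx (M.apex x)))
        rw [← h, hc.nx_nx, hapex, hapex] at this; simp at this
  have hsurj : Function.Surjective f := by
    intro v
    obtain ⟨e, rfl⟩ := M.src_surjective v
    refine M.dart_induction (p := fun e => ∃ p, f p = M.src e) ?_ ?_
      ⟨(⟨d, Equiv.Perm.SameCycle.refl _ _⟩, false), rfl⟩ e
    · intro x hx
      rwa [M.src_nx]
    · rintro e ⟨⟨x, _ | _⟩, h⟩ <;>
        simp only [f, Bool.false_eq_true, if_false, if_true] at h
      · obtain ⟨y, hy⟩ := pred x
        rcases M.eq_nx_of_src_eq h with rfl | rfl | rfl | rfl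
        · exact ⟨(⟨_, succ x⟩, false), M.src_faceStep _⟩
        · exact ⟨(y, false), by rw [← hy, M.nx_faceStep, M.rv_rv]; rfl⟩
        · exact ⟨(y, true), by rw [← hy, ← apex_eq (ht.tri_rv (hO y).1)]; rfl⟩
        · exact ⟨(x, true), by rw [← nx_apex, M.src_nx]; rfl⟩
      · obtain ⟨y, hy⟩ := pred x
        rcases M.eq_nx_of_src_eq h with rfl | rfl | rfl | rfl
        · refine ⟨(⟨_, succ x⟩, false), ?_⟩
          rw [apex_eq (ht.tri_rv (hO x).1), M.rv_rv, M.src_nx, M.src_nx]; rfl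
        · refine ⟨(x, false), ?_⟩
          rw [nx_apex, M.rv_rv, M.src_nx, M.src_nx, M.src_nx]; rfl
        · refine ⟨(y, true), ?_⟩
          rw [← hy, nx_two_apex_faceStep (ht.tri_rv (hO y).1) (by rw [hy]; exact (hO x).2.1),
            M.rv_rv, M.src_nx, M.src_nx, M.src_nx]; rfl
        · refine ⟨(⟨_, succ x⟩, true), ?_⟩
          rw [← nx_two_apex_faceStep (ht.tri_rv (hO x).1) (hO ⟨_, succ x⟩).2.1, M.src_nx,
            M.src_nx]; rfl
  have := Nat.card_eq_of_bijective f ⟨hinj, hsurj⟩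
  rw [Nat.card_prod, Nat.card_eq_fintype_card (α := Bool), Fintype.card_bool] at this
  rw [← this, mul_comm]

/-- Four straight steps in a band of triangles advance by three steps along its boundary. -/
theorem straight_four {d : D} (h1 : M.Tri (M.rv (M.faceStep d)))
    (h2 : M.Tri (M.rv (M.faceStep (M.faceStep d))))
    (hg : M.Tri (M.nx (M.nx (M.faceStep (M.faceStep d))))) :
    M.straight (M.straight (M.straight (M.straight d))) =
      M.faceStep (M.faceStep (M.faceStep d)) := by
  rw [M.straight_apply d, ← M.nx_faceStep, M.straight_apply (M.nx _), ← nx_apex,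
    M.straight_apply (M.nx _), ← nx_two_apex_faceStep h1 hg, M.nx_four, M.straight_apply,
    apex_eq h2, M.rv_rv, M.nx_four]

/-- A straight-ahead walk traverses each edge of a knot map, in one direction at least. -/
theorem Knot.card_dart_le [Finite D] (hk : M.Knot) (d : D) :
    Nat.card D ≤ 2 * Function.minimalPeriod M.straight d := by
  obtain ⟨d₀, h⟩ := hk
  have hr : ∀ x, M.rv (M.straight x) = M.straight.symm (M.rv x) := fun x => by
    rw [Equiv.eq_symm_apply, M.straight_apply, M.rv_rv, M.straight_apply, M.nx_four]
  have hr' : ∀ x y, M.straight.SameCycle x y → M.straight.SameCycle (M.rv x) (M.rv y) := by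
    intro x y hxy
    obtain ⟨i, -, rfl⟩ := hxy.exists_pow_eq'
    induction i with
    | zero => rfl
    | succ i ih =>
      rw [pow_succ', Equiv.Perm.mul_apply, hr, Equiv.Perm.sameCycle_symm_apply_right]
      exact ih ⟨i, by simp⟩
  have hd : ∀ x, M.straight.SameCycle d x ∨ M.straight.SameCycle d (M.rv x) := fun x => by
    rcases h d with h1 | h1 <;> rcases h x with h2 | h2
    · exact Or.inl (h1.symm.trans h2)
    · exact Or.inr (h1.symm.trans h2)
    · refine Or.inr ?_
      simpa [M.rv_rv] using hr' _ _ (h1.symm.trans h2)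
    · refine Or.inl ?_
      simpa [M.rv_rv] using hr' _ _ (h1.symm.trans h2)
  rw [← ncard_sameCycle, two_mul]
  have hu : {x | M.straight.SameCycle d x} ∪ M.rv '' {x | M.straight.SameCycle d x} =
      Set.univ := by
    refine Set.eq_univ_of_forall fun x => (hd x).imp id fun h => ⟨M.rv x, h, M.rv_rv x⟩
  rw [← Set.ncard_univ, ← hu]
  exact (Set.ncard_union_le _ _).trans (Nat.add_le_add_left Set.ncard_image_le _)

end Classification

end QuarticMap

/-! ### Cubic graphs on eight vertices -/

/-- An alternating matrix of odd size over `𝔽₂` is singular, as it lifts to a skew-symmetric integral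
matrix. -/
theorem det_eq_zero_of_odd_of_alternating {T : Type} [Fintype T] [DecidableEq T]
    (hT : Odd (Fintype.card T)) (A : Matrix T T (ZMod 2)) (hA : A.transpose = A)
    (h0 : ∀ i, A i i = 0) : A.det = 0 := by
  let e := Fintype.equivFin T
  let B : Matrix T T ℤ := Matrix.of fun i j => if A i j = 0 then 0 else if e i < e j then 1 else -1
  have hB : B.transpose = -B := by
    ext i j
    have hs : A j i = A i j := by
      conv_rhs => rw [← hA]
      rfl
    simp only [B, Matrix.transpose_apply, Matrix.neg_apply, Matrix.of_apply, hs]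
    by_cases hij : A i j = 0
    · simp [hij]
    · have hne : i ≠ j := fun h => hij (h ▸ h0 i)
      rcases lt_or_gt_of_ne fun h => hne (e.injective h) with h | h
      · simp [hij, h, h.not_gt]
      · simp [hij, h, h.not_gt]
  have hdet : B.det = 0 := by
    have h := Matrix.det_transpose B
    rw [hB, Matrix.det_neg, hT.neg_one_pow] at h
    linarith
  have hmap : A = (Int.castRingHom (ZMod 2)).mapMatrix B := by
    ext i j
    have : ∀ x : ZMod 2, x ≠ 0 → x = 1 := by decide
    by_cases hij : A i j = 0
    · simp [B, hij]
    · by_cases h : e i < e j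
      · simp [B, h, this _ hij]
      · simpa [B, hij, h] using this _ hij
  rw [hmap, ← RingHom.map_det, hdet, map_zero]

section CubicEight

variable {T : Type} [Fintype T] (H : SimpleGraph T) [DecidableRel H.Adj]

theorem sum_sum_neighborFinset (hH : ∀ t, H.degree t = 3) (x : T → ZMod 2) :
    ∑ t, ∑ u ∈ H.neighborFinset t, x u = ∑ t, x t := by
  have h1 : ∀ t, ∑ u ∈ H.neighborFinset t, x u = ∑ u, if H.Adj t u then x u else 0 := fun t => by
    rw [← Finset.sum_filter, SimpleGraph.neighborFinset_eq_filter]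
  simp_rw [h1]
  rw [Finset.sum_comm]
  refine Finset.sum_congr rfl fun u _ => ?_
  simp_rw [H.adj_comm _ u]
  rw [← Finset.sum_filter, ← SimpleGraph.neighborFinset_eq_filter, Finset.sum_const,
    SimpleGraph.card_neighborFinset_eq_degree, hH]
  generalize x u = a
  revert a; decide

variable [DecidableEq T]

/-- In a cubic graph with eight vertices, some nonconstant function over `𝔽₂` has its sums over
closed neighbourhoods all equal to its total sum: the adjacency matrix of the complement is
alternating with row sums zero. -/
theorem exists_closedNeighborhood_sum_eq (hT : Fintype.card T = 8) (hH : ∀ t, H.degree t = 3) :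
    ∃ x : T → ZMod 2, (∃ t u, x t ≠ x u) ∧
      ∀ t, x t + ∑ u ∈ H.neighborFinset t, x u = ∑ u, x u := by
  have : Nonempty T := Fintype.card_pos_iff.1 (by omega)
  obtain ⟨t₀⟩ := this
  let A : Matrix {t // t ≠ t₀} {t // t ≠ t₀} (ZMod 2) := Matrix.of fun i j =>
    1 + (if i = j then 1 else 0) + if H.Adj i j then 1 else 0
  have hdet : A.det = 0 := by
    apply det_eq_zero_of_odd_of_alternating
    · rw [Fintype.card_subtype_compl, hT, Fintype.card_subtype_eq]; decide
    · ext i j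
      simp [A, eq_comm, H.adj_comm]
    · intro i
      simp [A]; decide
  obtain ⟨v, hv, hAv⟩ := Matrix.exists_mulVec_eq_zero_iff.2 hdet
  let x : T → ZMod 2 := fun t => if h : t ≠ t₀ then v ⟨t, h⟩ else 0
  have hsum : ∀ f : T → ZMod 2, ∑ u, f u * x u = ∑ u : {t // t ≠ t₀}, f u * v u := fun f => by
    rw [← Fintype.sum_subtype_add_sum_subtype (fun t => t ≠ t₀)]
    have h1 : ∑ u : {t // ¬ t ≠ t₀}, f u * x u = 0 := Finset.sum_eq_zero fun u _ => by
      simp [x, u.2]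
    rw [h1, add_zero]
    exact Finset.sum_congr rfl fun u _ => by simp [x, u.2]
  have hx : ∀ t, t ≠ t₀ → x t + ∑ u ∈ H.neighborFinset t, x u = ∑ u, x u := by
    intro t ht
    have h := congrFun hAv ⟨t, ht⟩
    rw [Matrix.mulVec, dotProduct, Pi.zero_apply] at h
    have h2 := hsum fun u => 1 + (if t = u then 1 else 0) + if H.Adj t u then 1 else 0
    have h3 : ∑ u : {t // t ≠ t₀}, ((1 + if t = u then 1 else 0) +
        if H.Adj t u then 1 else 0) * v u = 0 := by
      refine (Finset.sum_congr rfl fun u _ => ?_).trans h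
      simp [A, Subtype.ext_iff]
    rw [h3] at h2
    simp only [add_mul, one_mul, ite_mul, zero_mul, Finset.sum_add_distrib, Finset.sum_ite_eq,
      Finset.mem_univ, if_true] at h2
    rw [← Finset.sum_filter, ← SimpleGraph.neighborFinset_eq_filter, add_assoc] at h2
    exact (CharTwo.add_eq_zero.1 h2).symm
  refine ⟨x, ?_, ?_⟩
  · obtain ⟨i, hi⟩ := Function.ne_iff.1 hv
    exact ⟨i, t₀, by simpa [x, i.2] using hi⟩
  · intro t
    by_cases ht : t = t₀
    · subst ht
      have htot : ∑ u, (x u + ∑ w ∈ H.neighborFinset u, x w + ∑ w, x w) = 0 := by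
        rw [Finset.sum_add_distrib, Finset.sum_add_distrib, sum_sum_neighborFinset H hH,
          Finset.sum_const, Finset.card_univ, hT]
        generalize ∑ u, x u = a
        revert a; decide
      rw [Finset.sum_eq_single t (fun u _ hu => by rw [hx u hu, CharTwo.add_self_eq_zero])
        (by simp)] at htot
      exact CharTwo.add_eq_zero.1 htot
    · exact hx t ht

/-- Let a set `S` of one or three vertices of a cubic graph with eight vertices meet every closed
neighbourhood in an odd number of vertices. Then the graph is `K₃,₃` with one vertex blown up to a
triangle `R`, and `S` is the side to which that vertex does not belong. -/
theorem exists_triangle_of_odd_domination (hT : Fintype.card T = 8) (hH : ∀ t, H.degree t = 3)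
    (S : Finset T) (hS : S.card = 1 ∨ S.card = 3)
    (hin : ∀ t ∈ S, Even (H.neighborFinset t ∩ S).card)
    (hout : ∀ t ∉ S, Odd (H.neighborFinset t ∩ S).card) :
    ∃ R : Finset T, R.card = 3 ∧
      (∀ t u w, H.Adj t u → H.Adj u w → H.Adj w t → t ∈ R) ∧
      ∀ t u w x, t ∈ R → H.Adj t u → H.Adj u w → H.Adj w x → H.Adj x t → t ≠ w → u = x := by
  have hdeg : ∀ t, (H.neighborFinset t).card = 3 := fun t => by
    rw [SimpleGraph.card_neighborFinset_eq_degree, hH]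
  have hcompl : (Sᶜ).card = 8 - S.card := by rw [Finset.card_compl, hT]
  have hcut : ∑ t ∈ Sᶜ, (H.neighborFinset t ∩ S).card = ∑ s ∈ S, (H.neighborFinset s \ S).card := by
    have h1 : ∀ t, (H.neighborFinset t ∩ S).card = ∑ s ∈ S, if H.Adj t s then 1 else 0 := by
      intro t
      rw [← Finset.card_filter]
      congr 1
      ext u; simp [and_comm]
    have h2 : ∀ s, (H.neighborFinset s \ S).card = ∑ t ∈ Sᶜ, if H.Adj t s then 1 else 0 := by
      intro s
      rw [← Finset.card_filter]
      congr 1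
      ext u; simp [and_comm, H.adj_comm]
    simp_rw [h1, h2]
    exact Finset.sum_comm
  have hsplit : ∀ t, (H.neighborFinset t \ S).card + (H.neighborFinset t ∩ S).card = 3 := fun t => by
    rw [Finset.card_sdiff_add_card_inter, hdeg]
  have hge : (Sᶜ).card ≤ ∑ t ∈ Sᶜ, (H.neighborFinset t ∩ S).card := by
    rw [Finset.card_eq_sum_ones]
    exact Finset.sum_le_sum fun t ht => (hout t (Finset.mem_compl.1 ht)).pos
  have hle : ∑ s ∈ S, (H.neighborFinset s \ S).card ≤ S.card * 3 := by
    rw [← smul_eq_mul]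
    exact Finset.sum_le_card_nsmul _ _ _ fun s _ => by have := hsplit s; omega
  have hS3 : S.card = 3 := by omega
  -- An edge within `S` would make `S` a triangle, from which only three edges lead to the other
  -- five vertices.
  have hind : ∀ s ∈ S, ∀ t ∈ S, ¬ H.Adj s t := by
    intro s hs t ht hst
    have hsub : ∀ a ∈ S, (H.neighborFinset a ∩ S).card ≤ 2 := fun a ha => by
      have : H.neighborFinset a ∩ S ⊆ S.erase a := fun b hb => by
        simp only [Finset.mem_inter, SimpleGraph.mem_neighborFinset] at hb
        exact Finset.mem_erase.2 ⟨hb.1.ne', hb.2⟩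
      have := Finset.card_le_card this
      rw [Finset.card_erase_of_mem ha] at this
      omega
    have hall : ∀ a ∈ S, ∀ b ∈ S, H.Adj a b → (H.neighborFinset a ∩ S) = S.erase a := by
      intro a ha b hb hab
      refine Finset.eq_of_subset_of_card_le (fun b hb => ?_) ?_
      · simp only [Finset.mem_inter, SimpleGraph.mem_neighborFinset] at hb
        exact Finset.mem_erase.2 ⟨hb.1.ne', hb.2⟩
      · have hpos : 0 < (H.neighborFinset a ∩ S).card :=
          Finset.card_pos.2 ⟨b, by simp [hab, hb]⟩
        obtain ⟨k, hk⟩ := hin a ha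
        rw [Finset.card_erase_of_mem ha]
        omega
    have hs2 : ∀ a ∈ S, (H.neighborFinset a ∩ S).card = 2 := by
      intro a ha
      have : ∃ b ∈ S, H.Adj a b := by
        by_cases has : a = s
        · exact ⟨t, ht, has ▸ hst⟩
        · have : a ∈ H.neighborFinset s ∩ S := by
            rw [hall s hs t ht hst]; exact Finset.mem_erase.2 ⟨has, ha⟩
          simp only [Finset.mem_inter, SimpleGraph.mem_neighborFinset] at this
          exact ⟨s, hs, this.1.symm⟩
      obtain ⟨b, hb, hab⟩ := this
      rw [hall a ha b hb hab, Finset.card_erase_of_mem ha, hS3]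
    have : ∑ s ∈ S, (H.neighborFinset s \ S).card = ∑ s ∈ S, 1 :=
      Finset.sum_congr rfl fun a ha => by have := hsplit a; have := hs2 a ha; omega
    rw [Finset.sum_const, smul_eq_mul] at this
    omega
  have hcut9 : ∑ t ∈ Sᶜ, (H.neighborFinset t ∩ S).card = 9 := by
    rw [hcut, Finset.sum_congr rfl (g := fun _ => 3), Finset.sum_const, hS3]
    · rfl
    intro s hs
    have : H.neighborFinset s ∩ S = ∅ := by
      ext u
      simp only [Finset.mem_inter, SimpleGraph.mem_neighborFinset, Finset.notMem_empty, iff_false]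
      exact fun h => hind s hs u h.2 h.1
    have h := hsplit s
    rw [this, Finset.card_empty] at h
    exact h
  -- Nine edges join `S` to the five other vertices: two of them, `P`, have three neighbours in `S`
  -- and three of them, `R`, have one.
  let P : Finset T := (Sᶜ).filter fun t => (H.neighborFinset t ∩ S).card = 3
  let R : Finset T := (Sᶜ).filter fun t => ¬ (H.neighborFinset t ∩ S).card = 3
  have hR1 : ∀ t ∈ R, (H.neighborFinset t ∩ S).card = 1 := by
    intro t ht
    simp only [R, Finset.mem_filter, Finset.mem_compl] at ht
    obtain ⟨k, hk⟩ := hout t ht.1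
    have := hsplit t
    omega
  have hPR : P.card + R.card = 5 := by
    simp only [P, R]
    rw [Finset.card_filter_add_card_filter_not, hcompl, hS3]
  have hPR9 : 3 * P.card + R.card = 9 := by
    rw [← hcut9, ← Finset.sum_filter_add_sum_filter_not (Sᶜ)
      fun t => (H.neighborFinset t ∩ S).card = 3]
    rw [Finset.sum_congr rfl (g := fun _ => 3) (fun t ht => (Finset.mem_filter.1 ht).2),
      Finset.sum_congr rfl (g := fun _ => 1) (fun t ht => hR1 t ht)]
    simp [P, R, mul_comm]
  have hcases : ∀ t, t ∈ S ∨ t ∈ P ∨ t ∈ R := fun t => by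
    simp only [P, R, Finset.mem_filter, Finset.mem_compl]
    tauto
  have hPN : ∀ p ∈ P, ∀ q, H.Adj p q ↔ q ∈ S := by
    intro p hp q
    have h3 := (Finset.mem_filter.1 hp).2
    have h4 : H.neighborFinset p ∩ S = H.neighborFinset p :=
      Finset.eq_of_subset_of_card_le Finset.inter_subset_left (by rw [h3, hdeg])
    have h5 : H.neighborFinset p ∩ S = S :=
      Finset.eq_of_subset_of_card_le Finset.inter_subset_right (by rw [h3, hS3])
    rw [← SimpleGraph.mem_neighborFinset, ← h4, h5]
  have hSR : ∀ s ∈ S, ∀ u ∈ R, ∀ w ∈ R, H.Adj s u → H.Adj s w → u = w := by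
    intro s hs u hu w hw hsu hsw
    by_contra hne
    have hsub : insert u (insert w P) ⊆ H.neighborFinset s := by
      intro a ha
      rw [SimpleGraph.mem_neighborFinset]
      rcases Finset.mem_insert.1 ha with rfl | ha
      · exact hsu
      rcases Finset.mem_insert.1 ha with rfl | ha
      · exact hsw
      · exact ((hPN a ha s).2 hs).symm
    have hnP : ∀ a ∈ R, a ∉ P := fun a ha hP =>
      (Finset.mem_filter.1 ha).2 (Finset.mem_filter.1 hP).2
    have := Finset.card_le_card hsub
    rw [Finset.card_insert_of_notMem (by simp [hne, hnP u hu]),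
      Finset.card_insert_of_notMem (hnP w hw), hdeg] at this
    omega
  have hRS : ∀ t ∈ R, ∀ u ∈ S, ∀ w ∈ S, H.Adj t u → H.Adj t w → u = w := by
    intro t ht u hu w hw htu htw
    exact Finset.card_le_one.1 (hR1 t ht).le u (by simp [htu, hu]) w (by simp [htw, hw])
  have hRP : ∀ t ∈ R, ∀ u ∈ P, ¬ H.Adj t u := fun t ht u hu h =>
    Finset.mem_compl.1 (Finset.mem_filter.1 ht).1 ((hPN u hu t).1 h.symm)
  have hPS : ∀ t ∈ P, t ∉ S := fun t ht => Finset.mem_compl.1 (Finset.mem_filter.1 ht).1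
  have hRS' : ∀ t ∈ R, t ∉ S := fun t ht => Finset.mem_compl.1 (Finset.mem_filter.1 ht).1
  refine ⟨R, by omega, ?_, ?_⟩
  · intro t u w htu huw hwt
    have hP : ∀ t u w, t ∈ P → H.Adj t u → H.Adj u w → H.Adj w t → False := fun t u w ht htu huw hwt =>
      hind u ((hPN t ht u).1 htu) w ((hPN t ht w).1 hwt.symm) huw
    rcases hcases t with ht | ht | ht
    · have hu : u ∈ R := by
        rcases hcases u with h | h | h
        · exact absurd htu (hind t ht u h)
        · exact (hP u w t h huw hwt htu).elim
        · exact h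
      have hw : w ∈ R := by
        rcases hcases w with h | h | h
        · exact absurd hwt (hind w h t ht)
        · exact (hP w t u h hwt htu huw).elim
        · exact h
      exact absurd (hSR t ht u hu w hw htu hwt.symm) huw.ne
    · exact (hP t u w ht htu huw hwt).elim
    · exact ht
  · intro t u w x ht htu huw hwx hxt htw
    by_contra hux
    have hu := hcases u
    have hx := hcases x
    have hw := hcases w
    have key : ∀ u x, H.Adj t u → H.Adj u w → H.Adj w x → H.Adj x t → u ∈ S → x ∈ R → False := by
      intro u x htu huw hwx hxt hu hx
      rcases hcases w with h | h | h
      · exact hind u hu w h huw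
      · exact hRS' x hx ((hPN w h x).1 hwx)
      · exact htw (hSR u hu t ht w h htu.symm huw)
    rcases hu with hu | hu | hu
    · rcases hx with hx | hx | hx
      · exact hux (hRS t ht u hu x hx htu hxt.symm)
      · exact hRP t ht x hx hxt.symm
      · exact key u x htu huw hwx hxt hu hx
    · exact hRP t ht u hu htu
    · rcases hx with hx | hx | hx
      · exact key x u hxt.symm hwx.symm huw.symm htu.symm hx hu
      · exact hRP t ht x hx hxt.symm
      · rcases hw with hw | hw | hw
        · exact hux (hSR w hw u hu x hx huw.symm hwx)
        · exact hRS' u hu ((hPN w hw u).1 huw.symm)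
        · have hsub : ({t, u, x, w} : Finset T) ⊆ R := by
            intro a ha
            simp only [Finset.mem_insert, Finset.mem_singleton] at ha
            rcases ha with rfl | rfl | rfl | rfl <;> assumption
          have := Finset.card_le_card hsub
          rw [Finset.card_insert_of_notMem (by simp [htu.ne, hxt.ne', htw]),
            Finset.card_insert_of_notMem (by simp [hux, huw.ne]),
            Finset.card_insert_of_notMem (by simp [hwx.ne']), Finset.card_singleton] at this
          omega

/-- If only constants are harmonic modulo two on a cubic graph with eight vertices, then all its
triangles lie in a set `R` of three vertices, none of which is on a four-cycle. -/
theorem exists_triangle_of_kernel_const (hT : Fintype.card T = 8) (hH : ∀ t, H.degree t = 3)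
    (hker : ∀ s : T → ZMod 2, (∀ t, s t + ∑ u ∈ H.neighborFinset t, s u = 0) → ∀ t u, s t = s u) :
    ∃ R : Finset T, R.card = 3 ∧
      (∀ t u w, H.Adj t u → H.Adj u w → H.Adj w t → t ∈ R) ∧
      ∀ t u w x, t ∈ R → H.Adj t u → H.Adj u w → H.Adj w x → H.Adj x t → t ≠ w → u = x := by
  obtain ⟨x, ⟨a, b, hab⟩, hx⟩ := exists_closedNeighborhood_sum_eq H hT hH
  have h01 : ∀ y : ZMod 2, y ≠ 0 → y = 1 := by decide
  have hsum : ∑ u, x u = 1 := h01 _ fun h => hab (hker x (fun t => by rw [hx, h]) a b)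
  rw [hsum] at hx
  -- Both `x` and `1 + x` have the property that follows; one of them has support of size at most `4`.
  have key : ∀ x : T → ZMod 2, ∑ u, x u = 1 →
      (∀ t, x t + ∑ u ∈ H.neighborFinset t, x u = 1) →
      (Finset.univ.filter fun t => x t = 1).card ≤ 4 →
      ∃ R : Finset T, R.card = 3 ∧
      (∀ t u w, H.Adj t u → H.Adj u w → H.Adj w t → t ∈ R) ∧
      ∀ t u w x, t ∈ R → H.Adj t u → H.Adj u w → H.Adj w x → H.Adj x t → t ≠ w → u = x := by
    intro x hsum hx h4
    have hcount : ∀ P : Finset T, ∑ u ∈ P, x u =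
        ((P ∩ Finset.univ.filter fun t => x t = 1).card : ZMod 2) := by
      intro P
      rw [Finset.card_eq_sum_ones, Finset.inter_filter, Finset.inter_univ, Finset.sum_filter,
        Nat.cast_sum]
      refine Finset.sum_congr rfl fun u _ => ?_
      by_cases h : x u = 1
      · simp [h]
      · have : x u = 0 := by by_contra h'; exact h (h01 _ h')
        simp [this]
    have hodd : Odd (Finset.univ.filter fun t => x t = 1).card := by
      have := hcount Finset.univ
      rw [hsum, Finset.univ_inter] at this
      exact ZMod.natCast_eq_one_iff_odd.1 this.symm
    refine exists_triangle_of_odd_domination H hT hH (Finset.univ.filter fun t => x t = 1) ?_ ?_ ?_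
    · obtain ⟨k, hk⟩ := hodd
      omega
    · intro t ht
      have h := hx t
      rw [(Finset.mem_filter.1 ht).2, hcount] at h
      exact ZMod.natCast_eq_zero_iff_even.1 (by simpa using h)
    · intro t ht
      have h := hx t
      have h0 : x t = 0 := by by_contra h'; exact ht (by simpa using h01 _ h')
      rw [h0, zero_add, hcount] at h
      exact ZMod.natCast_eq_one_iff_odd.1 h
  by_cases h4 : (Finset.univ.filter fun t => x t = 1).card ≤ 4
  · exact key x hsum hx h4
  · refine key (fun t => 1 + x t) ?_ ?_ ?_
    · rw [Finset.sum_add_distrib, hsum, Finset.sum_const, Finset.card_univ, hT]; decide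
    · intro t
      rw [Finset.sum_add_distrib, Finset.sum_const, SimpleGraph.card_neighborFinset_eq_degree, hH,
        show (1 + x t) + (3 • (1 : ZMod 2) + ∑ u ∈ H.neighborFinset t, x u) =
          1 + 3 • 1 + (x t + ∑ u ∈ H.neighborFinset t, x u) by ring, hx]
      decide
    · have h2 := Finset.card_filter_add_card_filter_not (s := (Finset.univ : Finset T))
        (fun t => x t = 1)
      rw [Finset.card_univ, hT] at h2
      have h3 : (Finset.univ.filter fun t => 1 + x t = 1) =
          Finset.univ.filter fun t => ¬ x t = 1 := by
        ext t
        simp only [Finset.mem_filter_univ]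
        generalize x t = y
        revert y; decide
      rw [h3]; omega

end CubicEight

/-! ### Maps in which the faces of one colour are triangles -/

namespace QuarticMap

variable {V D : Type} {M : QuarticMap V D} {c : D → Bool}

/-- Reversal exchanges the darts of the two colours. -/
theorem IsCheckerboard.two_mul_card [Fintype D] (hc : M.IsCheckerboard c) (b : Bool) :
    2 * Fintype.card {d // c d = b} = Fintype.card D := by
  have h1 : Fintype.card {d // ¬ c d = b} = Fintype.card {d // c d = b} :=
    Fintype.card_congr (M.rv.subtypeEquiv fun d => by
      rw [hc.rv]; cases c d <;> cases b <;> simp)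
  have h2 := Fintype.card_congr (Equiv.sumCompl fun d => c d = b)
  rw [Fintype.card_sum, h1] at h2
  omega

/-- If all faces of one colour are triangles, then the number of vertices is divisible by three:
`faceStep` acts freely, with order three, on the darts of this colour, which are twice as many. -/
theorem IsCheckerboard.three_dvd [Finite V] [Finite D] (hc : M.IsCheckerboard c) {b : Bool}
    (h : ∀ d, c d = b → M.Tri d) : 3 ∣ Nat.card V := by
  classical
  have := Fintype.ofFinite V
  have := Fintype.ofFinite D
  have h1 := hc.two_mul_card b
  rw [M.card_dart] at h1
  let f : Function.End {d // c d = b} := fun d => ⟨M.faceStep d, by rw [hc.faceStep]; exact d.2⟩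
  have h2 := Equiv.Perm.card_fixedPoints_modEq (p := 3) (n := 1) (f := f)
    (funext fun d => Subtype.ext (h d d.2))
  have h3 : Fintype.card (Function.fixedPoints f) = 0 := by
    rw [Fintype.card_eq_zero_iff]
    exact ⟨fun x => M.faceStep_ne x.1.1 (congrArg Subtype.val x.2)⟩
  rw [h3] at h2
  have h4 : 3 ∣ Fintype.card {d // c d = b} := (Nat.modEq_zero_iff_dvd).1 h2
  rw [Nat.card_eq_fintype_card]
  omega

/-- The faces of one colour are connected through their common vertices. -/
theorem IsCheckerboard.const_of_color (hc : M.IsCheckerboard c) {b : Bool} {α : Type} (S : D → α)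
    (h1 : ∀ d d', c d = b → M.face d = M.face d' → S d = S d')
    (h2 : ∀ d, c d = b → S (M.nx (M.nx d)) = S d) (d d' : D) (hd : c d = b) (hd' : c d' = b) :
    S d = S d' := by
  have hv : ∀ x y, M.src x = M.src y → c x = b → c y = b → S x = S y := by
    intro x y hxy hx hy
    rcases M.eq_nx_of_src_eq hxy with rfl | rfl | rfl | rfl
    · rfl
    · rw [hc.nx, hx] at hy; simp at hy
    · exact (h2 x hx).symm
    · rw [hc.nx_nx, hc.nx, hx] at hy; simp at hy
  refine M.dart_induction (p := fun x => ∀ y, M.src y = M.src x → c y = b → S d = S y) ?_ ?_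
    (fun y hy hyb => hv d y hy.symm hd hyb) d' d' rfl hd'
  · intro x hx y hy
    rw [M.src_nx] at hy
    exact hx y hy
  · intro x hx y hy hyb
    by_cases hxb : c x = b
    · rw [hx x rfl hxb, h1 x (M.faceStep x) hxb (M.face_faceStep x).symm]
      exact hv _ _ (by rw [M.src_faceStep, hy]) (by rw [hc.faceStep, hxb]) hyb
    · have hb : c (M.rv x) = b := by
        rw [hc.rv]
        revert hxb; cases c x <;> cases b <;> simp
      have hb3 : c (M.nx (M.nx (M.nx x))) = b := by rw [hc.nx_nx, hc.nx, ← hc.rv, hb]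
      rw [hx (M.nx (M.nx (M.nx x))) (by rw [M.src_nx, M.src_nx, M.src_nx]) hb3,
        ← h1 _ _ hb (M.face_rv x)]
      exact hv _ _ hy.symm hb hyb

/-- The colour of a face. -/
def IsCheckerboard.faceColor (hc : M.IsCheckerboard c) : M.Face → Bool :=
  Quotient.lift c fun _ _ h => hc.of_face_eq (M.face_eq_iff.2 h)

theorem IsCheckerboard.faceColor_face (hc : M.IsCheckerboard c) (d : D) :
    hc.faceColor (M.face d) = c d := rfl

theorem card_face_color [Finite D] [Finite V] (hP : M.Planar) (hc : M.IsCheckerboard c) :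
    Nat.card {F // hc.faceColor F = false} + Nat.card {F // hc.faceColor F = true} =
      Nat.card V + 2 := by
  classical
  have := Fintype.ofFinite M.Face
  rw [← hP, ← Nat.card_congr (Equiv.sumCompl fun F => hc.faceColor F = false), Nat.card_sum]
  congr 1
  exact Nat.card_congr (Equiv.subtypeEquivRight fun F => by simp)

/-- A function on the triangles of one colour that is harmonic modulo two extends to all faces such
that its sum around each vertex vanishes. Consider the graph on the other faces in which the two at
each vertex are joined: the sum of `s` over the two triangles at a vertex is a function on its edges,
whose sum around each triangle vanishes since `s` is harmonic, so it is a coboundary by Euler's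
formula. -/
theorem Planar.exists_extension [Finite D] [Finite V] (hP : M.Planar) (hc : M.IsCheckerboard c)
    (s : M.Face → ZMod 2)
    (hs : ∀ d, c d = true → s (M.face d) + (s (M.face (M.nx (M.nx d))) +
      s (M.face (M.nx (M.nx (M.faceStep d)))) +
      s (M.face (M.nx (M.nx (M.faceStep (M.faceStep d)))))) = 0) :
    ∃ q : M.Face → ZMod 2, (∀ d, c d = true → q (M.face d) = s (M.face d)) ∧
      ∀ d, q (M.face d) + q (M.face (M.nx (M.nx d))) =
        q (M.face (M.nx d)) + q (M.face (M.nx (M.nx (M.nx d)))) := by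
  classical
  have := Fintype.ofFinite D
  have := Fintype.ofFinite V
  have := Fintype.ofFinite M.Face
  have hcard := card_face_color hP hc
  have hD := hc.two_mul_card false
  rw [M.card_dart] at hD
  rw [Nat.card_eq_fintype_card, Nat.card_eq_fintype_card, Nat.card_eq_fintype_card] at hcard
  let τ : {d // c d = false} → {d // c d = false} := fun d =>
    ⟨M.nx (M.nx d), by rw [hc.nx_nx]; exact d.2⟩
  let ψ : Equiv.Perm {d // c d = false} := M.faceStep.subtypePerm fun d => by rw [hc.faceStep]
  let a : {d // c d = false} → {F // hc.faceColor F = false} := fun d => ⟨M.face d, d.2⟩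
  let w : {d // c d = false} → {F // hc.faceColor F = true} := fun d =>
    ⟨M.face (M.nx d), by rw [hc.faceColor_face, hc.nx, d.2]; rfl⟩
  have hexact := (euler_inequality_and_exactness τ (fun d => Subtype.ext (M.nx_four d))
    (fun d h => M.nx_two_ne d (congrArg Subtype.val h)) ψ a w
    (fun d => Subtype.ext (M.face_faceStep d))
    (fun d => Subtype.ext (by
      change M.face (M.nx (M.faceStep d)) = M.face (M.nx (M.nx (M.nx d)))
      rw [M.nx_faceStep, M.face_rv]))
    (fun t ht F F' => by
      obtain ⟨F, hF⟩ := F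
      obtain ⟨F', hF'⟩ := F'
      obtain ⟨d, rfl⟩ := M.face_surjective F
      obtain ⟨d', rfl⟩ := M.face_surjective F'
      have := hc.const_of_color (b := false) (fun d => if h : c d = false then t ⟨M.face d, h⟩ else 0)
        (fun d d' hd hdd' => by
          have hd' : c d' = false := by rw [← hc.of_face_eq hdd', hd]
          simp only [hd, hd', hdd', dite_true])
        (fun d hd => by
          have hd' : c (M.nx (M.nx d)) = false := by rw [hc.nx_nx, hd]
          simp only [hd, hd', dite_true]
          exact ht ⟨d, hd⟩) d d' hF hF'
      simpa only [show c d = false from hF, show c d' = false from hF', dite_true] using this)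
    (fun t ht F F' => by
      obtain ⟨F, hF⟩ := F
      obtain ⟨F', hF'⟩ := F'
      obtain ⟨d, rfl⟩ := M.face_surjective F
      obtain ⟨d', rfl⟩ := M.face_surjective F'
      have := hc.const_of_color (b := true) (fun d => if h : c d = true then t ⟨M.face d, h⟩ else 0)
        (fun d d' hd hdd' => by
          have hd' : c d' = true := by rw [← hc.of_face_eq hdd', hd]
          simp only [hd, hd', hdd', dite_true])
        (fun d hd => by
          have hd' : c (M.nx (M.nx d)) = true := by rw [hc.nx_nx, hd]
          simp only [hd, hd', dite_true]
          have := ht ⟨M.nx d, by rw [hc.nx, hd]; rfl⟩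
          simp only [w, τ, M.nx_four] at this
          exact this.symm) d d' hF hF'
      simpa only [show c d = true from hF, show c d' = true from hF', dite_true] using this)).2
    (by omega) (fun d => s (M.face (M.nx d)) + s (M.face (M.nx (M.nx (M.nx d)))))
    (fun d => by
      change s (M.face (M.nx (M.nx (M.nx d)))) +
        s (M.face (M.nx (M.nx (M.nx (M.nx (M.nx d)))))) = _
      rw [M.nx_four, add_comm])
    (fun t => by
      -- `ρ` rotates the vertices of each triangle.
      let ρ : Equiv.Perm {d // c d = false} :=
        Equiv.Perm.subtypePerm ((M.nx.trans M.faceStep).trans M.nx.symm) fun d => by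
          have h := hc.nx (M.nx.symm (M.faceStep (M.nx d)))
          rw [Equiv.apply_symm_apply, hc.faceStep, hc.nx] at h
          simp only [Equiv.trans_apply]
          generalize c (M.nx.symm (M.faceStep (M.nx d))) = y at *
          revert h; cases c d <;> cases y <;> simp
      have hρ : ∀ d, M.nx (ρ d) = M.faceStep (M.nx d) := fun d => by simp [ρ]
      have hwρ : ∀ d, w (ρ d) = w d := fun d => Subtype.ext (by
        simp only [w, hρ, M.face_faceStep])
      generalize hf : (fun d : {d // c d = false} =>
        (s (M.face (M.nx d)) + s (M.face (M.nx (M.nx (M.nx d))))) * t (w d)) = f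
      have e1 : ∑ d, f (ρ d) = ∑ d, f d := Equiv.sum_comp ρ f
      have e2 : ∑ d, f (ρ (ρ d)) = ∑ d, f d := by rw [Equiv.sum_comp ρ fun d => f (ρ d), e1]
      have h3 : ∑ d, f d + ∑ d, f (ρ d) + ∑ d, f (ρ (ρ d)) = 0 := by
        rw [← Finset.sum_add_distrib, ← Finset.sum_add_distrib]
        refine Finset.sum_eq_zero fun d _ => ?_
        have := hs (M.nx d) (by rw [hc.nx, d.2]; rfl)
        simp only [← hf, hwρ, hρ, M.face_faceStep]
        rw [← add_mul, ← add_mul]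
        refine mul_eq_zero_of_left ?_ _
        rw [← this]
        generalize s (M.face (M.nx d)) = x
        generalize s (M.face (M.nx (M.nx (M.nx d)))) = y
        generalize s (M.face (M.nx (M.nx (M.faceStep (M.nx d))))) = z
        generalize s (M.face (M.nx (M.nx (M.faceStep (M.faceStep (M.nx d)))))) = u
        revert x y z u
        decide
      rw [e1, e2, CharTwo.add_self_eq_zero, zero_add] at h3
      rw [← h3, ← hf])
  obtain ⟨s', hs'⟩ := hexact
  refine ⟨fun F => if h : hc.faceColor F = false then s' ⟨F, h⟩ else s F, fun d hd => ?_, ?_⟩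
  · simp [hc.faceColor_face, hd]
  · have key : ∀ d (hd : c d = false), _ := fun d hd => hs' ⟨d, hd⟩
    intro d
    cases hd : c d with
    | false =>
      have := key d hd
      simp [hc.faceColor_face, hc.nx, hd, a, τ, this]
    | true =>
      have := key (M.nx d) (by rw [hc.nx, hd]; rfl)
      simp [hc.faceColor_face, hc.nx, hd, a, τ, ← this, M.nx_four, add_comm]

/-- If `q` sums to zero around each vertex, then the sum of `q` over the two faces along an edge is
preserved by straight-ahead steps, hence is the same for all edges of a knot map. -/
theorem Knot.const_of_sum_eq_zero (hk : M.Knot) (q : M.Face → ZMod 2)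
    (hq : ∀ d, q (M.face d) + q (M.face (M.nx (M.nx d))) =
        q (M.face (M.nx d)) + q (M.face (M.nx (M.nx (M.nx d))))) (d : D) :
    q (M.face (M.nx (M.nx d))) = q (M.face d) := by
  let Φ : D → ZMod 2 := fun x => q (M.face x) + q (M.face (M.rv x))
  have hr : ∀ x, Φ (M.rv x) = Φ x := fun x => by simp only [Φ, M.rv_rv, add_comm]
  have hS : ∀ x, Φ (M.straight x) = Φ x := by
    intro x
    have h := hq (M.rv x)
    have h1 : M.face x = M.face (M.nx (M.nx (M.nx (M.rv x)))) := by rw [← M.face_rv, M.rv_rv]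
    simp only [Φ, M.straight_apply, M.face_rv_nx, h1]
    generalize q (M.face (M.rv x)) = x0 at *
    generalize q (M.face (M.nx (M.rv x))) = x1 at *
    generalize q (M.face (M.nx (M.nx (M.rv x)))) = x2 at *
    generalize q (M.face (M.nx (M.nx (M.nx (M.rv x))))) = x3 at *
    revert x0 x1 x2 x3; decide
  have hS' : ∀ x y, M.straight.SameCycle x y → Φ x = Φ y := by
    rintro x y ⟨i, rfl⟩
    induction i using Int.induction_on with
    | zero => rfl
    | succ i ih => rw [add_comm, zpow_add, zpow_one, Equiv.Perm.mul_apply, hS, ← ih]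
    | pred i ih =>
      rw [ih, ← hS ((M.straight ^ (-(i : ℤ) - 1)) x), ← Equiv.Perm.mul_apply, ← zpow_one_add]
      congr 3
      ring
  obtain ⟨d₀, h⟩ := hk
  have hconst : ∀ x, Φ x = Φ d₀ := fun x => by
    rcases h x with h | h
    · exact (hS' _ _ h).symm
    · rw [hS' _ _ h, hr]
  have h1 := (hconst (M.nx d)).trans (hconst (M.nx (M.nx d))).symm
  simp only [Φ, M.face_rv_nx] at h1
  generalize q (M.face d) = x0 at *
  generalize q (M.face (M.nx d)) = x1 at *
  generalize q (M.face (M.nx (M.nx d))) = x2 at *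
  clear hq hr hS hS' hconst
  revert x0 x1 x2; decide

/-- In a planar knot map whose faces of one colour are triangles, only constants are harmonic modulo
two on these triangles. -/
theorem Knot.const_of_harmonic [Finite D] [Finite V] (hk : M.Knot) (hP : M.Planar)
    (hc : M.IsCheckerboard c) (s : M.Face → ZMod 2)
    (hs : ∀ d, c d = true → s (M.face d) + (s (M.face (M.nx (M.nx d))) +
      s (M.face (M.nx (M.nx (M.faceStep d)))) +
      s (M.face (M.nx (M.nx (M.faceStep (M.faceStep d)))))) = 0) (d d' : D) (hd : c d = true)
    (hd' : c d' = true) : s (M.face d) = s (M.face d') := by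
  obtain ⟨q, hqs, hq⟩ := hP.exists_extension hc s hs
  rw [← hqs d hd, ← hqs d' hd']
  exact hc.const_of_color (b := true) (fun d => q (M.face d)) (fun _ _ _ h => congrArg q h)
    (fun d _ => hk.const_of_sum_eq_zero q hq d) d d' hd hd'

end QuarticMap

/-! ### Twelve vertices -/

namespace QuarticMap

variable {V D : Type} {M : QuarticMap V D} {c : D → Bool}

theorem Tri.eq_of_face_eq {d d' : D} (hd : M.Tri d) (h : M.face d = M.face d') :
    d' = d ∨ d' = M.faceStep d ∨ d' = M.faceStep (M.faceStep d) := by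
  obtain ⟨i, rfl⟩ := M.face_eq_iff.1 h
  induction i using Int.induction_on with
  | zero => exact Or.inl rfl
  | succ i ih =>
    rw [add_comm, zpow_add, zpow_one, Equiv.Perm.mul_apply]
    rcases ih (M.face_eq_iff.2 ⟨_, rfl⟩) with h | h | h <;> rw [h]
    · exact Or.inr (Or.inl rfl)
    · exact Or.inr (Or.inr rfl)
    · exact Or.inl hd
  | pred i ih =>
    have h1 : (M.faceStep ^ (-(i : ℤ) - 1)) d = M.faceStep.symm ((M.faceStep ^ (-(i : ℤ))) d) := by
      rw [Equiv.eq_symm_apply, ← Equiv.Perm.mul_apply, ← zpow_one_add]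
      congr 2
      ring
    rw [h1, Equiv.symm_apply_eq, Equiv.symm_apply_eq, Equiv.symm_apply_eq]
    rcases ih (M.face_eq_iff.2 ⟨_, rfl⟩) with h | h | h <;> rw [h]
    · exact Or.inr (Or.inr hd.symm)
    · exact Or.inl rfl
    · exact Or.inr (Or.inl rfl)

/-- The vertices of a triangle are distinct. -/
theorem Tri.src_injective {d d' : D} (hd : M.Tri d) (h : M.face d = M.face d')
    (hs : M.src d = M.src d') : d' = d := by
  rcases hd.eq_of_face_eq h with h | h | h
  · exact h
  · rw [h, M.src_faceStep] at hs
    exact absurd hs.symm (M.src_rv_ne d)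
  · have h3 := M.src_faceStep (M.faceStep (M.faceStep d))
    rw [hd, hs, h] at h3
    exact absurd h3.symm (M.src_rv_ne _)

/-- Two triangles of the same colour share at most one vertex: otherwise the two common vertices
would be joined by two edges. -/
theorem IsCheckerboard.eq_of_face_nx_two_eq (hc : M.IsCheckerboard c) {x y : D} (hx : M.Tri x)
    (hx' : M.Tri (M.nx (M.nx x))) (h : M.face x = M.face y)
    (h' : M.face (M.nx (M.nx x)) = M.face (M.nx (M.nx y))) : x = y := by
  have step : ∀ x, M.Tri x → M.Tri (M.nx (M.nx x)) →
      M.face (M.nx (M.nx x)) ≠ M.face (M.nx (M.nx (M.faceStep x))) := by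
    intro x hx hx' h'
    have hsrc : ∀ z, M.src (M.nx (M.nx z)) = M.src z := fun z => by rw [M.src_nx, M.src_nx]
    rcases hx'.eq_of_face_eq h' with h1 | h1 | h1
    · have := congrArg M.src h1
      rw [hsrc, hsrc, M.src_faceStep] at this
      exact M.src_rv_ne x this
    · refine M.nx_two_ne x (M.simple _ _ (hsrc x) ?_)
      rw [← M.src_faceStep, ← h1, hsrc, M.src_faceStep]
    · have h2 : M.faceStep (M.nx (M.nx (M.faceStep x))) = M.nx (M.nx x) := by rw [h1, hx']
      have h3 : M.rv (M.nx (M.nx (M.faceStep x))) = x := by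
        apply M.simple
        · rw [← M.src_faceStep, h2, hsrc]
        · rw [M.rv_rv, hsrc, M.src_faceStep]
      have h4 := hc.rv (M.nx (M.nx (M.faceStep x)))
      rw [h3, hc.nx_nx, hc.faceStep] at h4
      simp at h4
  rcases hx.eq_of_face_eq h with rfl | rfl | rfl
  · rfl
  · exact absurd h' (step x hx hx')
  · have := step (M.faceStep (M.faceStep x)) (tri_faceStep.2 (tri_faceStep.2 hx))
      ((tri_congr h').1 hx')
    rw [hx] at this
    exact absurd h'.symm this

/-- Each face contributes `1`, spread evenly over its darts. -/
theorem sum_inv_faceDegree [Fintype D] (hc : M.IsCheckerboard c) (b : Bool) :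
    ∑ d : {d // c d = b}, (1 / Function.minimalPeriod M.faceStep d.1 : ℚ) =
      Nat.card {F // hc.faceColor F = b} := by
  classical
  have := Fintype.ofFinite M.Face
  let π : {d // c d = b} → {F // hc.faceColor F = b} := fun d => ⟨M.face d, d.2⟩
  rw [← Finset.sum_fiberwise_of_maps_to (s := Finset.univ) (t := Finset.univ) (g := π)
      (fun _ _ => Finset.mem_univ _), Nat.card_eq_fintype_card, ← Finset.card_univ,
      Finset.card_eq_sum_ones, Nat.cast_sum]
  refine Finset.sum_congr rfl fun F _ => ?_
  obtain ⟨F, hF⟩ := F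
  obtain ⟨d, rfl⟩ := M.face_surjective F
  have hper : ∀ x, M.face x = M.face d →
      Function.minimalPeriod M.faceStep x = Function.minimalPeriod M.faceStep d := by
    intro x hx
    rw [← ncard_sameCycle, ← ncard_sameCycle]
    congr 1
    ext y
    have := M.face_eq_iff.1 hx
    exact ⟨fun h => this.symm.trans h, fun h => this.trans h⟩
  have hcard : (Finset.univ.filter fun x => π x = ⟨M.face d, hF⟩).card =
      Function.minimalPeriod M.faceStep d := by
    rw [← ncard_sameCycle, ← Set.ncard_coe_finset,
      ← Set.ncard_image_of_injective _ Subtype.val_injective]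
    congr 1
    ext y
    simp only [Set.mem_image, Finset.mem_coe, Finset.mem_filter_univ, Subtype.exists, π,
      exists_and_right, exists_eq_right, Set.mem_ofPred_eq]
    rw [← M.face_eq_iff]
    constructor
    · rintro ⟨_, h⟩; exact (congrArg Subtype.val h).symm
    · intro h; exact ⟨by rw [← hc.of_face_eq h]; exact hF, Subtype.ext h.symm⟩
  have hpos : Function.minimalPeriod M.faceStep d ≠ 0 :=
    (Function.minimalPeriod_pos_of_mem_periodicPts (M.faceStep.injective.mem_periodicPts d)).ne'
  rw [Finset.sum_congr rfl (g := fun _ => (1 / Function.minimalPeriod M.faceStep d : ℚ)),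
    Finset.sum_const, hcard, nsmul_eq_mul]
  · field_simp
    simp
  · intro x hx
    rw [hper x (congrArg Subtype.val (Finset.mem_filter.1 hx).2)]

/-- A planar map with twelve vertices, all of whose faces of one colour are triangles, is no knot
map. There are eight such triangles, and two of them are adjacent in the cubic graph `H` if they
share a vertex. If the map is a knot map, then only constants are harmonic on `H`, so that all
triangles of `H` have their vertices in a set of three, none of which lies on a four-cycle. This leaves room for
fewer than six faces of the other colour, since these give closed walks in `H`. -/
theorem Knot.false_of_card_eq_twelve [Finite D] [Finite V] (hk : M.Knot) (hP : M.Planar)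
    (hc : M.IsCheckerboard c) (hw : ∀ d, c d = true → M.Tri d) (hV : Nat.card V = 12) : False := by
  classical
  have := Fintype.ofFinite D
  have := Fintype.ofFinite V
  have := Fintype.ofFinite M.Face
  -- The darts `W` at the boundary of the triangles `T`: `σ` is the next dart of the triangle, `op`
  -- the dart of the opposite triangle with the same initial vertex, and `nxt` follows the boundary of
  -- the face on the other side.
  let W := {d // c d = true}
  let T := {F // hc.faceColor F = true}
  let π : W → T := fun x => ⟨M.face x, x.2⟩
  let σ : W → W := fun x => ⟨M.faceStep x, by rw [hc.faceStep]; exact x.2⟩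
  let op : W → W := fun x => ⟨M.nx (M.nx x), by rw [hc.nx_nx]; exact x.2⟩
  let nxt : W → W := fun x => ⟨M.rv (M.faceStep (M.rv x)), by
    rw [hc.rv, hc.faceStep, hc.rv, x.2]; rfl⟩
  have hσ3 : ∀ x, σ (σ (σ x)) = x := fun x => Subtype.ext (hw x x.2)
  have hσ1 : ∀ x, σ x ≠ x := fun x h => M.faceStep_ne x (congrArg Subtype.val h)
  have hσ2 : ∀ x, σ (σ x) ≠ x := fun x h => M.faceStep_two_ne x (congrArg Subtype.val h)
  have hop : ∀ x, op (op x) = x := fun x => Subtype.ext (M.nx_four x)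
  have hπσ : ∀ x, π (σ x) = π x := fun x => Subtype.ext (M.face_faceStep x)
  have hnxt : ∀ x, σ (nxt x) = op x := fun x => Subtype.ext (by
    change M.faceStep (M.rv (M.faceStep (M.rv x))) = M.nx (M.nx x)
    rw [M.faceStep_rv, M.faceStep_rv, M.nx_four])
  have hπnxt : ∀ x, π (nxt x) = π (op x) := fun x => by rw [← hnxt, hπσ]
  have hπsurj : Function.Surjective π := by
    rintro ⟨F, hF⟩
    obtain ⟨d, rfl⟩ := M.face_surjective F
    exact ⟨⟨d, hF⟩, rfl⟩
  have hcases : ∀ x y, π x = π y → y = x ∨ y = σ x ∨ y = σ (σ x) := fun x y h => by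
    rcases (hw x x.2).eq_of_face_eq (congrArg Subtype.val h) with h | h | h
    exacts [Or.inl (Subtype.ext h), Or.inr (Or.inl (Subtype.ext h)), Or.inr (Or.inr (Subtype.ext h))]
  have hfib : ∀ x, (Finset.univ.filter fun y => π y = π x) = {x, σ x, σ (σ x)} := by
    intro x
    ext y
    simp only [Finset.mem_filter_univ, Finset.mem_insert, Finset.mem_singleton]
    constructor
    · exact fun h => hcases x y h.symm
    · rintro (rfl | rfl | rfl) <;> simp only [hπσ]
  have hinj : ∀ x y, π x = π y → π (op x) = π (op y) → x = y := fun x y h h' =>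
    Subtype.ext (hc.eq_of_face_nx_two_eq (hw x x.2) (hw _ (op x).2) (congrArg Subtype.val h)
      (congrArg Subtype.val h'))
  have hsrcinj : ∀ x y : W, π x = π y → M.src x = M.src y → x = y := fun x y h h' =>
    Subtype.ext ((hw x x.2).src_injective (congrArg Subtype.val h) h').symm
  have hπop : ∀ x, π (op x) ≠ π x := fun x h =>
    M.nx_two_ne x (congrArg Subtype.val (hsrcinj (op x) x h (by
      change M.src (M.nx (M.nx x)) = _
      rw [M.src_nx, M.src_nx])))
  have hsum3 : ∀ (f : W → ℚ) x, ∑ y ∈ Finset.univ.filter (fun y => π y = π x), f y =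
      f x + f (σ x) + f (σ (σ x)) := fun f x => by
    rw [hfib, Finset.sum_insert (by simp [(hσ1 x).symm, (hσ2 x).symm]),
      Finset.sum_pair (hσ1 _).symm, add_assoc]
  have hWcard : Fintype.card W = 24 := by
    have := hc.two_mul_card true
    rw [M.card_dart, ← Nat.card_eq_fintype_card (α := V), hV] at this
    change 2 * Fintype.card W = _ at this
    omega
  have hTcard : Fintype.card T = 8 := by
    have : Fintype.card W = ∑ F : T, 3 := by
      rw [← Finset.card_univ, Finset.card_eq_sum_card_fiberwise (f := π) (t := Finset.univ)
        (fun _ _ => Finset.mem_univ _)]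
      refine Finset.sum_congr rfl fun F _ => ?_
      obtain ⟨x, rfl⟩ := hπsurj F
      rw [hfib, Finset.card_insert_of_notMem (by simp [(hσ1 x).symm, (hσ2 x).symm]),
        Finset.card_pair (hσ1 _).symm]
    rw [hWcard, Finset.sum_const, Finset.card_univ, smul_eq_mul] at this
    omega
  let H : SimpleGraph T :=
    { Adj := fun F F' => ∃ x, π x = F ∧ π (op x) = F'
      symm := ⟨by
        rintro _ _ ⟨x, rfl, rfl⟩
        exact ⟨op x, rfl, by rw [hop]⟩⟩
      loopless := ⟨by
        rintro _ ⟨x, rfl, h⟩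
        exact hπop x h⟩ }
  have hadj : ∀ x, H.Adj (π x) (π (op x)) := fun x => ⟨x, rfl, rfl⟩
  have hne : ∀ x, π (op x) ≠ π (op (σ x)) := fun x h => hσ1 x (hinj x (σ x) (hπσ x).symm h).symm
  have hne2 : ∀ x, π (op x) ≠ π (op (σ (σ x))) := fun x h =>
    hσ2 x (hinj x (σ (σ x)) (by rw [hπσ, hπσ]) h).symm
  have hN : ∀ x, H.neighborFinset (π x) = {π (op x), π (op (σ x)), π (op (σ (σ x)))} := by
    intro x
    ext F
    simp only [SimpleGraph.mem_neighborFinset, Finset.mem_insert, Finset.mem_singleton]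
    constructor
    · rintro ⟨y, hy, rfl⟩
      rcases hcases x y hy.symm with rfl | rfl | rfl <;> simp
    · rintro (rfl | rfl | rfl)
      exacts [⟨x, rfl, rfl⟩, ⟨σ x, hπσ x, rfl⟩, ⟨σ (σ x), by rw [hπσ, hπσ], rfl⟩]
  have hdeg : ∀ F, H.degree F = 3 := by
    intro F
    obtain ⟨x, rfl⟩ := hπsurj F
    rw [← SimpleGraph.card_neighborFinset_eq_degree, hN,
      Finset.card_insert_of_notMem (by simp [hne x, hne2 x]), Finset.card_pair (hne _)]
  obtain ⟨R, hR, htriR, hfourR⟩ := exists_triangle_of_kernel_const H hTcard hdeg (by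
    intro s hs F F'
    obtain ⟨x, rfl⟩ := hπsurj F
    obtain ⟨y, rfl⟩ := hπsurj F'
    let s' : M.Face → ZMod 2 := fun F => if h : hc.faceColor F = true then s ⟨F, h⟩ else 0
    have hs' : ∀ x : W, s' (M.face x) = s (π x) := fun x => by
      simp only [s', hc.faceColor_face, x.2, dite_true]; rfl
    rw [← hs', ← hs']
    refine hk.const_of_harmonic hP hc s' (fun d hd => ?_) x y x.2 y.2
    have := hs (π ⟨d, hd⟩)
    rw [hN, Finset.sum_insert (by simp [hne, hne2]), Finset.sum_pair (hne _), ← hs', ← hs',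
      ← hs', ← hs'] at this
    rw [add_assoc (s' _) (s' _) (s' _)]
    exact this)
  -- The length of the boundary of the face on the other side.
  let ℓ : W → ℕ := fun x => Function.minimalPeriod M.faceStep (M.rv x)
  have hper : ∀ x, Function.IsPeriodicPt M.faceStep (ℓ x) (M.rv x) := fun x =>
    Function.isPeriodicPt_minimalPeriod _ _
  have hiter : ∀ (k : ℕ) (x : W), M.faceStep^[k] (M.rv x) = M.rv (nxt^[k] x : W) := by
    intro k x
    induction k with
    | zero => rfl
    | succ k ih =>
      rw [Function.iterate_succ_apply', Function.iterate_succ_apply', ih]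
      exact (M.rv_rv _).symm
  have hper' : ∀ x k, ℓ x = k → nxt^[k] x = x := by
    rintro x k rfl
    have h : M.faceStep^[ℓ x] (M.rv x) = M.rv x := hper x
    rw [hiter] at h
    exact Subtype.ext (M.rv.injective h)
  have hℓ3 : ∀ x, 3 ≤ ℓ x := by
    intro x
    have h := hper x
    have hpos : 0 < ℓ x := Function.minimalPeriod_pos_of_mem_periodicPts
      (M.faceStep.injective.mem_periodicPts _)
    by_contra hlt
    have : ℓ x = 1 ∨ ℓ x = 2 := by omega
    rcases this with h1 | h1 <;> rw [h1] at h
    · exact M.faceStep_ne _ h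
    · exact M.faceStep_two_ne _ h
  have hadj' : ∀ x, H.Adj (π x) (π (nxt x)) := fun x => hπnxt x ▸ hadj x
  -- A boundary walk of a face of the other colour does not backtrack.
  have hback : ∀ x, π x ≠ π (nxt (nxt x)) := by
    intro x h
    rw [hπnxt (nxt x)] at h
    have h1 : op x = nxt x := hinj _ _ (hπnxt x).symm (by rw [hop]; exact h)
    exact hσ1 (nxt x) ((hnxt x).trans h1)
  have h3 : ∀ x, ℓ x = 3 → π x ∈ R ∧ π (op x) ∈ R ∧ π (op (σ x)) ∈ R := by
    intro x hx
    have hp : nxt (nxt (nxt x)) = x := hper' x 3 hx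
    have a1 := hadj' x
    have a2 := hadj' (nxt x)
    have a3 := hadj' (nxt (nxt x))
    rw [hp] at a3
    refine ⟨htriR _ _ _ a1 a2 a3, ?_, ?_⟩
    · rw [← hπnxt]; exact htriR _ _ _ a2 a3 a1
    · have h1 := hnxt (nxt (nxt x))
      rw [hp] at h1
      rw [h1, hop]
      exact htriR _ _ _ a3 a1 a2
  have h4 : ∀ x, ℓ x = 4 → π x ∉ R := by
    intro x hx hxR
    have hp : nxt (nxt (nxt (nxt x))) = x := hper' x 4 hx
    have a4 := hadj' (nxt (nxt (nxt x)))
    rw [hp] at a4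
    exact hback _ (hfourR _ _ _ _ hxR (hadj' x) (hadj' _) (hadj' _) a4 (hback x))
  -- No element of `R` has two triangles next to it on the other side, as its neighbours would all be
  -- in `R`.
  have hone : ∀ x, ¬ (ℓ x = 3 ∧ ℓ (σ x) = 3) := by
    rintro x ⟨hx, hx'⟩
    obtain ⟨m0, m1, m2⟩ := h3 x hx
    obtain ⟨-, -, m3⟩ := h3 (σ x) hx'
    have hn : ∀ y, π y = π x → π x ≠ π (op y) := fun y hy h => hπop y (h.symm.trans hy.symm)
    have hsub : ({π x, π (op x), π (op (σ x)), π (op (σ (σ x)))} : Finset T) ⊆ R := by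
      intro a ha
      simp only [Finset.mem_insert, Finset.mem_singleton] at ha
      rcases ha with rfl | rfl | rfl | rfl <;> assumption
    have := Finset.card_le_card hsub
    rw [Finset.card_insert_of_notMem (by simp [hn x rfl, hn (σ x) (hπσ x),
      hn (σ (σ x)) (by rw [hπσ, hπσ])]),
      Finset.card_insert_of_notMem (by simp [hne x, hne2 x]), Finset.card_pair (hne _), hR] at this
    omega
  have hcount : ∑ x : W, (1 / ℓ x : ℚ) = 6 := by
    have h1 := sum_inv_faceDegree hc false
    have h2 := card_face_color hP hc
    rw [hV, Nat.card_eq_fintype_card (α := {F // hc.faceColor F = true})] at h2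
    change _ + Fintype.card T = _ at h2
    have h3 : Nat.card {F // hc.faceColor F = false} = 6 := by omega
    rw [h3] at h1
    have h6 : ((6 : ℕ) : ℚ) = 6 := by norm_num
    rw [← h6, ← h1]
    exact Fintype.sum_equiv (M.rv.subtypeEquiv fun d => by rw [hc.rv]; cases c d <;> simp) _ _
      fun x => rfl
  -- A triangle in `R` has at most one neighbouring triangle on the other side, and no quadrangle:
  -- `1 / 3 + 1 / 5 + 1 / 5 = 11 / 15`. For the other triangles, `1 / 4 + 1 / 4 + 1 / 4 = 3 / 4`.
  have hbound : ∀ F : T, ∑ y ∈ Finset.univ.filter (fun y => π y = F), (1 / ℓ y : ℚ) ≤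
      if F ∈ R then 11 / 15 else 3 / 4 := by
    intro F
    obtain ⟨x, rfl⟩ := hπsurj F
    rw [hsum3]
    have inv : ∀ y k, 0 < k → k ≤ ℓ y → (1 / ℓ y : ℚ) ≤ 1 / k := fun y k hk h =>
      one_div_le_one_div_of_le (by exact_mod_cast hk) (by exact_mod_cast h)
    split_ifs with hF
    · have h5 : ∀ y, π y = π x → ℓ y = 3 ∨ 5 ≤ ℓ y := fun y hy => by
        have := hℓ3 y
        have : ℓ y ≠ 4 := fun h => h4 y h (hy ▸ hF)
        omega
      have b3 : ∀ y, (1 / ℓ y : ℚ) ≤ 1 / 3 := fun y => by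
        exact_mod_cast inv y 3 (by norm_num) (hℓ3 y)
      have b5 : ∀ y, 5 ≤ ℓ y → (1 / ℓ y : ℚ) ≤ 1 / 5 := fun y hy => by
        exact_mod_cast inv y 5 (by norm_num) hy
      have p1 := h5 x rfl
      have p2 := h5 (σ x) (hπσ x)
      have p3 := h5 (σ (σ x)) (by rw [hπσ, hπσ])
      have o1 := hone x
      have o2 := hone (σ x)
      have o3 := hone (σ (σ x))
      rw [hσ3] at o3
      have c1 := b3 x
      have c2 := b3 (σ x)
      have c3 := b3 (σ (σ x))
      have d1 := b5 x
      have d2 := b5 (σ x)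
      have d3 := b5 (σ (σ x))
      have : (5 ≤ ℓ x ∧ 5 ≤ ℓ (σ x)) ∨ (5 ≤ ℓ (σ x) ∧ 5 ≤ ℓ (σ (σ x))) ∨
          (5 ≤ ℓ x ∧ 5 ≤ ℓ (σ (σ x))) := by omega
      rcases this with ⟨e1, e2⟩ | ⟨e1, e2⟩ | ⟨e1, e2⟩
      · linarith [d1 e1, d2 e2]
      · linarith [d2 e1, d3 e2]
      · linarith [d1 e1, d3 e2]
    · have b4 : ∀ y, π y = π x → (1 / ℓ y : ℚ) ≤ 1 / 4 := fun y hy => by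
        have := hℓ3 y
        have h : ℓ y ≠ 3 := fun h => hF (hy ▸ (h3 y h).1)
        exact_mod_cast inv y 4 (by norm_num) (by omega)
      have c1 := b4 x rfl
      have c2 := b4 (σ x) (hπσ x)
      have c3 := b4 (σ (σ x)) (by rw [hπσ, hπσ])
      linarith
  have htotal : ∑ x : W, (1 / ℓ x : ℚ) ≤ ∑ F : T, if F ∈ R then 11 / 15 else 3 / 4 := by
    rw [← Finset.sum_fiberwise_of_maps_to (s := Finset.univ) (t := Finset.univ) (g := π)
      (fun _ _ => Finset.mem_univ _)]
    exact Finset.sum_le_sum fun F _ => hbound F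
  rw [hcount, Finset.sum_ite, Finset.sum_const, Finset.sum_const] at htotal
  have r1 : (Finset.univ.filter fun F : T => F ∈ R).card = 3 := by
    rw [Finset.filter_univ_mem, hR]
  have r2 : (Finset.univ.filter fun F : T => F ∉ R).card = 5 := by
    have := Finset.card_filter_add_card_filter_not (s := (Finset.univ : Finset T)) (fun F => F ∈ R)
    rw [r1, Finset.card_univ, hTcard] at this
    omega
  rw [r1, r2] at htotal
  norm_num at htotal

end QuarticMap

/-! ### Necessary conditions -/

namespace QuarticMap

variable {V D : Type} {M : QuarticMap V D}

theorem Tight.two_dvd_or_three_dvd [Finite D] [Finite V] (hP : M.Planar) (ht : M.Tight) :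
    2 ∣ Nat.card V ∨ 3 ∣ Nat.card V := by
  obtain ⟨c, hc⟩ := hP.exists_checkerboard
  rcases ht.classification hc with ⟨b, hb⟩ | ⟨d, hd, hg⟩
  · exact Or.inr (hc.three_dvd hb)
  · exact Or.inl ⟨_, ht.card_of_antiprism hc hd hg⟩

/-- With six vertices, there are eight faces and twenty-four darts, so all faces are triangles. -/
theorem Planar.tri_of_card_eq_six [Finite D] [Finite V] (hP : M.Planar) (hV : Nat.card V = 6)
    (d : D) : M.Tri d := by
  classical
  have := Fintype.ofFinite D
  have := Fintype.ofFinite V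
  obtain ⟨c, hc⟩ := hP.exists_checkerboard
  by_contra hd
  have h3 : ∀ x, 3 ≤ Function.minimalPeriod M.faceStep x := by
    intro x
    have h := Function.isPeriodicPt_minimalPeriod M.faceStep x
    have hpos : 0 < Function.minimalPeriod M.faceStep x :=
      Function.minimalPeriod_pos_of_mem_periodicPts (M.faceStep.injective.mem_periodicPts _)
    by_contra hlt
    have : Function.minimalPeriod M.faceStep x = 1 ∨ Function.minimalPeriod M.faceStep x = 2 := by
      omega
    rcases this with h1 | h1 <;> rw [h1] at h
    · exact M.faceStep_ne _ h
    · exact M.faceStep_two_ne _ h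
  have h4 : 4 ≤ Function.minimalPeriod M.faceStep d := by
    have := h3 d
    have : Function.minimalPeriod M.faceStep d ≠ 3 := fun h =>
      hd ((M.minimalPeriod_faceStep_eq_three_iff d).1 h)
    omega
  have hle : ∀ x, (1 / Function.minimalPeriod M.faceStep x : ℚ) ≤ 1 / 3 := fun x =>
    one_div_le_one_div_of_le (by norm_num) (by exact_mod_cast h3 x)
  have hcard : ∀ b, Fintype.card {x // c x = b} = 12 := fun b => by
    have := hc.two_mul_card b
    rw [M.card_dart, ← Nat.card_eq_fintype_card (α := V), hV] at this
    omega
  have hs : ∀ b, (Nat.card {F // hc.faceColor F = b} : ℚ) ≤ 4 := fun b => by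
    rw [← sum_inv_faceDegree]
    refine (Finset.sum_le_sum fun x _ => hle x.1).trans ?_
    rw [Finset.sum_const, Finset.card_univ, hcard]
    norm_num
  have hlt : (Nat.card {F // hc.faceColor F = c d} : ℚ) < 4 := by
    rw [← sum_inv_faceDegree]
    have h : ∑ x : {x // c x = c d}, (1 / 3 : ℚ) = 4 := by
      rw [Finset.sum_const, Finset.card_univ, hcard]; norm_num
    rw [← h]
    refine Finset.sum_lt_sum (fun x _ => hle x.1) ⟨⟨d, rfl⟩, Finset.mem_univ _, ?_⟩
    exact one_div_lt_one_div_of_lt (by norm_num) (by exact_mod_cast h4)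
  have htot := card_face_color hP hc
  rw [hV] at htot
  have h1 : Nat.card {F // hc.faceColor F = true} ≤ 4 := by exact_mod_cast hs true
  have h2 : Nat.card {F // hc.faceColor F = false} ≤ 4 := by exact_mod_cast hs false
  have h3 : Nat.card {F // hc.faceColor F = c d} < 4 := by exact_mod_cast hlt
  cases hcd : c d <;> rw [hcd] at h3 <;> omega

/-- In the octahedron, a straight-ahead walk closes after four steps. -/
theorem Knot.card_ne_six [Finite D] [Finite V] (hP : M.Planar) (hk : M.Knot) :
    Nat.card V ≠ 6 := by
  intro hV
  have := Fintype.ofFinite D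
  have := Fintype.ofFinite V
  have ht := hP.tri_of_card_eq_six hV
  have hD := M.card_dart
  rw [← Nat.card_eq_fintype_card, ← Nat.card_eq_fintype_card, hV] at hD
  obtain ⟨d, -⟩ := id hk
  have h4 : Function.IsPeriodicPt M.straight 4 d :=
    (straight_four (ht _) (ht _) (ht _)).trans (ht d)
  have := hk.card_dart_le d
  have := h4.minimalPeriod_le (by norm_num)
  omega

/-- In the antiprism over a hexagon, a straight-ahead walk closes after eight steps. -/
theorem Knot.card_ne_twelve [Finite D] [Finite V] (hP : M.Planar) (ht : M.Tight) (hk : M.Knot) :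
    Nat.card V ≠ 12 := by
  intro hV
  have := Fintype.ofFinite D
  have := Fintype.ofFinite V
  obtain ⟨c, hc⟩ := hP.exists_checkerboard
  rcases ht.classification hc with ⟨b, hb⟩ | ⟨d, hd, hg⟩
  · cases b with
    | true => exact hk.false_of_card_eq_twelve hP hc hb hV
    | false => exact hk.false_of_card_eq_twelve hP hc.not (fun d hd => hb d (by simpa using hd)) hV
  · have hD := M.card_dart
    rw [← Nat.card_eq_fintype_card, ← Nat.card_eq_fintype_card, hV] at hD
    have h6 := ht.card_of_antiprism hc hd hg
    have hp := Function.isPeriodicPt_minimalPeriod M.faceStep d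
    rw [show Function.minimalPeriod M.faceStep d = 6 by omega] at hp
    have hs : ∀ x, M.faceStep.SameCycle d x → M.faceStep.SameCycle d (M.faceStep x) :=
      fun x h => Equiv.Perm.sameCycle_apply_right.2 h
    have hr : ∀ x, M.faceStep.SameCycle d x → M.Tri (M.rv x) :=
      fun x h => ht.tri_rv (SameCycle.nontri hd h)
    have four : ∀ x, M.faceStep.SameCycle d x →
        M.straight (M.straight (M.straight (M.straight x))) =
          M.faceStep (M.faceStep (M.faceStep x)) := fun x h =>
      straight_four (hr _ (hs _ h)) (hr _ (hs _ (hs _ h))) (hg _ (hs _ (hs _ h)))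
    have h0 : M.faceStep.SameCycle d d := Equiv.Perm.SameCycle.refl _ _
    have h8 : Function.IsPeriodicPt M.straight 8 d := by
      have e := four _ (hs _ (hs _ (hs _ h0)))
      rw [← four d h0] at e
      exact e.trans ((congrArg (fun x => M.faceStep (M.faceStep (M.faceStep x))) (four d h0)).trans
        hp)
    have := hk.card_dart_le d
    have := h8.minimalPeriod_le (by norm_num)
    omega

end QuarticMap

namespace LuneFreeLinkGraph

variable {V : Type} [Finite V] (L : LuneFreeLinkGraph V)

theorem planar_toQuarticMap : L.toQuarticMap.Planar := by
  have := L.card_add_card_face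
  rw [QuarticMap.Planar]
  omega

theorem five_le_card {V : Type} [Finite V] (L : LuneFreeLinkGraph V) : 5 ≤ Nat.card V := by
  have := L.connected.nonempty
  obtain ⟨x⟩ := this
  have h1 : L.graph.neighborSet x ⊆ {x}ᶜ := fun y hy => by
    simpa using (SimpleGraph.Adj.ne' hy)
  have h2 := Set.ncard_le_ncard h1
  rw [L.regular, Set.ncard_compl, Set.ncard_singleton] at h2
  omega

theorem Tight.card {L : LuneFreeLinkGraph V} (h : L.Tight) :
    6 ≤ Nat.card V ∧ (2 ∣ Nat.card V ∨ 3 ∣ Nat.card V) := by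
  have h1 := L.five_le_card
  have h2 := QuarticMap.Tight.two_dvd_or_three_dvd L.planar_toQuarticMap (L.tight_iff.1 h)
  omega

theorem IsKnot.card {L : LuneFreeLinkGraph V} (h : L.Tight) (hk : L.IsKnot) :
    8 ≤ Nat.card V ∧ Nat.card V ≠ 12 := by
  have h1 := h.card
  have h2 := QuarticMap.Knot.card_ne_six (M := L.toQuarticMap) L.planar_toQuarticMap hk
  have h3 := QuarticMap.Knot.card_ne_twelve (M := L.toQuarticMap) L.planar_toQuarticMap
    (L.tight_iff.1 h) hk
  omega

end LuneFreeLinkGraph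

/-! ### Link graphs described by maps -/

theorem sameCycle_of_semiconj {D E : Type} {f : Equiv.Perm D} {g : Equiv.Perm E} {e : D → E}
    (h : ∀ d, g (e d) = e (f d)) {x y : D} [Finite D] (hxy : f.SameCycle x y) :
    g.SameCycle (e x) (e y) := by
  obtain ⟨i, -, rfl⟩ := hxy.exists_pow_eq'
  induction i with
  | zero => rfl
  | succ i ih =>
    rw [pow_succ', Equiv.Perm.mul_apply, ← h, Equiv.Perm.sameCycle_apply_right]
    exact ih ⟨i, by simp⟩

namespace QuarticMap

variable {V D : Type} (M : QuarticMap V D)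

/-- A labelling of the faces by as many labels as a planar map has faces certifies planarity, since
a map never has more faces than that. -/
theorem planar_of_labelling [Finite D] [Finite V] {Φ : Type} [Finite Φ] (lab : D → Φ)
    (hs : Function.Surjective lab) (hl : ∀ d, lab (M.faceStep d) = lab d)
    (hΦ : Nat.card V + 2 ≤ Nat.card Φ) : M.Planar := by
  have hl' : ∀ d d', M.faceStep.SameCycle d d' → lab d = lab d' := by
    intro d d' h
    obtain ⟨i, -, rfl⟩ := h.exists_pow_eq'
    induction i with
    | zero => rfl
    | succ i ih => rw [pow_succ', Equiv.Perm.mul_apply, hl, ← ih ⟨i, by simp⟩]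
  have hsurj : Function.Surjective (Quotient.lift lab hl' : M.Face → Φ) := fun φ => by
    obtain ⟨d, rfl⟩ := hs φ
    exact ⟨M.face d, rfl⟩
  exact le_antisymm M.card_face_le (hΦ.trans (Nat.card_le_card_of_surjective _ hsurj))

/-- To see that all edges lie on one straight-ahead walk, it suffices to consider classes of darts
closed under reversal and straight-ahead steps. -/
theorem knot_of_forall (d₀ : D) (h : ∀ E : D → Prop, (∀ d, E (M.rv d) ↔ E d) →
    (∀ d, E (M.straight d) ↔ E d) → E d₀ → ∀ d, E d) : M.Knot := by
  have hr : ∀ x, M.straight (M.rv (M.straight x)) = M.rv x := fun x => by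
    rw [M.straight_apply, M.rv_rv, M.straight_apply, M.nx_four]
  refine ⟨d₀, h _ (fun d => ?_) (fun d => ?_) (Or.inl (Equiv.Perm.SameCycle.refl _ _))⟩
  · rw [M.rv_rv]
    exact Or.comm
  · rw [Equiv.Perm.sameCycle_apply_right,
      ← Equiv.Perm.sameCycle_apply_right (y := M.rv (M.straight d)), hr]

/-- The underlying graph of a map. -/
def graph : SimpleGraph V where
  Adj u v := ∃ d, M.src d = u ∧ M.src (M.rv d) = v
  symm := ⟨by
    rintro _ _ ⟨d, rfl, rfl⟩
    exact ⟨M.rv d, rfl, by rw [M.rv_rv]⟩⟩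
  loopless := ⟨by
    rintro _ ⟨d, rfl, h⟩
    exact M.src_rv_ne d h⟩

/-- The darts of a map are those of its graph. -/
noncomputable def dartEquiv : D ≃ M.graph.Dart :=
  Equiv.ofBijective (fun d => ⟨(M.src d, M.src (M.rv d)), ⟨d, rfl, rfl⟩⟩)
    ⟨fun d d' h => by
      have h' := congrArg SimpleGraph.Dart.toProd h
      exact M.simple d d' (congrArg Prod.fst h') (congrArg Prod.snd h'),
    fun ⟨⟨u, v⟩, ⟨d, hu, hv⟩⟩ => ⟨d, SimpleGraph.Dart.ext _ _ (Prod.ext hu hv)⟩⟩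

theorem dartEquiv_rv (d : D) :
    RotationSystem.rev M.graph (M.dartEquiv d) = M.dartEquiv (M.rv d) := by
  apply SimpleGraph.Dart.ext
  change (M.src (M.rv d), M.src d) = (M.src (M.rv d), M.src (M.rv (M.rv d)))
  rw [M.rv_rv]

/-- The rotation system of a map. -/
noncomputable def rotation [Finite D] : RotationSystem M.graph where
  next := M.dartEquiv.permCongr M.nx
  next_fst d := by
    obtain ⟨d, rfl⟩ := M.dartEquiv.surjective d
    simp only [Equiv.permCongr_apply, Equiv.symm_apply_apply]
    exact M.src_nx d
  sameCycle_of_fst_eq d d' h := by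
    obtain ⟨d, rfl⟩ := M.dartEquiv.surjective d
    obtain ⟨d', rfl⟩ := M.dartEquiv.surjective d'
    exact sameCycle_of_semiconj (fun d => by simp) (M.sameCycle d d' h)

theorem rotation_faceStep [Finite D] (d : D) :
    M.rotation.faceStep (M.dartEquiv d) = M.dartEquiv (M.faceStep d) := by
  simp only [RotationSystem.faceStep, Equiv.trans_apply, dartEquiv_rv]
  rw [Equiv.symm_apply_eq]
  simp [rotation, M.nx_faceStep]

theorem rotation_straight [Finite D] (d : D) :
    M.rotation.straight (M.dartEquiv d) = M.dartEquiv (M.straight d) := by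
  simp only [RotationSystem.straight, Equiv.trans_apply, dartEquiv_rv]
  simp [rotation, M.straight_apply]

variable {M}

theorem Planar.rotation [Finite D] [Finite V] (hP : M.Planar) : M.rotation.IsPlanar := by
  classical
  have := Fintype.ofFinite V
  have := Fintype.ofFinite D
  have : Finite M.graph.Dart := Finite.of_equiv _ M.dartEquiv
  have := Fintype.ofFinite M.graph.Dart
  have hF : Nat.card M.Face = Nat.card M.rotation.Face := by
    refine Nat.card_congr (Quotient.congr M.dartEquiv fun d d' => ?_)
    constructor
    · exact fun h => sameCycle_of_semiconj M.rotation_faceStep h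
    · intro h
      have := sameCycle_of_semiconj (f := M.rotation.faceStep) (g := M.faceStep)
        (e := M.dartEquiv.symm) (fun x => by
          obtain ⟨x, rfl⟩ := M.dartEquiv.surjective x
          rw [M.rotation_faceStep, Equiv.symm_apply_apply, Equiv.symm_apply_apply]) h
      exact (by simpa using this : M.faceStep.SameCycle d d')
  have h1 := M.graph.dart_card_eq_twice_card_edges
  have h2 := M.card_dart
  have h3 : Fintype.card M.graph.Dart = 2 * M.graph.edgeFinset.card := by
    convert h1
  have h4 := Fintype.card_congr M.dartEquiv
  rw [RotationSystem.IsPlanar, ← hF, hP, Nat.card_eq_fintype_card, Nat.card_eq_fintype_card,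
    ← SimpleGraph.edgeFinset_card]
  omega

/-- The lune-free link graph described by a planar map. -/
noncomputable def Planar.toLink [Finite D] [Finite V] (hP : M.Planar) : LuneFreeLinkGraph V where
  graph := M.graph
  connected := by
    obtain ⟨u⟩ : Nonempty V := by
      by_contra h
      rw [not_nonempty_iff] at h
      have : IsEmpty D := ⟨fun d => h.elim (M.src d)⟩
      have h2 : Nat.card M.Face = 0 :=
        Nat.card_eq_zero.2 (Or.inl ⟨fun F => by
          obtain ⟨d, -⟩ := M.face_surjective F
          exact this.elim d⟩)
      rw [Planar, h2] at hP
      omega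
    have : ∀ v, M.graph.Reachable u v := fun v =>
      M.connected (fun v => M.graph.Reachable u v)
        (fun d hd => hd.trans (SimpleGraph.Adj.reachable ⟨d, rfl, rfl⟩)) u v
          (SimpleGraph.Reachable.refl _)
    exact { preconnected := fun v w => (this v).symm.trans (this w), nonempty := ⟨u⟩ }
  regular x := by
    classical
    have := Fintype.ofFinite D
    rw [← M.card_fiber_src x, ← Set.ncard_coe_finset]
    symm
    refine Set.ncard_congr (fun d _ => M.src (M.rv d)) ?_ ?_ ?_
    · intro d hd
      exact ⟨d, by simpa using hd, rfl⟩
    · intro d d' hd hd' h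
      simp only [Finset.coe_filter, Finset.mem_univ, true_and, Set.mem_ofPred_eq] at hd hd'
      exact M.simple d d' (hd.trans hd'.symm) h
    · rintro y ⟨d, hd, hy⟩
      exact ⟨d, by simpa using hd, hy⟩
  rotation := M.rotation
  planar := hP.rotation

theorem Tight.toLink [Finite D] [Finite V] (hP : M.Planar) (ht : M.Tight) : hP.toLink.Tight := by
  rw [LuneFreeLinkGraph.tight_iff]
  have h : ∀ d, hP.toLink.toQuarticMap.faceStep (M.dartEquiv d) = M.dartEquiv (M.faceStep d) :=
    M.rotation_faceStep
  have hr : ∀ d, hP.toLink.toQuarticMap.rv (M.dartEquiv d) = M.dartEquiv (M.rv d) :=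
    M.dartEquiv_rv
  intro d
  obtain ⟨d, rfl⟩ := M.dartEquiv.surjective d
  simp only [h, hr]
  exact (ht d).imp (congrArg _) (congrArg _)

theorem Knot.toLink [Finite D] [Finite V] (hP : M.Planar) (hk : M.Knot) : hP.toLink.IsKnot := by
  obtain ⟨d₀, h⟩ := hk
  refine ⟨M.dartEquiv d₀, fun d => ?_⟩
  obtain ⟨d, rfl⟩ := M.dartEquiv.surjective d
  have hr : (M.dartEquiv d).symm = M.dartEquiv (M.rv d) := M.dartEquiv_rv d
  rcases h d with h | h
  · exact Or.inl (sameCycle_of_semiconj M.rotation_straight h)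
  · refine Or.inr ?_
    have := sameCycle_of_semiconj M.rotation_straight h
    rw [← hr] at this
    exact this

end QuarticMap

/-! ### Medial maps of cubic maps -/

/-- A simple connected cubic map on the vertices `T`: the darts at the vertex `t` are `(t, i)`, in
counterclockwise order, and `opp` reverses darts. -/
structure CubicMap (T : Type) where
  opp : T × Fin 3 → T × Fin 3
  opp_opp : ∀ x, opp (opp x) = x
  opp_fst_ne : ∀ x, (opp x).1 ≠ x.1
  simple : ∀ t i j, (opp (t, i)).1 = (opp (t, j)).1 → i = j
  connected : ∀ p : T → Prop, (∀ x, p x.1 → p (opp x).1) → ∀ t u, p t → p u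

namespace CubicMap

/-- The next dart around a vertex of a cubic map. -/
def turn (T : Type) : Equiv.Perm (T × Fin 3) where
  toFun x := (x.1, x.2 + 1)
  invFun x := (x.1, x.2 - 1)
  left_inv x := by simp
  right_inv x := by simp

variable {T : Type} (K : CubicMap T)

theorem turn_three (x : T × Fin 3) : turn T (turn T (turn T x)) = x := by
  obtain ⟨t, i⟩ := x
  have : ∀ i : Fin 3, i + 1 + 1 + 1 = i := by decide
  exact Prod.ext rfl (this i)

theorem turn_ne (x : T × Fin 3) : turn T x ≠ x := fun h => by
  have : ∀ i : Fin 3, i + 1 ≠ i := by decide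
  exact this x.2 (congrArg Prod.snd h)

theorem turn_symm_zero (t : T) : (turn T).symm (t, 0) = (t, 2) :=
  (turn T).symm_apply_eq.2 (Prod.ext rfl (by decide : (0 : Fin 3) = 2 + 1))

theorem turn_symm_one (t : T) : (turn T).symm (t, 1) = (t, 0) :=
  (turn T).symm_apply_eq.2 (Prod.ext rfl (by decide : (1 : Fin 3) = 0 + 1))

theorem turn_symm_two (t : T) : (turn T).symm (t, 2) = (t, 1) :=
  (turn T).symm_apply_eq.2 (Prod.ext rfl (by decide : (2 : Fin 3) = 1 + 1))

theorem fst {x y : T × Fin 3} (h : x = y) : x.1 = y.1 := congrArg Prod.fst h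

theorem eq_of_opp_fst_eq {x y : T × Fin 3} (h : x.1 = y.1) (h' : (K.opp x).1 = (K.opp y).1) :
    x = y := by
  obtain ⟨t, i⟩ := x
  obtain ⟨u, j⟩ := y
  obtain rfl : t = u := h
  rw [K.simple t i j h']

/-- Two darts are related if they belong to the same edge. -/
def edgeSetoid : Setoid (T × Fin 3) where
  r x y := y = x ∨ y = K.opp x
  iseqv :=
    { refl := fun _ => Or.inl rfl
      symm := by
        rintro x y (rfl | rfl)
        · exact Or.inl rfl
        · exact Or.inr (K.opp_opp x).symm
      trans := by
        rintro x y z (rfl | rfl) (rfl | rfl)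
        · exact Or.inl rfl
        · exact Or.inr rfl
        · exact Or.inr rfl
        · exact Or.inl (K.opp_opp x) }

/-- The edges of a cubic map. -/
def Edge : Type := Quotient K.edgeSetoid

/-- The edge of a dart. -/
def edge (x : T × Fin 3) : K.Edge := Quotient.mk _ x

theorem edge_eq_iff {x y : T × Fin 3} : K.edge x = K.edge y ↔ y = x ∨ y = K.opp x := Quotient.eq

theorem edge_opp (x : T × Fin 3) : K.edge (K.opp x) = K.edge x :=
  K.edge_eq_iff.2 (Or.inr (K.opp_opp x).symm)

/-- The edge of the cubic map at which a dart of the medial map starts. A dart `x` of the cubic map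
gives the corner between `x` and `turn x`, which is an edge of the medial map; its dart `(x, true)`
goes from the edge of `x` to the edge of `turn x`, and `(x, false)` goes back. -/
def medialSrc : (T × Fin 3) × Bool → K.Edge
  | (x, true) => K.edge x
  | (x, false) => K.edge (turn T x)

/-- The next dart around a vertex of the medial map. -/
def medialNext : Equiv.Perm ((T × Fin 3) × Bool) where
  toFun
    | (x, true) => ((turn T).symm x, false)
    | (x, false) => (K.opp (turn T x), true)
  invFun
    | (x, true) => ((turn T).symm (K.opp x), false)
    | (x, false) => (turn T x, true)
  left_inv := by rintro ⟨x, _ | _⟩ <;> simp [K.opp_opp]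
  right_inv := by rintro ⟨x, _ | _⟩ <;> simp [K.opp_opp]

theorem medialNext_true (x : T × Fin 3) : K.medialNext (x, true) = ((turn T).symm x, false) := rfl

theorem medialNext_false (x : T × Fin 3) : K.medialNext (x, false) = (K.opp (turn T x), true) := rfl

/-- The medial map of a cubic map: its vertices are the edges of the cubic map, and its faces are the
vertices and the faces of the cubic map. The former are triangles. -/
def medial : QuarticMap K.Edge ((T × Fin 3) × Bool) where
  src := K.medialSrc
  nx := K.medialNext
  rv := ⟨fun d => (d.1, !d.2), fun d => (d.1, !d.2), fun d => by simp, fun d => by simp⟩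
  src_nx := by
    rintro ⟨x, _ | _⟩
    · exact K.edge_opp _
    · exact congrArg K.edge ((turn T).apply_symm_apply x)
  sameCycle := by
    have key : ∀ d : (T × Fin 3) × Bool, ∃ x, K.medialNext.SameCycle d (x, true) ∧
        K.medialSrc d = K.edge x := by
      rintro ⟨x, _ | _⟩
      · refine ⟨turn T x, ?_, rfl⟩
        rw [← Equiv.Perm.sameCycle_apply_right, medialNext_true, Equiv.symm_apply_apply]
      · exact ⟨x, Equiv.Perm.SameCycle.refl _ _, rfl⟩
    intro d d' h
    obtain ⟨x, hx, hx'⟩ := key d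
    obtain ⟨y, hy, hy'⟩ := key d'
    rw [hx', hy', edge_eq_iff] at h
    refine (hx.trans ?_).trans hy.symm
    rcases h with rfl | rfl
    · rfl
    · rw [← Equiv.Perm.sameCycle_apply_left, ← Equiv.Perm.sameCycle_apply_left, medialNext_true,
        medialNext_false, Equiv.apply_symm_apply]
  nx_four := by
    rintro ⟨x, _ | _⟩ <;> simp [medialNext_true, medialNext_false, K.opp_opp]
  nx_two_ne := by
    rintro ⟨x, _ | _⟩ h
    · rw [medialNext_false, medialNext_true, Prod.mk.injEq, Equiv.symm_apply_eq] at h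
      exact K.opp_fst_ne _ (congrArg Prod.fst h.1)
    · rw [medialNext_true, medialNext_false, Prod.mk.injEq, Equiv.apply_symm_apply] at h
      exact K.opp_fst_ne _ (congrArg Prod.fst h.1)
  rv_rv d := by simp
  src_rv_ne := by
    have : ∀ x, K.edge x ≠ K.edge (turn T x) := fun x h => by
      rcases K.edge_eq_iff.1 h with h | h
      · exact turn_ne x h
      · exact K.opp_fst_ne x (fst h.symm :)
    rintro ⟨x, _ | _⟩
    · exact this x
    · exact (this x).symm
  simple := by
    have same : ∀ x y, K.edge x = K.edge y → K.edge (turn T x) = K.edge (turn T y) → x = y := by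
      intro x y h h'
      rcases K.edge_eq_iff.1 h with rfl | rfl
      · rfl
      · rcases K.edge_eq_iff.1 h' with h' | h'
        · exact ((turn T).injective h').symm
        · exact absurd (K.eq_of_opp_fst_eq (x := turn T x) (y := x) rfl (fst h'.symm :)) (turn_ne x)
    have cross : ∀ x y, K.edge x = K.edge (turn T y) → K.edge (turn T x) ≠ K.edge y := by
      intro x y h h'
      rcases K.edge_eq_iff.1 h with h | h <;> rcases K.edge_eq_iff.1 h' with rfl | rfl
      · exact turn_ne (turn T (turn T x)) (by rw [turn_three, h])
      · exact K.opp_fst_ne (turn T x) (fst h :)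
      · exact K.opp_fst_ne x (fst h.symm :)
      · exact turn_ne x (K.eq_of_opp_fst_eq (x := turn T x) (y := x) rfl (fst h :))
    rintro ⟨x, _ | _⟩ ⟨y, _ | _⟩ h h'
    · rw [same x y h' h]
    · exact absurd h (cross x y h')
    · exact absurd h' (cross x y h)
    · rw [same x y h h']
  src_surjective := by
    intro e
    obtain ⟨x, rfl⟩ := Quotient.exists_rep e
    exact ⟨(x, true), rfl⟩
  connected := by
    intro p hp e e' he
    have hturn : ∀ x, p (K.edge x) → p (K.edge (turn T x)) := fun x => hp (x, true)
    have hall : ∀ x y : T × Fin 3, x.1 = y.1 → p (K.edge x) → p (K.edge y) := by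
      rintro ⟨t, i⟩ ⟨u, j⟩ h hx
      obtain rfl : t = u := h
      have h1 := hturn _ hx
      have h2 := hturn _ h1
      have : ∀ i j : Fin 3, j = i ∨ j = i + 1 ∨ j = i + 1 + 1 := by decide
      rcases this i j with rfl | rfl | rfl
      exacts [hx, h1, h2]
    obtain ⟨x, rfl⟩ := Quotient.exists_rep e
    obtain ⟨y, rfl⟩ := Quotient.exists_rep e'
    exact K.connected (fun t => ∀ z : T × Fin 3, z.1 = t → p (K.edge z))
      (fun z hz w hw => hall (K.opp z) w hw.symm (by rw [K.edge_opp]; exact hz z rfl)) x.1 y.1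
      (fun z hz => hall x z hz.symm he) y rfl

theorem medial_faceStep_true (x : T × Fin 3) :
    K.medial.faceStep (x, true) = (turn T x, true) := rfl

theorem medial_straight_true (x : T × Fin 3) :
    K.medial.straight (x, true) = ((turn T).symm (K.opp (turn T x)), false) := rfl

theorem medial_straight_false (x : T × Fin 3) :
    K.medial.straight (x, false) = (K.opp x, true) :=
  congrArg (fun y => (K.opp y, true)) ((turn T).apply_symm_apply x)

theorem tight_medial : K.medial.Tight := by
  have : ∀ x, K.medial.Tri (x, true) := fun x => by
    simp only [QuarticMap.Tri, medial_faceStep_true, turn_three]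
  rintro ⟨x, _ | _⟩
  · exact Or.inr (this x)
  · exact Or.inl (this x)

instance [Finite T] : Finite K.Edge := Quotient.finite _

theorem two_mul_card_edge [Finite T] : 2 * Nat.card K.Edge = 3 * Nat.card T := by
  classical
  have := Fintype.ofFinite T
  have := Fintype.ofFinite K.Edge
  have h := K.medial.card_dart
  rw [Fintype.card_prod, Fintype.card_prod, Fintype.card_fin, Fintype.card_bool] at h
  rw [Nat.card_eq_fintype_card, Nat.card_eq_fintype_card]
  omega

/-- The strands of the medial map of a cubic map correspond to the classes of corners generated by
`x ∼ opp x` and `turn⁻¹ x ∼ turn⁻¹ (opp x)`. -/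
theorem knot_medial (x₀ : T × Fin 3) (h : ∀ C : T × Fin 3 → Prop, (∀ x, C (K.opp x) ↔ C x) →
    (∀ x, C ((turn T).symm (K.opp x)) ↔ C ((turn T).symm x)) → C x₀ → ∀ x, C x) :
    K.medial.Knot := by
  refine K.medial.knot_of_forall (x₀, true) fun E hr hs h0 => ?_
  have hr' : ∀ x, E (x, false) ↔ E (x, true) := fun x => hr (x, true)
  have := h (fun x => E (x, true))
    (fun x => by rw [← medial_straight_false, hs, hr'])
    (fun x => by
      have := hs ((turn T).symm x, true)
      rw [medial_straight_true, Equiv.apply_symm_apply, hr'] at this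
      exact this) h0
  rintro ⟨x, _ | _⟩
  · exact (hr' x).2 (this x)
  · exact this x

/-- The faces of the cubic map are labelled by `lab x`, for the face in the corner between `x` and
`turn x`. -/
theorem planar_medial [Finite T] {Φ : Type} [Finite Φ] (lab : T × Fin 3 → Φ)
    (hs : Function.Surjective lab) (hl : ∀ x, lab ((turn T).symm (K.opp x)) = lab x)
    (hΦ : 2 * Nat.card Φ = Nat.card T + 4) : K.medial.Planar := by
  refine K.medial.planar_of_labelling (Φ := T ⊕ Φ)
    (fun d => if d.2 then Sum.inl d.1.1 else Sum.inr (lab d.1)) ?_ ?_ ?_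
  · rintro (t | φ)
    · exact ⟨((t, 0), true), rfl⟩
    · obtain ⟨x, rfl⟩ := hs φ
      exact ⟨(x, false), rfl⟩
  · rintro ⟨x, _ | _⟩
    · exact congrArg Sum.inr (hl x)
    · rfl
  · rw [Nat.card_sum]
    have := K.two_mul_card_edge
    omega

end CubicMap

/-! ### Antiprisms -/

/-- Steps by a unit reach all of `ZMod N`. -/
theorem ZMod.forall_of_step {N a : ℕ} [NeZero N] (ha : a.Coprime N) {p : ZMod N → Prop}
    (hp : ∀ i, p i → p (i + a)) {i : ZMod N} (hi : p i) (j : ZMod N) : p j := by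
  have key : ∀ k : ℕ, p (i + k * a) := by
    intro k
    induction k with
    | zero => simpa using hi
    | succ k ih =>
      have := hp _ ih
      rwa [add_assoc, ← add_one_mul, ← Nat.cast_succ] at this
  have := key ((j - i) * (a : ZMod N)⁻¹).val
  rwa [ZMod.natCast_zmod_val, mul_assoc, mul_comm _ (a : ZMod N), ZMod.coe_mul_inv_eq_one _ ha,
    mul_one, add_sub_cancel] at this

namespace Antiprism

/-- The four displacements `2, 1, -1, -2` between adjacent vertices of an antiprism, whose vertices
are numbered in zigzag order around the band of triangles. -/
def shift : Fin 4 → ℤ := ![2, 1, -1, -2]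

theorem shift_rev (k : Fin 4) : shift k.rev = -shift k := by revert k; decide

variable (N : ℕ)

/-- The parity of a vertex, for even `N`. -/
def parity (h2 : 2 ∣ N) : ZMod N →+* ZMod 2 := ZMod.castHom h2 _

variable {N}

theorem parity_shift (h2 : 2 ∣ N) (j : ZMod N) (k : Fin 4) :
    parity N h2 (j + shift k) = parity N h2 j + shift k := by
  rw [map_add, map_intCast]

theorem two_cases (x : ZMod 2) : x = 0 ∨ x = 1 := by revert x; decide

/-- Around an even vertex the neighbours are, counterclockwise, at distance `2, 1, -1, -2`, around
an odd one they come in the opposite order. -/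
def next (h2 : 2 ∣ N) : Equiv.Perm (ZMod N × Fin 4) where
  toFun d := (d.1, if parity N h2 d.1 = 0 then d.2 + 1 else d.2 - 1)
  invFun d := (d.1, if parity N h2 d.1 = 0 then d.2 - 1 else d.2 + 1)
  left_inv d := by by_cases h : parity N h2 d.1 = 0 <;> simp [h]
  right_inv d := by by_cases h : parity N h2 d.1 = 0 <;> simp [h]

/-- Reversal of darts: `Fin.rev` negates the displacement. -/
def reverse (N : ℕ) : Equiv.Perm (ZMod N × Fin 4) where
  toFun d := (d.1 + shift d.2, d.2.rev)
  invFun d := (d.1 + shift d.2, d.2.rev)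
  left_inv d := by simp [shift_rev]
  right_inv d := by simp [shift_rev]

theorem shift_injective (h : 6 ≤ N) {k l : Fin 4} (hkl : (shift k : ZMod N) = shift l) : k = l := by
  rw [ZMod.intCast_eq_intCast_iff_dvd_sub] at hkl
  have h4 : ∀ k l : Fin 4, |shift l - shift k| < 6 := by decide
  have h5 : ∀ k l : Fin 4, shift l - shift k = 0 → k = l := by decide
  exact h5 k l (Int.eq_zero_of_abs_lt_dvd hkl ((h4 k l).trans_le (by exact_mod_cast h)))

theorem shift_ne_zero (h : 6 ≤ N) (k : Fin 4) : (shift k : ZMod N) ≠ 0 := by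
  intro hk
  rw [ZMod.intCast_zmod_eq_zero_iff_dvd] at hk
  have h4 : ∀ k : Fin 4, |shift k| < 6 := by decide
  have h5 : ∀ k : Fin 4, shift k ≠ 0 := by decide
  exact h5 k (Int.eq_zero_of_abs_lt_dvd hk ((h4 k).trans_le (by exact_mod_cast h)))

theorem next_even (h2 : 2 ∣ N) {j : ZMod N} (hj : parity N h2 j = 0) (k : Fin 4) :
    next h2 (j, k) = (j, k + 1) := by
  simp [next, hj]

theorem next_odd (h2 : 2 ∣ N) {j : ZMod N} (hj : parity N h2 j ≠ 0) (k : Fin 4) :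
    next h2 (j, k) = (j, k - 1) := by
  simp [next, hj]

theorem next_next (h2 : 2 ∣ N) (j : ZMod N) (k : Fin 4) :
    next h2 (next h2 (j, k)) = (j, k + 2) := by
  have h : ∀ k : Fin 4, k + 1 + 1 = k + 2 ∧ k - 1 - 1 = k + 2 := by decide
  by_cases hj : parity N h2 j = 0
  · rw [next_even h2 hj, next_even h2 hj, (h k).1]
  · rw [next_odd h2 hj, next_odd h2 hj, (h k).2]

/-- The antiprism with `N` vertices. -/
def map (h2 : 2 ∣ N) (h6 : 6 ≤ N) : QuarticMap (ZMod N) (ZMod N × Fin 4) where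
  src := Prod.fst
  nx := next h2
  rv := reverse N
  src_nx _ := rfl
  sameCycle := by
    rintro ⟨j, k⟩ ⟨j', l⟩ h
    obtain rfl : j = j' := h
    have step : ∀ k, (next h2).SameCycle (j, k) (j, k + 1) := by
      intro k
      by_cases hj : parity N h2 j = 0
      · rw [← next_even h2 hj, Equiv.Perm.sameCycle_apply_right]
      · have := next_odd h2 hj (k + 1)
        rw [add_sub_cancel_right] at this
        rw [← this, Equiv.Perm.sameCycle_apply_left]
    have h4 : ∀ k l : Fin 4, l = k ∨ l = k + 1 ∨ l = k + 1 + 1 ∨ l = k + 1 + 1 + 1 := by decide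
    rcases h4 k l with rfl | rfl | rfl | rfl
    exacts [Equiv.Perm.SameCycle.refl _ _, step _, (step _).trans (step _),
      ((step _).trans (step _)).trans (step _)]
  nx_four d := by
    obtain ⟨j, k⟩ := d
    have h : ∀ k : Fin 4, k + 2 + 2 = k := by decide
    rw [next_next, next_next, h]
  nx_two_ne d := by
    obtain ⟨j, k⟩ := d
    have h : ∀ k : Fin 4, k + 2 ≠ k := by decide
    rw [next_next]
    exact fun h' => h k (congrArg Prod.snd h')
  rv_rv d := (reverse N).left_inv d
  src_rv_ne d h := shift_ne_zero h6 d.2 (by simpa [reverse] using h)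
  simple := by
    rintro ⟨j, k⟩ ⟨j', l⟩ h h'
    obtain rfl : j = j' := h
    exact Prod.ext rfl (shift_injective h6 (add_left_cancel h'))
  src_surjective j := ⟨(j, 0), rfl⟩
  connected p hp i j hi := by
    have : NeZero N := ⟨by omega⟩
    exact ZMod.forall_of_step (a := 1) (Nat.coprime_one_left N)
      (fun i hi => by simpa [reverse, shift] using hp (i, 1) hi) hi j

variable (h2 : 2 ∣ N) (h6 : 6 ≤ N)

theorem faceStep_even {j : ZMod N} (hj : parity N h2 j = 0) (k : Fin 4) :
    (map h2 h6).faceStep (j, k) = (j + shift k, (![2, 3, 2, 3] : Fin 4 → Fin 4) k) := by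
  have h := parity_shift h2 j k
  rw [hj, zero_add] at h
  have h' : ∀ k : Fin 4, (if (shift k : ZMod 2) = 0 then k.rev - 1 else k.rev + 1) =
    (![2, 3, 2, 3] : Fin 4 → Fin 4) k := by decide
  rw [← h' k, ← h]
  rfl

theorem faceStep_odd {j : ZMod N} (hj : parity N h2 j = 1) (k : Fin 4) :
    (map h2 h6).faceStep (j, k) = (j + shift k, (![0, 1, 0, 1] : Fin 4 → Fin 4) k) := by
  have h := parity_shift h2 j k
  rw [hj] at h
  have h' : ∀ k : Fin 4, (if 1 + (shift k : ZMod 2) = 0 then k.rev - 1 else k.rev + 1) =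
    (![0, 1, 0, 1] : Fin 4 → Fin 4) k := by decide
  rw [← h' k, ← h]
  rfl

theorem straight_apply (j : ZMod N) (k : Fin 4) :
    (map h2 h6).straight (j, k) = (j + shift k, k.rev + 2) :=
  next_next h2 _ _

/-- The faces of the antiprism: the triangles with vertices `j, j + 1, j + 2`, and the two bases. -/
def label (d : ZMod N × Fin 4) : ZMod N ⊕ Bool :=
  if parity N h2 d.1 = 0 then
    (![Sum.inl d.1, Sum.inl (d.1 - 1), Sum.inl (d.1 - 2), Sum.inr false] :
      Fin 4 → ZMod N ⊕ Bool) d.2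
  else
    (![Sum.inr true, Sum.inl d.1, Sum.inl (d.1 - 1), Sum.inl (d.1 - 2)] :
      Fin 4 → ZMod N ⊕ Bool) d.2

theorem parity_add_two (j : ZMod N) : parity N h2 (j + 2) = parity N h2 j := by
  rw [map_add, map_ofNat]
  exact add_zero _

theorem parity_sub_two (j : ZMod N) : parity N h2 (j - 2) = parity N h2 j := by
  rw [map_sub, map_ofNat]
  exact sub_zero _

theorem planar : (map h2 h6).Planar := by
  have : NeZero N := ⟨by omega⟩
  refine (map h2 h6).planar_of_labelling (label h2) ?_ ?_ ?_
  · rintro (j | _ | _)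
    · rcases two_cases (parity N h2 j) with hj | hj
      · exact ⟨(j, 0), by simp [label, hj]⟩
      · exact ⟨(j, 1), by simp [label, hj]⟩
    · exact ⟨(0, 3), by simp [label]⟩
    · exact ⟨(1, 0), by simp [label]⟩
  · rintro ⟨j, k⟩
    have e1 : j + 2 - 1 = j + 1 := by ring
    have e2 : j - 1 - 1 = j - 2 := by ring
    have e3 : j + 1 - 2 = j - 1 := by ring
    rcases two_cases (parity N h2 j) with hj | hj
    · rw [faceStep_even h2 h6 hj]
      fin_cases k <;>
        simp [label, shift, hj, parity_add_two, ← sub_eq_add_neg, parity_sub_two, e1, e2, e3]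
    · rw [faceStep_odd h2 h6 hj]
      have h11 : (1 : ZMod 2) + 1 = 0 := rfl
      fin_cases k <;>
        simp [label, shift, hj, parity_add_two, ← sub_eq_add_neg, parity_sub_two, e1, e2, e3, h11]
  · simp

theorem tri_of_even {j : ZMod N} {k : Fin 4} (hj : parity N h2 j = 0) (hk : k ≠ 3) :
    (map h2 h6).Tri (j, k) := by
  have h := parity_shift h2 j k
  have h' := parity_shift h2 (j + shift k) ((![2, 3, 2, 3] : Fin 4 → Fin 4) k)
  rw [hj, zero_add] at h
  rw [h] at h'
  unfold QuarticMap.Tri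
  rw [faceStep_even h2 h6 hj]
  fin_cases k
  · rw [faceStep_even h2 h6 h, faceStep_odd h2 h6 h']
    simp [shift]
    ring
  · rw [faceStep_odd h2 h6 h, faceStep_odd h2 h6 h']
    simp [shift]
    try ring
  · rw [faceStep_odd h2 h6 h, faceStep_even h2 h6 h']
    simp [shift]
    try ring
  · exact absurd rfl hk

theorem tri_of_odd {j : ZMod N} {k : Fin 4} (hj : parity N h2 j = 1) (hk : k ≠ 0) :
    (map h2 h6).Tri (j, k) := by
  have h := parity_shift h2 j k
  have h' := parity_shift h2 (j + shift k) ((![0, 1, 0, 1] : Fin 4 → Fin 4) k)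
  rw [hj] at h
  rw [h] at h'
  unfold QuarticMap.Tri
  rw [faceStep_odd h2 h6 hj]
  fin_cases k
  · exact absurd rfl hk
  · rw [faceStep_even h2 h6 h, faceStep_odd h2 h6 h']
    simp [shift]
    try ring
  · rw [faceStep_even h2 h6 h, faceStep_even h2 h6 h']
    simp [shift]
    try ring
  · rw [faceStep_odd h2 h6 h, faceStep_even h2 h6 h']
    simp [shift]
    try ring

theorem tight : (map h2 h6).Tight := by
  rintro ⟨j, k⟩
  rcases two_cases (parity N h2 j) with hj | hj
  · by_cases hk : k = 3
    · subst hk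
      refine Or.inr (tri_of_even h2 h6 (k := 0) ?_ (by decide))
      rw [parity_shift, hj]
      exact (by decide : 0 + ((shift 3 : ℤ) : ZMod 2) = 0)
    · exact Or.inl (tri_of_even h2 h6 hj hk)
  · by_cases hk : k = 0
    · subst hk
      refine Or.inr (tri_of_odd h2 h6 (k := 3) ?_ (by decide))
      rw [parity_shift, hj]
      exact (by decide : 1 + ((shift 0 : ℤ) : ZMod 2) = 1)
    · exact Or.inl (tri_of_odd h2 h6 hj hk)

/-- Two straight-ahead steps advance by three vertices. -/
theorem knot (h3 : Nat.Coprime 3 N) : (map h2 h6).Knot := by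
  have : NeZero N := ⟨by omega⟩
  refine (map h2 h6).knot_of_forall (0, 0) fun E hr hs h0 => ?_
  have s0 : ∀ j, E (j + 2, 1) ↔ E (j, 0) := fun j => by
    have := hs (j, 0)
    rw [straight_apply] at this
    simpa [shift] using this
  have s1 : ∀ j, E (j + 1, 0) ↔ E (j, 1) := fun j => by
    have := hs (j, 1)
    rw [straight_apply] at this
    simpa [shift] using this
  have h : ∀ j, E (j, 0) := ZMod.forall_of_step h3 (fun i hi => by
    rw [show i + ((3 : ℕ) : ZMod N) = i + 2 + 1 by push_cast; ring, s1, s0]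
    exact hi) h0
  have h1 : ∀ j, E (j, 1) := fun j => (s1 j).1 (h _)
  rintro ⟨j, k⟩
  fin_cases k
  · exact h j
  · exact h1 j
  · exact (hr (j, 2)).1 (h1 _)
  · exact (hr (j, 3)).1 (h _)

theorem exists_link (h2 : 2 ∣ N) (h6 : 6 ≤ N) :
    ∃ (V : Type) (_ : Finite V) (L : LuneFreeLinkGraph V),
      Nat.card V = N ∧ L.Tight ∧ (Nat.Coprime 3 N → L.IsKnot) := by
  have : NeZero N := ⟨by omega⟩
  exact ⟨ZMod N, inferInstance, (planar h2 h6).toLink, Nat.card_zmod N,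
    (tight h2 h6).toLink _, fun h3 => (knot h2 h6 h3).toLink _⟩

end Antiprism

/-! ### Medial maps of prisms -/

namespace Prism

variable (m : ℕ)

/-- Reversal of darts in the prism over an `m`-gon, with vertices `(false, i)` around one base and
`(true, i)` around the other. -/
def opp : (Bool × ZMod m) × Fin 3 → (Bool × ZMod m) × Fin 3
  | ((false, i), 0) => ((true, i), 1)
  | ((false, i), 1) => ((false, i + 1), 2)
  | ((false, i), 2) => ((false, i - 1), 1)
  | ((true, i), 0) => ((true, i + 1), 2)
  | ((true, i), 1) => ((false, i), 0)
  | ((true, i), 2) => ((true, i - 1), 0)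

variable {m}

theorem add_one_ne (h3 : 3 ≤ m) (i : ZMod m) : i + 1 ≠ i := by
  have : Fact (1 < m) := ⟨by omega⟩
  simp

theorem sub_one_ne (h3 : 3 ≤ m) (i : ZMod m) : i - 1 ≠ i := by
  have : Fact (1 < m) := ⟨by omega⟩
  simp

theorem add_one_ne_sub_one (h3 : 3 ≤ m) (i : ZMod m) : i + 1 ≠ i - 1 := by
  intro h
  have h2 : ((2 : ℕ) : ZMod m) = 0 := by
    push_cast
    linear_combination h
  rw [ZMod.natCast_eq_zero_iff] at h2
  have := Nat.le_of_dvd two_pos h2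
  omega

/-- The prism over an `m`-gon. -/
def map (h3 : 3 ≤ m) : CubicMap (Bool × ZMod m) where
  opp := opp m
  opp_opp := by
    rintro ⟨⟨_ | _, i⟩, k⟩ <;> fin_cases k <;> simp [opp]
  opp_fst_ne := by
    rintro ⟨⟨_ | _, i⟩, k⟩ <;> fin_cases k <;> simp [opp, add_one_ne h3, sub_one_ne h3]
  simple := by
    rintro ⟨_ | _, i⟩ k l <;> fin_cases k <;> fin_cases l <;>
      simp [opp, add_one_ne_sub_one h3, (add_one_ne_sub_one h3 _).symm]
  connected p hp := by
    have : NeZero m := ⟨by omega⟩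
    have hf : ∀ i, p (false, i) → ∀ j, p (false, j) := fun i hi =>
      ZMod.forall_of_step (a := 1) (Nat.coprime_one_left m)
        (fun i hi => by simpa [opp] using hp ((false, i), 1) hi) hi
    have hft : ∀ i, p (false, i) → p (true, i) := fun i hi => hp ((false, i), 0) hi
    have htf : ∀ i, p (true, i) → p (false, i) := fun i hi => hp ((true, i), 1) hi
    rintro ⟨_ | _, i⟩ ⟨_ | _, j⟩ h
    · exact hf i h j
    · exact hft j (hf i h j)
    · exact hf i (htf i h) j
    · exact hft j (hf i (htf i h) j)

/-- The faces of the prism: the squares and the two bases. -/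
def label : (Bool × ZMod m) × Fin 3 → ZMod m ⊕ Bool
  | ((false, i), 0) => Sum.inl i
  | ((false, _), 1) => Sum.inr false
  | ((false, i), 2) => Sum.inl (i - 1)
  | ((true, i), 0) => Sum.inl i
  | ((true, i), 1) => Sum.inl (i - 1)
  | ((true, _), 2) => Sum.inr true

theorem planar [NeZero m] (h3 : 3 ≤ m) : (map h3).medial.Planar := by
  refine (map h3).planar_medial label ?_ ?_ ?_
  · rintro (i | _ | _)
    exacts [⟨((false, i), 0), rfl⟩, ⟨((false, 0), 1), rfl⟩, ⟨((true, 0), 2), rfl⟩]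
  · rintro ⟨⟨_ | _, i⟩, k⟩ <;> fin_cases k <;>
      simp [map, opp, label, CubicMap.turn_symm_zero, CubicMap.turn_symm_one,
        CubicMap.turn_symm_two]
  · simp
    ring

/-- Following a strand around the prism leads from a corner to the corresponding corner four
vertices ahead. -/
theorem knot [NeZero m] (h3 : 3 ≤ m) (h2 : Nat.Coprime 4 m) : (map h3).medial.Knot := by
  refine (map h3).knot_medial ((false, 0), 0) fun C hα hβ h0 => ?_
  have a0 : ∀ i, C ((true, i), 1) ↔ C ((false, i), 0) := fun i => hα ((false, i), 0)
  have a1 : ∀ i, C ((false, i + 1), 2) ↔ C ((false, i), 1) := fun i => hα ((false, i), 1)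
  have a2 : ∀ i, C ((true, i + 1), 2) ↔ C ((true, i), 0) := fun i => hα ((true, i), 0)
  have b0 : ∀ i, C ((true, i), 0) ↔ C ((false, i), 2) := fun i => by
    simpa [map, opp, CubicMap.turn_symm_zero, CubicMap.turn_symm_one, CubicMap.turn_symm_two]
      using hβ ((false, i), 0)
  have b1 : ∀ i, C ((false, i + 1), 1) ↔ C ((false, i), 0) := fun i => by
    simpa [map, opp, CubicMap.turn_symm_zero, CubicMap.turn_symm_one, CubicMap.turn_symm_two]
      using hβ ((false, i), 1)
  have b2 : ∀ i, C ((true, i + 1), 1) ↔ C ((true, i), 2) := fun i => by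
    simpa [map, opp, CubicMap.turn_symm_zero, CubicMap.turn_symm_one, CubicMap.turn_symm_two]
      using hβ ((true, i), 0)
  have h : ∀ i, C ((false, i), 0) := ZMod.forall_of_step h2 (fun i hi => by
    rw [show i + ((4 : ℕ) : ZMod m) = i + 1 + 1 + 1 + 1 by push_cast; ring, ← a0, b2, a2, b0, a1,
      b1]
    exact hi) h0
  have e : ∀ i : ZMod m, i - 1 + 1 = i := fun i => sub_add_cancel i 1
  have h1 : ∀ i, C ((false, i), 1) := fun i => by
    rw [← e i, b1]
    exact h _
  have h2 : ∀ i, C ((false, i), 2) := fun i => by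
    rw [← e i, a1]
    exact h1 _
  have h3 : ∀ i, C ((true, i), 0) := fun i => (b0 i).2 (h2 i)
  rintro ⟨⟨_ | _, i⟩, k⟩ <;> fin_cases k
  · exact h i
  · exact h1 i
  · exact h2 i
  · exact h3 i
  · exact (a0 i).2 (h i)
  · have := (a2 (i - 1)).2 (h3 _)
    rwa [e] at this

theorem exists_link (h3 : 3 ≤ m) (h2 : ¬ 2 ∣ m) :
    ∃ (V : Type) (_ : Finite V) (L : LuneFreeLinkGraph V),
      Nat.card V = 3 * m ∧ L.Tight ∧ L.IsKnot := by
  have : NeZero m := ⟨by omega⟩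
  refine ⟨(map h3).Edge, inferInstance, (planar h3).toLink, ?_,
    (map h3).tight_medial.toLink _, (knot h3 ?_).toLink _⟩
  · have := (map h3).two_mul_card_edge
    simp at this
    omega
  · exact ((Nat.Prime.coprime_iff_not_dvd Nat.prime_two).2 h2).pow_left 2

end Prism

/-! ### Medial maps of capped ladders -/

namespace CappedLadder

/-- The two caps of a capped ladder, the lower one for `false` and the upper one for `true`. Both are
prisms over a triangle with an edge cut open: an edge between the bases in the lower cap, an edge of
a base in the upper one. The value at the dart `j` of the vertex `k` is the reversed dart, or the
side of the rail to which `k` is attached by `j`. -/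
def cap : Bool → Fin 6 → Fin 3 → (Fin 6 × Fin 3) ⊕ Bool
  | false =>
    ![![.inr false, .inl (1, 0), .inl (2, 0)], ![.inl (0, 1), .inl (4, 2), .inl (2, 1)],
      ![.inl (0, 2), .inl (1, 2), .inl (5, 0)], ![.inr true, .inl (5, 2), .inl (4, 0)],
      ![.inl (3, 2), .inl (5, 1), .inl (1, 1)], ![.inl (2, 2), .inl (4, 1), .inl (3, 1)]]
  | true =>
    ![![.inl (3, 0), .inr false, .inl (2, 1)], ![.inl (4, 2), .inl (2, 2), .inr true],
      ![.inl (5, 1), .inl (0, 2), .inl (1, 1)], ![.inl (0, 0), .inl (5, 0), .inl (4, 0)],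
      ![.inl (3, 2), .inl (5, 2), .inl (1, 0)], ![.inl (3, 1), .inl (2, 0), .inl (4, 1)]]

/-- The dart of a cap at which the rail on a given side is attached. -/
def port : Bool → Bool → Fin 6 × Fin 3
  | false, false => (0, 0)
  | false, true => (3, 0)
  | true, false => (0, 1)
  | true, true => (1, 2)

variable {r : ℕ}

variable (r) in
/-- The vertices of a capped ladder: those of the caps, and the ends of `r` rungs on the two rails, `false` and `true`. -/
abbrev Vertex : Type := (Bool × Fin 6) ⊕ (Fin r × Bool)

/-- The lower end of the `i`-th edge of a rail. At a vertex of a rail, `0` is the dart going up. -/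
def lower (i : Fin (r + 1)) (s : Bool) : Vertex r × Fin 3 :=
  Fin.cases (.inl (false, (port false s).1), (port false s).2) (fun i => (.inr (i, s), 0)) i

/-- The upper end of the `i`-th edge of a rail. At a vertex of a rail, the dart going down is `1`
on the side `false` and `2` on the side `true`. -/
def upper (i : Fin (r + 1)) (s : Bool) : Vertex r × Fin 3 :=
  Fin.lastCases (.inl (true, (port true s).1), (port true s).2)
    (fun i => (.inr (i, s), bif s then 2 else 1)) i

/-- Reversal of darts. -/
def opp : Vertex r × Fin 3 → Vertex r × Fin 3
  | (.inl (b, k), j) =>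
    match cap b k j with
    | .inl d => (.inl (b, d.1), d.2)
    | .inr s => bif b then lower (Fin.last r) s else upper 0 s
  | (.inr (i, s), 0) => upper i.succ s
  | (.inr (i, false), 1) => lower i.castSucc false
  | (.inr (i, false), 2) => (.inr (i, true), 1)
  | (.inr (i, true), 1) => (.inr (i, false), 2)
  | (.inr (i, true), 2) => lower i.castSucc true

theorem lower_zero (s : Bool) :
    lower (0 : Fin (r + 1)) s = (.inl (false, (port false s).1), (port false s).2) := rfl

theorem upper_last (s : Bool) :
    upper (Fin.last r) s = (.inl (true, (port true s).1), (port true s).2) := by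
  simp [upper]

theorem upper_castSucc (i : Fin r) (s : Bool) :
    upper i.castSucc s = (.inr (i, s), bif s then 2 else 1) := by
  simp [upper]

theorem opp_cap {b : Bool} {k : Fin 6} {j : Fin 3} {d : Fin 6 × Fin 3}
    (h : cap b k j = .inl d) : opp (r := r) (.inl (b, k), j) = (.inl (b, d.1), d.2) := by
  simp [opp, h]

theorem opp_port_false {k : Fin 6} {j : Fin 3} {s : Bool} (h : cap false k j = .inr s) :
    opp (r := r) (.inl (false, k), j) = upper 0 s := by
  simp [opp, h]

theorem opp_port_true {k : Fin 6} {j : Fin 3} {s : Bool} (h : cap true k j = .inr s) :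
    opp (r := r) (.inl (true, k), j) = lower (Fin.last r) s := by
  simp [opp, h]

theorem cap_port (b s : Bool) : cap b (port b s).1 (port b s).2 = .inr s := by
  revert b s; decide

theorem port_of_cap {b s : Bool} {k : Fin 6} {j : Fin 3} (h : cap b k j = .inr s) :
    (k, j) = port b s := by
  revert b s k j; decide

theorem cap_cap {b : Bool} {k : Fin 6} {j : Fin 3} {d : Fin 6 × Fin 3} (h : cap b k j = .inl d) :
    cap b d.1 d.2 = .inl (k, j) := by
  revert b k j d; decide

theorem opp_lower (i : Fin (r + 1)) (s : Bool) : opp (lower i s) = upper i s := by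
  induction i using Fin.cases with
  | zero => rw [lower_zero, opp_port_false (cap_port _ _)]
  | succ i => rfl

theorem opp_upper (i : Fin (r + 1)) (s : Bool) : opp (upper i s) = lower i s := by
  induction i using Fin.lastCases with
  | last => rw [upper_last, opp_port_true (cap_port _ _)]
  | cast i =>
    rw [upper_castSucc]
    cases s <;> rfl

/-- The darts, sorted by the edges to which they belong. -/
theorem dart_cases {p : Vertex r × Fin 3 → Prop} (hl : ∀ i s, p (lower i s))
    (hu : ∀ i s, p (upper i s)) (hc : ∀ b k j d, cap b k j = .inl d → p (.inl (b, k), j))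
    (hf : ∀ i, p (.inr (i, false), 2)) (ht : ∀ i, p (.inr (i, true), 1)) (x) : p x := by
  obtain ⟨⟨b, k⟩ | ⟨i, s⟩, j⟩ := x
  · rcases h : cap b k j with d | s
    · exact hc b k j d h
    · have h' := port_of_cap h
      have e : k = (port b s).1 ∧ j = (port b s).2 := ⟨congrArg Prod.fst h', congrArg Prod.snd h'⟩
      rw [e.1, e.2]
      cases b
      · exact hl 0 s
      · exact upper_last (r := r) s ▸ hu (Fin.last r) s
  · have h0 : ∀ s, p (.inr (i, s), 0) := fun s => hl i.succ s
    have h1 := fun s => upper_castSucc i s ▸ hu i.castSucc s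
    cases s <;> fin_cases j
    exacts [h0 _, h1 false, hf i, h0 _, ht i, h1 true]

/-- The height of a vertex: opposite darts along the rails lead to adjacent heights. -/
def height : Vertex r → ℕ
  | .inl (b, _) => bif b then r + 1 else 0
  | .inr (i, _) => i + 1

theorem height_lower (i : Fin (r + 1)) (s : Bool) : height (lower i s).1 = i := by
  induction i using Fin.cases with
  | zero => rfl
  | succ i => rfl

theorem height_upper (i : Fin (r + 1)) (s : Bool) : height (upper i s).1 = i + 1 := by
  induction i using Fin.lastCases with
  | last => rw [upper_last]; rfl
  | cast i => rw [upper_castSucc]; rfl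

theorem opp_opp (x : Vertex r × Fin 3) : opp (opp x) = x := by
  refine dart_cases (p := fun x => opp (opp x) = x) (fun i s => ?_) (fun i s => ?_)
    (fun b k j d h => ?_) (fun i => rfl) (fun i => rfl) x
  · rw [opp_lower, opp_upper]
  · rw [opp_upper, opp_lower]
  · rw [opp_cap h, opp_cap (cap_cap h)]

theorem cap_fst_ne {b : Bool} {k : Fin 6} {j : Fin 3} {d : Fin 6 × Fin 3}
    (h : cap b k j = .inl d) : d.1 ≠ k := by
  revert b k j d; decide

theorem cap_simple {b : Bool} {k : Fin 6} {i j : Fin 3}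
    (h : (cap b k i).map Prod.fst (fun _ => ()) = (cap b k j).map Prod.fst (fun _ => ())) :
    i = j := by
  revert b k i j; decide

theorem height_opp_port {b s : Bool} {k : Fin 6} {i : Fin 3} (h : cap b k i = .inr s) :
    height (opp (r := r) (.inl (b, k), i)).1 ≠ height (r := r) (.inl (b, k)) := by
  cases b
  · rw [opp_port_false h, height_upper]
    simp [height]
  · rw [opp_port_true h, height_lower]
    simp [height]

/-- The heights of the neighbours of a vertex of a rail, relative to the lowest of them. -/
def heightStep (s : Bool) : Fin 3 → ℕ :=
  bif s then ![2, 1, 0] else ![2, 0, 1]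

theorem height_opp_rail (l : Fin r) (s : Bool) (j : Fin 3) :
    height (opp (.inr (l, s), j)).1 = l + heightStep s j := by
  cases s <;> fin_cases j
  exacts [height_upper l.succ _, height_lower l.castSucc _, rfl, height_upper l.succ _, rfl,
    height_lower l.castSucc _]

theorem opp_simple (t : Vertex r) (i j : Fin 3)
    (h : (opp (t, i)).1 = (opp (t, j)).1) : i = j := by
  obtain ⟨b, k⟩ | ⟨l, s⟩ := t
  · rcases hi : cap b k i with d | s <;> rcases hj : cap b k j with e | s'
    · rw [opp_cap hi, opp_cap hj] at h
      exact cap_simple (b := b) (k := k) (by simpa [hi, hj] using h)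
    · exact absurd (by rw [← h, opp_cap hi]; rfl) (height_opp_port (r := r) hj)
    · exact absurd (by rw [h, opp_cap hj]; rfl) (height_opp_port (r := r) hi)
    · exact cap_simple (by rw [hi, hj]; rfl)
  · have h := congrArg height h
    rw [height_opp_rail, height_opp_rail] at h
    have h' : ∀ s i j, heightStep s i = heightStep s j → i = j := by decide
    exact h' s i j (by omega)

/-- The capped ladder with `r` rungs. -/
def map (r : ℕ) : CubicMap (Vertex r) where
  opp := opp
  opp_opp := opp_opp
  opp_fst_ne x := by
    refine dart_cases (p := fun x => (opp x).1 ≠ x.1) (fun i s h => ?_) (fun i s h => ?_)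
      (fun b k j d h => ?_) (fun i => by simp [opp]) (fun i => by simp [opp]) x
    · rw [opp_lower] at h
      have := congrArg height h
      rw [height_upper, height_lower] at this
      omega
    · rw [opp_upper] at h
      have := congrArg height h
      rw [height_upper, height_lower] at this
      omega
    · rw [opp_cap h]
      simpa using cap_fst_ne h
  simple := opp_simple
  connected p hp := by
    have hp' : ∀ x : Vertex r × Fin 3, p (opp x).1 ↔ p x.1 := fun x =>
      ⟨fun h => opp_opp x ▸ hp _ h, hp x⟩
    have hc : ∀ b k, p (.inl (b, k)) ↔ p (.inl (b, 0)) := by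
      intro b
      have h : ∀ k j d, cap b k j = .inl d → (p (.inl (b, d.1)) ↔ p (.inl (b, k))) := by
        intro k j d h
        have := hp' (.inl (b, k), j)
        rwa [opp_cap h] at this
      intro k
      cases b
      · have h1 := h 0 1 _ rfl
        have h2 := h 0 2 _ rfl
        have h4 := (h 1 1 _ rfl).trans h1
        have h5 := (h 2 2 _ rfl).trans h2
        have h3 := (h 4 0 _ rfl).trans h4
        fin_cases k
        exacts [Iff.rfl, h1, h2, h3, h4, h5]
      · have h3 := h 0 0 _ rfl
        have h2 := h 0 2 _ rfl
        have h1 := (h 2 2 _ rfl).trans h2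
        have h4 := (h 3 2 _ rfl).trans h3
        have h5 := (h 3 1 _ rfl).trans h3
        fin_cases k
        exacts [Iff.rfl, h1, h2, h3, h4, h5]
    have hl : ∀ (i : Fin (r + 1)) s, p (lower i s).1 ↔ p (.inl (false, 0)) := by
      intro i s
      induction i using Fin.induction with
      | zero => exact hc _ _
      | succ i ih =>
        rw [← ih, ← hp' (lower i.castSucc s), opp_lower, upper_castSucc]
        rfl
    have h : ∀ t, p t ↔ p (.inl (false, 0)) := by
      rintro (⟨_ | _, k⟩ | ⟨i, s⟩)
      · exact hc _ _
      · rw [← hl (Fin.last r) false, ← hp' (lower (Fin.last r) false), opp_lower, upper_last, hc,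
          ← hc _ (port true false).1]
      · exact hl i.succ s
    intro t u ht
    rwa [h, ← h t]

/-- The faces inside the caps, and those adjacent to the rails: `none` stands for the face between
the rails, and `some 6` for the outer face. -/
def capLabel : Bool → Fin 6 → Fin 3 → Option (Fin 7)
  | false =>
    ![![some 6, some 0, none], ![some 6, some 1, some 0], ![some 0, some 1, none],
      ![none, some 2, some 6], ![some 2, some 1, some 6], ![some 1, some 2, none]]
  | true =>
    ![![some 6, none, some 3], ![some 4, none, some 6], ![some 3, none, some 4],
      ![some 3, some 5, some 6], ![some 5, some 4, some 6], ![some 3, some 4, some 5]]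

/-- The faces of a capped ladder: the `r + 1` faces between the rails, and those labelled by
`capLabel`. -/
def label : Vertex r × Fin 3 → Fin (r + 1) ⊕ Fin 7
  | (.inl (b, k), j) => (capLabel b k j).elim (.inl (bif b then Fin.last r else 0)) .inr
  | (.inr (i, false), j) =>
    (![.inr 6, .inl i.castSucc, .inl i.succ] : Fin 3 → Fin (r + 1) ⊕ Fin 7) j
  | (.inr (i, true), j) =>
    (![.inl i.succ, .inl i.castSucc, .inr 6] : Fin 3 → Fin (r + 1) ⊕ Fin 7) j

theorem turn_symm (t : Vertex r) (j : Fin 3) :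
    (CubicMap.turn (Vertex r)).symm (t, j) = (t, j - 1) := rfl

theorem label_lower (i : Fin (r + 1)) (s : Bool) :
    label (lower i s) = bif s then .inl i else .inr 6 := by
  induction i using Fin.cases <;> cases s <;> rfl

theorem label_turn_lower (i : Fin (r + 1)) (s : Bool) :
    label ((CubicMap.turn _).symm (lower i s)) = bif s then .inr 6 else .inl i := by
  induction i using Fin.cases <;> cases s <;> rfl

theorem label_upper (i : Fin (r + 1)) (s : Bool) :
    label (upper i s) = bif s then .inr 6 else .inl i := by
  induction i using Fin.lastCases
  · rw [upper_last]; cases s <;> rfl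
  · rw [upper_castSucc]; cases s <;> rfl

theorem label_turn_upper (i : Fin (r + 1)) (s : Bool) :
    label ((CubicMap.turn _).symm (upper i s)) = bif s then .inl i else .inr 6 := by
  induction i using Fin.lastCases
  · rw [upper_last]; cases s <;> rfl
  · rw [upper_castSucc]; cases s <;> rfl

theorem planar (r : ℕ) : (map r).medial.Planar := by
  refine (map r).planar_medial label ?_ (fun x => ?_) ?_
  · rintro (i | f)
    · exact ⟨lower i true, label_lower i true⟩
    · have h : ∀ f, ∃ b k j, capLabel b k j = some f := by decide
      obtain ⟨b, k, j, h⟩ := h f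
      exact ⟨(.inl (b, k), j), by simp [label, h]⟩
  · refine dart_cases (p := fun x => label ((CubicMap.turn _).symm (opp x)) = label x)
      (fun i s => ?_) (fun i s => ?_) (fun b k j d h => ?_)
      (fun i => by simp [opp, turn_symm, label]) (fun i => by simp [opp, turn_symm, label]) x
    · rw [opp_lower, label_turn_upper, label_lower]
    · rw [opp_upper, label_turn_lower, label_upper]
    · have h' : ∀ b k j d, cap b k j = .inl d → capLabel b d.1 (d.2 - 1) = capLabel b k j := by
        decide
      rw [opp_cap h, turn_symm]
      simp only [label, h' b k j d h]
  · simp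
    ring

/-- How the lower cap joins the strands along the rails, none being confined to the cap. -/
theorem lower_cap_corners {C : Fin 6 → Fin 3 → Prop}
    (hα : ∀ k j d, cap false k j = .inl d → (C d.1 d.2 ↔ C k j))
    (hβ : ∀ k j d, cap false k j = .inl d → (C d.1 (d.2 - 1) ↔ C k (j - 1))) :
    (C 0 2 ↔ C 0 0) ∧ (C 3 2 ↔ C 3 0) ∧ (C 0 0 → C 3 0 → ∀ k j, C k j) := by
  have a1 := hα 0 1 _ rfl
  have a2 := hα 0 2 _ rfl
  have a3 := hα 1 1 _ rfl
  have a4 := hα 1 2 _ rfl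
  have a5 := hα 2 2 _ rfl
  have a6 := hα 3 1 _ rfl
  have a7 := hα 3 2 _ rfl
  have a8 := hα 4 1 _ rfl
  have b1 : C 1 2 ↔ C 0 0 := hβ 0 1 _ rfl
  have b2 : C 2 2 ↔ C 0 1 := hβ 0 2 _ rfl
  have b3 : C 4 1 ↔ C 1 0 := hβ 1 1 _ rfl
  have b4 : C 2 0 ↔ C 1 1 := hβ 1 2 _ rfl
  have b5 : C 5 2 ↔ C 2 1 := hβ 2 2 _ rfl
  have b6 : C 5 1 ↔ C 3 0 := hβ 3 1 _ rfl
  have b7 : C 4 2 ↔ C 3 1 := hβ 3 2 _ rfl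
  have b8 : C 5 0 ↔ C 4 0 := hβ 4 1 _ rfl
  refine ⟨by grind, by grind, fun h0 h3 k j => ?_⟩
  fin_cases k <;> fin_cases j <;> grind

/-- How the upper cap joins the strands along the rails, none being confined to the cap. -/
theorem upper_cap_corners {C : Fin 6 → Fin 3 → Prop}
    (hα : ∀ k j d, cap true k j = .inl d → (C d.1 d.2 ↔ C k j))
    (hβ : ∀ k j d, cap true k j = .inl d → (C d.1 (d.2 - 1) ↔ C k (j - 1))) :
    (C 1 1 ↔ C 0 1) ∧ (C 1 2 ↔ C 0 0) ∧ (C 0 1 → C 0 0 → ∀ k j, C k j) := by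
  have a1 := hα 0 0 _ rfl
  have a2 := hα 0 2 _ rfl
  have a3 := hα 1 0 _ rfl
  have a4 := hα 1 1 _ rfl
  have a5 := hα 2 0 _ rfl
  have a6 := hα 3 1 _ rfl
  have a7 := hα 3 2 _ rfl
  have a8 := hα 4 1 _ rfl
  have b1 : C 3 2 ↔ C 0 2 := hβ 0 0 _ rfl
  have b2 : C 2 0 ↔ C 0 1 := hβ 0 2 _ rfl
  have b3 : C 4 1 ↔ C 1 2 := hβ 1 0 _ rfl
  have b4 : C 2 1 ↔ C 1 0 := hβ 1 1 _ rfl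
  have b5 : C 5 0 ↔ C 2 2 := hβ 2 0 _ rfl
  have b6 : C 5 2 ↔ C 3 0 := hβ 3 1 _ rfl
  have b7 : C 4 2 ↔ C 3 1 := hβ 3 2 _ rfl
  have b8 : C 5 1 ↔ C 4 0 := hβ 4 1 _ rfl
  refine ⟨by grind, by grind, fun h0 h3 k j => ?_⟩
  fin_cases k <;> fin_cases j <;> grind

theorem corner_upper {C : Vertex r × Fin 3 → Prop} (hα : ∀ x, C (opp x) ↔ C x) (i : Fin (r + 1)) (s : Bool) :
    C (upper i s) ↔ C (lower i s) := by
  rw [← opp_lower, hα]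

theorem turn_corner_upper {C : Vertex r × Fin 3 → Prop}
    (hβ : ∀ x, C ((CubicMap.turn _).symm (opp x)) ↔ C ((CubicMap.turn _).symm x))
    (i : Fin (r + 1)) (s : Bool) :
    C ((CubicMap.turn _).symm (upper i s)) ↔ C ((CubicMap.turn _).symm (lower i s)) := by
  rw [← opp_lower, hβ]

/-- A rung permutes the four strands along the rails cyclically. -/
theorem corners_succ {C : Vertex r × Fin 3 → Prop} (hα : ∀ x, C (opp x) ↔ C x)
    (hβ : ∀ x, C ((CubicMap.turn _).symm (opp x)) ↔ C ((CubicMap.turn _).symm x)) (i : Fin r) :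
    (C (lower i.succ false) ↔ C ((CubicMap.turn _).symm (lower i.castSucc false))) ∧
    (C ((CubicMap.turn _).symm (lower i.succ false)) ↔
      C ((CubicMap.turn _).symm (lower i.castSucc true))) ∧
    (C (lower i.succ true) ↔ C (lower i.castSucc false)) ∧
    (C ((CubicMap.turn _).symm (lower i.succ true)) ↔ C (lower i.castSucc true)) := by
  rw [← corner_upper hα i.castSucc, ← corner_upper hα i.castSucc,
    ← turn_corner_upper hβ i.castSucc, ← turn_corner_upper hβ i.castSucc]
  simp only [upper_castSucc]
  have h : C (.inr (i, true), 0) ↔ C (.inr (i, false), 1) := by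
    simpa [opp, turn_symm] using hβ (.inr (i, false), 2)
  exact ⟨Iff.rfl, (hα (.inr (i, false), 2)).symm, h, Iff.rfl⟩

theorem cap_corner {C : Vertex r × Fin 3 → Prop} (hα : ∀ x, C (opp x) ↔ C x) {b : Bool} (k : Fin 6)
    (j : Fin 3) (d : Fin 6 × Fin 3) (h : cap b k j = .inl d) :
    C (.inl (b, d.1), d.2) ↔ C (.inl (b, k), j) := by
  rw [← opp_cap h, hα]

theorem turn_cap_corner {C : Vertex r × Fin 3 → Prop}
    (hβ : ∀ x, C ((CubicMap.turn _).symm (opp x)) ↔ C ((CubicMap.turn _).symm x)) {b : Bool}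
    (k : Fin 6) (j : Fin 3) (d : Fin 6 × Fin 3) (h : cap b k j = .inl d) :
    C (.inl (b, d.1), d.2 - 1) ↔ C (.inl (b, k), j - 1) := by
  have := hβ (.inl (b, k), j)
  rwa [opp_cap h, turn_symm, turn_symm] at this

/-- `P i`, `Q i`, `R i`, `S i` tell which of the four strands along the rails belong to a given
union of strands. The lower cap joins two pairs, whose position among the four alternates from rung
to rung; the upper cap joins two other pairs, whatever the number of rungs. -/
theorem forall_of_rungs {P Q R S : Fin (r + 1) → Prop}
    (h : ∀ i : Fin r, (P i.succ ↔ Q i.castSucc) ∧ (Q i.succ ↔ S i.castSucc) ∧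
      (R i.succ ↔ P i.castSucc) ∧ (S i.succ ↔ R i.castSucc))
    (hPQ : P 0 ↔ Q 0) (hRS : R 0 ↔ S 0) (hPS : P (Fin.last r) ↔ S (Fin.last r))
    (hQR : Q (Fin.last r) ↔ R (Fin.last r)) (h0 : P 0) (i : Fin (r + 1)) :
    P i ∧ Q i ∧ R i ∧ S i := by
  have inv : ∀ i, ((P i ↔ Q i) ∧ (R i ↔ S i)) ∨ ((P i ↔ R i) ∧ (Q i ↔ S i)) := by
    intro i
    induction i using Fin.induction with
    | zero => exact Or.inl ⟨hPQ, hRS⟩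
    | succ i ih =>
      obtain ⟨e1, e2, e3, e4⟩ := h i
      rw [e1, e2, e3, e4]
      rcases ih with ⟨h1, h2⟩ | ⟨h1, h2⟩
      · exact Or.inr ⟨h1.symm, h2.symm⟩
      · exact Or.inl ⟨h2, h1⟩
  have eq : ∀ i, (P i ↔ Q i) ∧ (Q i ↔ R i) ∧ (R i ↔ S i) := by
    intro i
    induction i using Fin.reverseInduction with
    | last =>
      rcases inv (Fin.last r) with ⟨h1, h2⟩ | ⟨h1, h2⟩
      · exact ⟨h1, hQR, h2⟩
      · exact ⟨h1.trans hQR.symm, hQR, h1.symm.trans hPS⟩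
    | cast i ih =>
      obtain ⟨e1, e2, e3, e4⟩ := h i
      obtain ⟨h1, h2, h3⟩ := ih
      rw [e1, e2] at h1
      rw [e2, e3] at h2
      rw [e3, e4] at h3
      exact ⟨(h1.trans h2).symm, h1.trans (h2.trans h3), (h1.trans (h2.trans h3)).symm.trans h1⟩
  have hP : P i := by
    induction i using Fin.induction with
    | zero => exact h0
    | succ i ih => exact (h i).1.2 ((eq _).1.1 ih)
  have hQ := (eq i).1.1 hP
  have hR := (eq i).2.1.1 hQ
  exact ⟨hP, hQ, hR, (eq i).2.2.1 hR⟩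

theorem knot (r : ℕ) : (map r).medial.Knot := by
  refine (map r).knot_medial (lower 0 false) fun C hα hβ h0 => ?_
  replace hα : ∀ x, C (opp x) ↔ C x := hα
  replace hβ : ∀ x, C ((CubicMap.turn _).symm (opp x)) ↔ C ((CubicMap.turn _).symm x) := hβ
  obtain ⟨l1, l2, l3⟩ := lower_cap_corners (C := fun k j => C (.inl (false, k), j))
    (cap_corner hα) (turn_cap_corner hβ)
  obtain ⟨t1, t2, t3⟩ := upper_cap_corners (C := fun k j => C (.inl (true, k), j))
    (cap_corner hα) (turn_cap_corner hβ)
  have x1 := corner_upper hα (Fin.last r) false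
  have x2 := turn_corner_upper hβ (Fin.last r) false
  have x3 := corner_upper hα (Fin.last r) true
  have x4 := turn_corner_upper hβ (Fin.last r) true
  rw [upper_last] at x1 x2 x3 x4
  have all := forall_of_rungs (P := fun i => C (lower i false))
    (Q := fun i => C ((CubicMap.turn _).symm (lower i false))) (R := fun i => C (lower i true))
    (S := fun i => C ((CubicMap.turn _).symm (lower i true))) (corners_succ hα hβ) l1.symm l2.symm
    (x1.symm.trans (t1.symm.trans x4)) (x2.symm.trans (t2.symm.trans x3)) h0
  rintro ⟨⟨_ | _, k⟩ | ⟨i, s⟩, j⟩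
  · exact l3 h0 (all 0).2.2.1 k j
  · exact t3 (x1.2 (all _).1) (x2.2 (all _).2.1) k j
  · obtain ⟨h1, h2, h3, h4⟩ := all i.succ
    obtain ⟨h5, -, h6, h7⟩ := all i.castSucc
    rw [← corner_upper hα, upper_castSucc] at h5 h6
    rw [← turn_corner_upper hβ, upper_castSucc] at h7
    cases s <;> fin_cases j
    exacts [h1, h5, h2, h3, h7, h6]

theorem exists_link (r : ℕ) :
    ∃ (V : Type) (_ : Finite V) (L : LuneFreeLinkGraph V),
      Nat.card V = 18 + 3 * r ∧ L.Tight ∧ L.IsKnot := by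
  refine ⟨(map r).Edge, inferInstance, (planar r).toLink, ?_,
    (map r).tight_medial.toLink _, (knot r).toLink _⟩
  have := (map r).two_mul_card_edge
  simp at this
  omega

end CappedLadder

/-! ### The numbers of crossings -/

theorem theorem4 (v : ℕ) :
    ((∃ (V : Type) (_ : Finite V) (L : LuneFreeLinkGraph V), Nat.card V = v ∧ L.Tight) ↔
      6 ≤ v ∧ ¬ (v : ℤ) ≡ 1 [ZMOD 6] ∧ ¬ (v : ℤ) ≡ -1 [ZMOD 6]) ∧
    ((∃ (V : Type) (_ : Finite V) (L : LuneFreeLinkGraph V),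
        Nat.card V = v ∧ L.Tight ∧ L.IsKnot) ↔
      8 ≤ v ∧ ¬ (v : ℤ) ≡ 1 [ZMOD 6] ∧ ¬ (v : ℤ) ≡ -1 [ZMOD 6] ∧ v ≠ 12) := by
  have h6 : (¬ (v : ℤ) ≡ 1 [ZMOD 6] ∧ ¬ (v : ℤ) ≡ -1 [ZMOD 6]) ↔ 2 ∣ v ∨ 3 ∣ v := by
    simp only [Int.ModEq]
    omega
  rw [← and_assoc (a := ¬ (v : ℤ) ≡ 1 [ZMOD 6]), h6]
  constructor <;> constructor
  · rintro ⟨V, _, L, rfl, ht⟩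
    exact ht.card
  · rintro ⟨hv, h⟩
    by_cases h2 : 2 ∣ v
    · obtain ⟨V, hV, L, hc, ht, -⟩ := Antiprism.exists_link h2 hv
      exact ⟨V, hV, L, hc, ht⟩
    · obtain ⟨m, rfl⟩ := h.resolve_left h2
      obtain ⟨V, hV, L, hc, ht, -⟩ := Prism.exists_link (m := m) (by omega) (by omega)
      exact ⟨V, hV, L, hc, ht⟩
  · rintro ⟨V, _, L, rfl, ht, hk⟩
    exact ⟨(hk.card ht).1, ht.card.2, (hk.card ht).2⟩
  · rintro ⟨hv, h, h12⟩
    by_cases h3 : 3 ∣ v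
    · obtain ⟨m, rfl⟩ := h3
      by_cases hm : m < 6
      · exact Prism.exists_link (m := m) (by omega) (by omega)
      · obtain ⟨r, rfl⟩ := Nat.exists_eq_add_of_le (not_lt.1 hm)
        rw [mul_add]
        exact CappedLadder.exists_link r
    · obtain ⟨V, hV, L, hc, ht, hk⟩ :=
        Antiprism.exists_link (h.resolve_right h3) (show 6 ≤ v by omega)
      exact ⟨V, hV, L, hc, ht, hk ((Nat.Prime.coprime_iff_not_dvd Nat.prime_three).2 h3)⟩
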